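/- **Model.** An algorithm is a deterministic word RAM program: a fixed finite program over registers and indirectly addressed memory arrays, with unit-cost arithmetic, comparison, bitwise and shift operations, branches and loops, whose words on inputs of size $n$ have $\kappa\cdot(\lfloor\log_2 n\rfloor+1)$ bits for a constant $\kappa$ of the algorithm (no larger number may be produced), and whose memory is zero at the start apart from the input. Time is the number of executed steps, and $[n]=\{1,\dots,n\}$. **Deterministic 3SUM hypothesis.** For every $\varepsilon>0$ there is a constant $c$ such that no deterministic algorithm decides in time $O(n^{2-\varepsilon})$, given a set $A\subseteq[n^c]$ of size $n\ge 1$ (listed in arbitrary order), whether there are $x,y,z\in A$ with $x+y=z$. **Convolution Witness.** A data structure for this problem preprocesses two vectors $X,Y\in\{0,1\}^n$ ($n\ge1$). Afterwards it answers any sequence of queries $k\in[n]$, one after the other: a query $k$ must be answered with the list (without repetitions, in any order) of all witnesses, i.e. of the set $W_k=\{(i,j)\in[n]^2 : i+j=k,\ X[i]=Y[j]=1\}$. Queries may modify the memory. The query time is $O(Q(n))$ per witness if each query $k$ takes time at most $C\,Q(n)\,(1+|W_k|)$, for a constant $C$ independent of $n,X,Y,k$ and of the earlier queries. **Theorem.**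 Let $0<\alpha<1$ and assume the deterministic 3SUM hypothesis. Then for every $\varepsilon>0$ there is no deterministic data structure for Convolution Witness with preprocessing time $O(n^{2-\alpha})$ and query time $O(n^{\alpha/2-\varepsilon})$ per witness. -/

import Mathlib

namespace WordRAM

/-- The unit-cost operations on machine words. Subtraction is truncated at `0`, a quotient with
divisor `0` is `0`, and comparisons return `1` (true) or `0` (false). -/
inductive BinOp where
  | add | sub | mul | div | mod | lt | eq | land | lor | xor | shiftl | shiftr

/-- The value of an operation on two words. -/
def BinOp.eval : BinOp → ℕ → ℕ → ℕ
  | .add, x, y => x + y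
  | .sub, x, y => x - y
  | .mul, x, y => x * y
  | .div, x, y => x / y
  | .mod, x, y => x % y
  | .lt, x, y => if x < y then 1 else 0
  | .eq, x, y => if x = y then 1 else 0
  | .land, x, y => x &&& y
  | .lor, x, y => x ||| y
  | .xor, x, y => x ^^^ y
  | .shiftl, x, y => x <<< y
  | .shiftr, x, y => x >>> y

/-- Deterministic word RAM programs, in structured form. A program is a finite object, so it
mentions finitely many registers, finitely many memory arrays and finitely many constants.
The cells of a memory array are addressed by the contents of a register (indirect addressing).
Jumps are not needed as a primitive: a fixed program with jumps is a loop around a case distinction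
on its program counter, with constant overhead. -/
inductive Prog where
  /-- no operation -/
  | skip
  /-- `R[d] := c` -/
  | const (d c : ℕ)
  /-- `R[d] := R[a] o R[b]` -/
  | op (o : BinOp) (d a b : ℕ)
  /-- `R[d] := M_r[R[a]]` -/
  | load (d r a : ℕ)
  /-- `M_r[R[a]] := R[b]` -/
  | store (r a b : ℕ)
  /-- `p; q` -/
  | seq (p q : Prog)
  /-- `if R[a] ≠ 0 then p else q` -/
  | ite (a : ℕ) (p q : Prog)
  /-- `while R[a] ≠ 0 do p` -/
  | loop (a : ℕ) (p : Prog)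

/-- A memory configuration: the registers, and the memory arrays `mem r`. -/
@[ext]
structure State where
  reg : ℕ → ℕ
  mem : ℕ → ℕ → ℕ

/-- `R[d] := v`. -/
def State.setReg (s : State) (d v : ℕ) : State :=
  { s with reg := Function.update s.reg d v }

/-- `M_r[i] := v`. -/
def State.setMem (s : State) (r i v : ℕ) : State :=
  { s with mem := Function.update s.mem r (Function.update (s.mem r) i v) }

/-- `Exec w p s t s'`: on a machine with `w`-bit words, the program `p` started in `s` halts in `s'`
after exactly `t` steps. Each elementary instruction and each test of a branch or a loop is one step.
A value that does not fit in a word cannot be produced: such a run is stuck, it does not halt. -/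
inductive Exec (w : ℕ) : Prog → State → ℕ → State → Prop
  | skip (s : State) : Exec w .skip s 1 s
  | const (d c : ℕ) (s : State) (hc : c < 2 ^ w) : Exec w (.const d c) s 1 (s.setReg d c)
  | op (o : BinOp) (d a b : ℕ) (s : State) (h : o.eval (s.reg a) (s.reg b) < 2 ^ w) :
      Exec w (.op o d a b) s 1 (s.setReg d (o.eval (s.reg a) (s.reg b)))
  | load (d r a : ℕ) (s : State) :
      Exec w (.load d r a) s 1 (s.setReg d (s.mem r (s.reg a)))
  | store (r a b : ℕ) (s : State) :
      Exec w (.store r a b) s 1 (s.setMem r (s.reg a) (s.reg b))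
  | seq {p q : Prog} {s s' s'' : State} {t t' : ℕ} (hp : Exec w p s t s')
      (hq : Exec w q s' t' s'') : Exec w (.seq p q) s (t + t') s''
  | ite_true {a : ℕ} {p q : Prog} {s s' : State} {t : ℕ} (ha : s.reg a ≠ 0)
      (hp : Exec w p s t s') : Exec w (.ite a p q) s (t + 1) s'
  | ite_false {a : ℕ} {p q : Prog} {s s' : State} {t : ℕ} (ha : s.reg a = 0)
      (hq : Exec w q s t s') : Exec w (.ite a p q) s (t + 1) s'
  | loop_false {a : ℕ} {p : Prog} {s : State} (ha : s.reg a = 0) : Exec w (.loop a p) s 1 s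
  | loop_true {a : ℕ} {p : Prog} {s s' s'' : State} {t t' : ℕ} (ha : s.reg a ≠ 0)
      (hp : Exec w p s t s') (hl : Exec w (.loop a p) s' t' s'') :
      Exec w (.loop a p) s (t + t' + 1) s''

/-- The word length for inputs of size `n`: `κ * (⌊log₂ n⌋ + 1)` bits, for a constant `κ` that
belongs to the algorithm. A word thus holds numbers up to a fixed polynomial in `n`. -/
def wordLength (κ n : ℕ) : ℕ := κ * (Nat.log 2 n + 1)

end WordRAM

open WordRAM in
/-- Initial configuration for an array `a[1], …, a[n]`: `R[0] = n`, the entry `a[i]` is in cell `i`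
of array `0`, and everything else is `0`. -/
def threeSumInput (n : ℕ) (a : ℕ → ℕ) : State where
  reg := fun r => if r = 0 then n else 0
  mem := fun r i => if r = 0 ∧ i ∈ Finset.Icc 1 n then a i else 0

open WordRAM in
/-- 3SUM over `[n ^ c]` is solved by a deterministic word RAM algorithm in time `O(T n)`: the input
is a set `A ⊆ {1, …, n ^ c}` of size `n`, listed in an arbitrary order, and the algorithm halts with
`R[0] = 1` if and only if there are `x, y, z ∈ A` with `x + y = z`. -/
def ThreeSumSolvable (c : ℕ) (T : ℕ → ℝ) : Prop :=
  ∃ (p : Prog) (κ : ℕ) (C : ℝ), ∀ n : ℕ, 1 ≤ n →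
    ∀ A : Finset ℕ, A ⊆ Finset.Icc 1 (n ^ c) → A.card = n →
    ∀ a : ℕ → ℕ, Set.BijOn a (Set.Icc 1 n) A →
      ∃ (t : ℕ) (s : State), Exec (wordLength κ n) p (threeSumInput n a) t s ∧
        (s.reg 0 = 1 ↔ ∃ x ∈ A, ∃ y ∈ A, ∃ z ∈ A, x + y = z) ∧
        (t : ℝ) ≤ C * T n

/-- The deterministic 3SUM hypothesis: for every `ε > 0` there is a constant `c` such that no
deterministic algorithm solves 3SUM over `[n ^ c]` in time `O(n ^ (2 - ε))`. -/
def DeterministicThreeSumHypothesis : Prop :=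
  ∀ ε : ℝ, 0 < ε → ∃ c : ℕ, ¬ ThreeSumSolvable c (fun n => (n : ℝ) ^ (2 - ε))

/-- The witnesses of the index `k` for the vectors `X[1..n]`, `Y[1..n]`: the pairs `(i, j)` in
`[n] × [n]` with `i + j = k` and `X[i] = Y[j] = 1`. -/
def convWitnesses (n : ℕ) (X Y : ℕ → Bool) (k : ℕ) : Finset (ℕ × ℕ) :=
  (Finset.Icc 1 n ×ˢ Finset.Icc 1 n).filter
    fun q => q.1 + q.2 = k ∧ X q.1 = true ∧ Y q.2 = true

open WordRAM in
/-- Initial configuration for two bit vectors of length `n`: `R[0] = n`, the bits `X[i]` and `Y[i]`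
are in cell `i` of array `0` and of array `1`, and everything else is `0`. -/
def convInput (n : ℕ) (X Y : ℕ → Bool) : State where
  reg := fun r => if r = 0 then n else 0
  mem := fun r i =>
    if i ∈ Finset.Icc 1 n then
      (if r = 0 then (X i).toNat else if r = 1 then (Y i).toNat else 0)
    else 0

open WordRAM in
/-- The finite set `W` of pairs has been output as a list without repetitions: `R[0]` is the number
of its elements and the `t`-th element is `(M₂[t], M₃[t])`, for `t < R[0]`. -/
def ReturnsPairs (s : State) (W : Finset (ℕ × ℕ)) : Prop :=
  s.reg 0 = W.card ∧ (Finset.range (s.reg 0)).image (fun t => (s.mem 2 t, s.mem 3 t)) = W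

open WordRAM in
/-- The configurations that arise from `s₀` by answering finitely many queries, one after the other,
with the program `q`. A query `k ∈ [n]` is asked by writing `k` to `R[0]`; apart from that, `q` is
started in the configuration which the previous query has left behind. -/
inductive AfterQueries (w : ℕ) (q : Prog) (n : ℕ) (s₀ : State) : State → Prop
  | init : AfterQueries w q n s₀ s₀
  | query {s s' : State} {k t : ℕ} (hs : AfterQueries w q n s₀ s) (hk : k ∈ Finset.Icc 1 n)
      (hq : Exec w q (s.setReg 0 k) t s') : AfterQueries w q n s₀ s'

open WordRAM in
/-- There is a deterministic data structure for Convolution Witness with preprocessing time `O(P n)`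
and query time `O(Q n)` per witness. The program `pre` preprocesses the two vectors; from then on,
after any sequence of earlier queries, the program `q` answers every query `k ∈ [n]` with the list of
all witnesses of `k`, in time `O(Q n)` times one plus the number of witnesses. -/
def ConvWitnessDataStructure (P Q : ℕ → ℝ) : Prop :=
  ∃ (pre q : Prog) (κ : ℕ) (C : ℝ), ∀ n : ℕ, 1 ≤ n → ∀ X Y : ℕ → Bool,
    ∃ (t₀ : ℕ) (s₀ : State),
      Exec (wordLength κ n) pre (convInput n X Y) t₀ s₀ ∧ (t₀ : ℝ) ≤ C * P n ∧
      ∀ s : State, AfterQueries (wordLength κ n) q n s₀ s → ∀ k ∈ Finset.Icc 1 n,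
        ∃ (t : ℕ) (s' : State), Exec (wordLength κ n) q (s.setReg 0 k) t s' ∧
          ReturnsPairs s' (convWitnesses n X Y k) ∧
          (t : ℝ) ≤ C * Q n * (1 + ((convWitnesses n X Y k).card : ℝ))

/-! A fast data structure yields a deterministic subquadratic algorithm for 3SUM. Take a prime `q`
with `q ^ b` slightly above `N`, and replace each number by its residues modulo `r` moduli `P i ≤ (q
- 1) / 2`, written as digits in base `L = q - 1`. Two residues have a sum below `L`, so codes add
digit by digit. The congruences `x + y ≡ z` modulo all `P i` hold iff code(x) + code(y) equals the
code of `z` with `P i` added to the digits chosen by a carry pattern `e`; exactly one of the `2 ^ r`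
patterns then fits (`sum_dig_eq`). 3SUM thus becomes `2 ^ r * N` queries on vectors of length `L ^ r
+ 1` that mark the occurring codes. For each witness, all pairs of numbers from its two buckets are
tested. The number of tested pairs is the number of pseudo-solutions, the triples that satisfy all
congruences (`sum_hist_mul_hist`).

The moduli must be found without randomness and leave few pseudo-solutions. They are chosen
greedily, each one minimising the count. If there is no solution, every `z - x - y` is nonzero and
has only logarithmically many prime factors; so the average over the prime candidates, and hence the
minimum, cuts the count by a factor `q` up to logarithms (`exists_pseudoCount_le`,
`le_mul_card_primes`). After `r` choices at most `C * N ^ 3 / q ^ (r - 1)` pseudo-solutions are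
left, one factor `q` having been given up to absorb all logarithms (`le_threshold`). If the greedy
count exceeds this threshold, a solution must exist and no search is needed.

The greedy choice needs exact counts. The count is a trilinear form in histograms of codes,
diagonalised by an `r`-fold Kronecker power of a Fourier transform of order `L`. The roots of unity
are the Teichmüller representatives in `ZMod (q ^ (m + 1))`, so all arithmetic is on integers, and
the count, being at most `N ^ 3 < q ^ (m + 1)`, is recovered from its residue
(`sum_teichmuller_trilinear`, `sum_kron_mul`, `sum_transform_eq_pseudoCount`).

In terms of `X = N ^ (1 / b)`, with queries of exponent `β < α / 2`, the greedy phase costs `X ^ (r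
+ 2)`, preprocessing `X ^ (r * (2 - α))`, and the witnesses `X ^ (3 * b - (r - 1) + r * β)`, up to
constants. All these exponents can be made smaller than `2 * b` (`exists_exponents`), which
contradicts the hypothesis. The rest is verified programming: `Runs` is a timed Hoare logic, and the
given data structure runs as a guest on registers and arrays of its own. -/

namespace WordRAM

/-! ### State updates, and what a program cannot change -/

@[simp] theorem State.setReg_reg (s : State) (d v r : ℕ) :
    (s.setReg d v).reg r = if r = d then v else s.reg r := by
  simp [State.setReg, Function.update_apply]

@[simp] theorem State.setReg_mem (s : State) (d v : ℕ) : (s.setReg d v).mem = s.mem := rfl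

@[simp] theorem State.setMem_reg (s : State) (a i v : ℕ) : (s.setMem a i v).reg = s.reg := rfl

@[simp] theorem State.setMem_mem (s : State) (a i v a' : ℕ) :
    (s.setMem a i v).mem a' = if a' = a then Function.update (s.mem a) i v else s.mem a' := by
  simp [State.setMem, Function.update_apply]

/-- The word length enters only as an upper bound on produced values. Hence a guest written for
short words also runs on the host's longer ones. -/
theorem Exec.mono {w w' : ℕ} (hw : w ≤ w') {p : Prog} {s s' : State} {t : ℕ}
    (h : Exec w p s t s') : Exec w' p s t s' := by
  have hp : 2 ^ w ≤ 2 ^ w' := Nat.pow_le_pow_right (by norm_num) hw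
  induction h with
  | skip s => exact .skip s
  | const d c s hc => exact .const d c s (hc.trans_le hp)
  | op o d a b s h => exact .op o d a b s (h.trans_le hp)
  | load d r a s => exact .load d r a s
  | store r a b s => exact .store r a b s
  | seq _ _ ih1 ih2 => exact .seq ih1 ih2
  | ite_true ha _ ih => exact .ite_true ha ih
  | ite_false ha _ ih => exact .ite_false ha ih
  | loop_false ha => exact .loop_false ha
  | loop_true ha _ _ ih1 ih2 => exact .loop_true ha ih1 ih2

/-- All registers written by the program satisfy `f`. -/
def Prog.allR (f : ℕ → Bool) : Prog → Bool
  | .skip => true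
  | .const d _ => f d
  | .op _ d _ _ => f d
  | .load d _ _ => f d
  | .store _ _ _ => true
  | .seq p q => p.allR f && q.allR f
  | .ite _ p q => p.allR f && q.allR f
  | .loop _ p => p.allR f

/-- All arrays written by the program satisfy `f`. -/
def Prog.allM (f : ℕ → Bool) : Prog → Bool
  | .skip => true
  | .const _ _ => true
  | .op _ _ _ _ => true
  | .load _ _ _ => true
  | .store r _ _ => f r
  | .seq p q => p.allM f && q.allM f
  | .ite _ p q => p.allM f && q.allM f
  | .loop _ p => p.allM f

/-- The registers `60, …, 99` are used for intermediate results of expressions. -/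
def isTemp (r : ℕ) : Bool := Nat.ble 60 r && Nat.ble (r + 1) 100

theorem isTemp_eq_false {r : ℕ} : isTemp r = false ↔ r < 60 ∨ 100 ≤ r := by
  rw [← Bool.not_eq_true, isTemp, Bool.and_eq_true, Nat.ble_eq, Nat.ble_eq]
  omega

theorem beq_eq_false {a b : ℕ} : Nat.beq a b = false ↔ a ≠ b := by
  rw [← Bool.not_eq_true, Nat.beq_eq]

/-- The program leaves register `r` alone. -/
def Prog.keepR (p : Prog) (r : ℕ) : Bool := p.allR (fun x => !Nat.beq x r)

/-- The program leaves array `a` alone. -/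
def Prog.keepM (p : Prog) (a : ℕ) : Bool := p.allM (fun x => !Nat.beq x a)

theorem Prog.allR_mono {f g : ℕ → Bool} (hfg : ∀ x, f x = true → g x = true) {p : Prog}
    (h : p.allR f = true) : p.allR g = true := by
  induction p <;> simp_all [Prog.allR]

theorem Prog.allM_mono {f g : ℕ → Bool} (hfg : ∀ x, f x = true → g x = true) {p : Prog}
    (h : p.allM f = true) : p.allM g = true := by
  induction p <;> simp_all [Prog.allM]

theorem Exec.reg_eq {w : ℕ} {p : Prog} {s s' : State} {t r : ℕ} (h : Exec w p s t s')
    (hr : p.keepR r = true) : s'.reg r = s.reg r := by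
  unfold Prog.keepR at hr
  induction h <;> simp_all [Prog.allR, beq_eq_false] <;> grind

theorem Exec.mem_eq {w : ℕ} {p : Prog} {s s' : State} {t a : ℕ} (h : Exec w p s t s')
    (ha : p.keepM a = true) : s'.mem a = s.mem a := by
  unfold Prog.keepM at ha
  induction h <;> simp_all [Prog.allM, beq_eq_false]; grind

/-! ### Timed total correctness -/

/-- The states agree up to registers for intermediate results. -/
def Sim (s s₀ : State) : Prop :=
  (∀ r, isTemp r = false → s₀.reg r = s.reg r) ∧ s₀.mem = s.mem

theorem Sim.refl (s : State) : Sim s s := ⟨fun _ _ => rfl, rfl⟩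

/-- Total correctness with a time bound: started in `s`, up to registers for intermediate results,
the program halts within `T` steps in a state which satisfies `Q`. -/
def Runs (w : ℕ) (p : Prog) (s : State) (T : ℕ) (Q : State → Prop) : Prop :=
  ∀ s₀, Sim s s₀ → ∃ t s₀' s', Exec w p s₀ t s₀' ∧ t ≤ T ∧ Sim s' s₀' ∧ Q s'

/-- What is unchanged when `p` leads from `s` to `s'`. -/
def Frame (p : Prog) (s s' : State) : Prop :=
  (∀ r, (!isTemp r && p.keepR r) = true → s'.reg r = s.reg r) ∧
    ∀ a, p.keepM a = true → s'.mem a = s.mem a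

theorem Frame.reg {p : Prog} {s s' : State} (h : Frame p s s') (r : ℕ)
    (hr : (!isTemp r && p.keepR r) = true) : s'.reg r = s.reg r := h.1 r hr

theorem Frame.mem {p : Prog} {s s' : State} (h : Frame p s s') (a : ℕ)
    (ha : p.keepM a = true) : s'.mem a = s.mem a := h.2 a ha

theorem Frame.refl (p : Prog) (s : State) : Frame p s s := ⟨fun _ _ => rfl, fun _ _ => rfl⟩

theorem Runs.mono {w : ℕ} {p : Prog} {s : State} {T T' : ℕ} {Q Q' : State → Prop}
    (h : Runs w p s T Q) (hT : T ≤ T') (hQ : ∀ s', Q s' → Q' s') : Runs w p s T' Q' := by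
  intro s₀ hs
  obtain ⟨t, s₀', s', he, ht, hs', hq⟩ := h s₀ hs
  exact ⟨t, s₀', s', he, ht.trans hT, hs', hQ _ hq⟩

/-- What a run preserves is read off the syntax of the program. Postconditions and loop invariants
therefore only have to mention what changes. -/
theorem Runs.frame {w : ℕ} {p : Prog} {s : State} {T : ℕ} {Q : State → Prop}
    (h : Runs w p s T Q) : Runs w p s T (fun s' => Q s' ∧ Frame p s s') := by
  intro s₀ hs
  obtain ⟨t, s₀', s', he, ht, hs', hq⟩ := h s₀ hs
  refine ⟨t, s₀', s', he, ht, hs', hq, fun r hr => ?_, fun a ha => ?_⟩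
  · simp only [Bool.and_eq_true, Bool.not_eq_true'] at hr
    rw [← hs'.1 r hr.1, he.reg_eq hr.2, hs.1 r hr.1]
  · rw [← hs'.2, he.mem_eq ha, hs.2]

theorem Runs.seq {w : ℕ} {p q : Prog} {s : State} {T T' : ℕ} {Q : State → Prop}
    (h : Runs w p s T (fun s' => Runs w q s' T' Q)) : Runs w (.seq p q) s (T + T') Q := by
  intro s₀ hs
  obtain ⟨t, s₁, s', he, ht, hs', hq⟩ := h s₀ hs
  obtain ⟨t', s₂, s'', he', ht', hs'', hq'⟩ := hq s₁ hs'
  exact ⟨t + t', s₂, s'', .seq he he', by omega, hs'', hq'⟩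

theorem Runs.skip {w : ℕ} {s : State} {Q : State → Prop} (h : Q s) : Runs w .skip s 1 Q :=
  fun s₀ hs => ⟨1, s₀, s, .skip _, le_rfl, hs, h⟩

/-! ### Expressions, assignments and loops -/

/-- Expressions. -/
inductive Ex where
  | r (i : ℕ)
  | c (v : ℕ)
  | b (o : BinOp) (e f : Ex)
  | ld (a : ℕ) (e : Ex)

/-- The value of an expression. -/
def Ex.eval (s : State) : Ex → ℕ
  | .r i => s.reg i
  | .c v => v
  | .b o e f => o.eval (e.eval s) (f.eval s)
  | .ld a e => s.mem a (e.eval s)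

/-- No intermediate result overflows. -/
def Ex.Safe (w : ℕ) (s : State) : Ex → Prop
  | .r i => s.reg i < 2 ^ w
  | .c v => v < 2 ^ w
  | .b o e f => e.Safe w s ∧ f.Safe w s ∧ o.eval (e.eval s) (f.eval s) < 2 ^ w
  | .ld a e => e.Safe w s ∧ s.mem a (e.eval s) < 2 ^ w

theorem Ex.Safe.lt {w : ℕ} {s : State} {e : Ex} (h : e.Safe w s) : e.eval s < 2 ^ w := by
  cases e with
  | r i => exact h
  | c v => exact h
  | b o e f => exact h.2.2
  | ld a e => exact h.2

/-- Straight-line code for an expression: the result is left in register `d`. -/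
def Ex.code : Ex → ℕ → Prog
  | .r i, d => .op .lor d i i
  | .c v, d => .const d v
  | .b o e f, d => .seq (e.code d) (.seq (f.code (d + 1)) (.op o d d (d + 1)))
  | .ld a e, d => .seq (e.code d) (.load d a d)

/-- The number of steps of the code for an expression. -/
def Ex.cost : Ex → ℕ
  | .r _ => 1
  | .c _ => 1
  | .b _ e f => e.cost + (f.cost + 1)
  | .ld _ e => e.cost + 1

/-- The expression mentions no register for intermediate results, and its code for register `d`
does not run out of them. -/
def Ex.ok : Ex → ℕ → Bool
  | .r i, d => !isTemp i && Nat.ble (d + 1) 100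
  | .c _, d => Nat.ble (d + 1) 100
  | .b _ e f, d => e.ok d && f.ok (d + 1)
  | .ld _ e, d => e.ok d

/-- Registers from `d` on act as a stack: the code for `d` writes nothing below `d`, so the value of
a left operand survives in `d` while the right operand is evaluated from `d + 1` on. -/
theorem Ex.exec_code {w : ℕ} {s : State} (e : Ex) (d : ℕ) (hd : 60 ≤ d) (hok : e.ok d = true)
    (hs : e.Safe w s) (s₀ : State) (h₀ : Sim s s₀) :
    ∃ s₁, Exec w (e.code d) s₀ e.cost s₁ ∧ Sim s s₁ ∧ s₁.reg d = e.eval s ∧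
      ∀ r < d, s₁.reg r = s₀.reg r := by
  have key : ∀ (s₁ : State) (d v : ℕ), 60 ≤ d → d < 100 → Sim s s₁ → Sim s (s₁.setReg d v) := by
    intro s₁ d v h1 h2 h3
    refine ⟨fun r hr => ?_, h3.2⟩
    rw [State.setReg_reg, if_neg, h3.1 r hr]
    rintro rfl
    rw [isTemp_eq_false] at hr
    omega
  have hlt : ∀ (e : Ex) (d : ℕ), e.ok d = true → d < 100 := by
    intro e
    induction e with
    | r i => intro d h; simp [Ex.ok] at h; omega
    | c v => intro d h; simp [Ex.ok] at h; omega
    | b o e f ih _ => intro d h; simp [Ex.ok] at h; exact ih d h.1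
    | ld a e ih => exact ih
  induction e generalizing d s₀ with
  | r i =>
    have hi := hok
    simp only [Ex.ok, Bool.and_eq_true, Bool.not_eq_true'] at hi
    refine ⟨s₀.setReg d (BinOp.lor.eval (s₀.reg i) (s₀.reg i)), .op _ _ _ _ _ ?_,
      key _ _ _ hd (hlt _ _ hok) h₀, ?_, ?_⟩
    · simpa [BinOp.eval, h₀.1 i hi.1, Ex.Safe] using hs
    · simp [BinOp.eval, h₀.1 i hi.1, Ex.eval]
    · intro r hr; simp [hr.ne]
  | c v =>
    refine ⟨s₀.setReg d v, .const _ _ _ hs, key _ _ _ hd (hlt _ _ hok) h₀, by simp [Ex.eval], ?_⟩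
    intro r hr; simp [hr.ne]
  | b o e f ihe ihf =>
    have hd' := hlt _ _ hok
    simp only [Ex.ok, Bool.and_eq_true] at hok
    obtain ⟨s₁, h1, h2, h3, h4⟩ := ihe d hd hok.1 hs.1 s₀ h₀
    obtain ⟨s₂, g1, g2, g3, g4⟩ := ihf (d + 1) (by omega) hok.2 hs.2.1 s₁ h2
    have e1 : s₂.reg d = e.eval s := by rw [g4 d (by omega), h3]
    refine ⟨s₂.setReg d (o.eval (s₂.reg d) (s₂.reg (d + 1))), .seq h1 (.seq g1 (.op _ _ _ _ _ ?_)),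
      key _ _ _ hd hd' g2, ?_, ?_⟩
    · rw [e1, g3]; exact hs.2.2
    · simp [e1, g3, Ex.eval]
    · intro r hr
      rw [State.setReg_reg, if_neg hr.ne, g4 r (by omega), h4 r hr]
  | ld a e ihe =>
    obtain ⟨s₁, h1, h2, h3, h4⟩ := ihe d hd hok hs.1 s₀ h₀
    refine ⟨s₁.setReg d (s₁.mem a (s₁.reg d)), .seq h1 (.load _ _ _ _),
      key _ _ _ hd (hlt _ _ hok) h2, ?_, ?_⟩
    · simp [h3, h2.2, Ex.eval]
    · intro r hr
      rw [State.setReg_reg, if_neg hr.ne, h4 r hr]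

/-- `R[x] := e` -/
def asg (x : ℕ) (e : Ex) : Prog := .seq (e.code 60) (.op .lor x 60 60)

/-- `M_a[e] := f` -/
def sto (a : ℕ) (e f : Ex) : Prog := .seq (e.code 60) (.seq (f.code 61) (.store a 60 61))

/-- `if e ≠ 0 then p else q` -/
def cond (e : Ex) (p q : Prog) : Prog := .seq (e.code 60) (.ite 60 p q)

/-- `while e ≠ 0 do p` -/
def whl (e : Ex) (p : Prog) : Prog := .seq (e.code 60) (.loop 60 (.seq p (e.code 60)))

/-- `for R[i] := 0 to R[n] - 1 do p` -/
def forTo (i n : ℕ) (p : Prog) : Prog :=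
  .seq (asg i (.c 0)) (whl (.b .lt (.r i) (.r n)) (.seq p (asg i (.b .add (.r i) (.c 1)))))

theorem Runs.asg {w : ℕ} {x : ℕ} {e : Ex} {s : State} {Q : State → Prop}
    (hok : e.ok 60 = true) (hs : e.Safe w s) (hQ : Q (s.setReg x (e.eval s))) :
    Runs w (asg x e) s (e.cost + 1) Q := by
  intro s₀ h₀
  obtain ⟨s₁, h1, h2, h3, -⟩ := e.exec_code 60 le_rfl hok hs s₀ h₀
  refine ⟨_, s₁.setReg x (BinOp.lor.eval (s₁.reg 60) (s₁.reg 60)), s.setReg x (e.eval s),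
    .seq h1 (.op _ _ _ _ _ (by simpa [BinOp.eval, h3] using hs.lt)), le_rfl,
    ⟨fun r hr => ?_, h2.2⟩, hQ⟩
  simp [h3, BinOp.eval, h2.1 r hr]

theorem Runs.sto {w : ℕ} {a : ℕ} {e f : Ex} {s : State} {Q : State → Prop}
    (hoke : e.ok 60 = true) (hokf : f.ok 61 = true) (hse : e.Safe w s) (hsf : f.Safe w s)
    (hQ : Q (s.setMem a (e.eval s) (f.eval s))) :
    Runs w (sto a e f) s (e.cost + (f.cost + 1)) Q := by
  intro s₀ h₀
  obtain ⟨s₁, h1, h2, h3, -⟩ := e.exec_code 60 le_rfl hoke hse s₀ h₀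
  obtain ⟨s₂, g1, g2, g3, g4⟩ := f.exec_code 61 (by norm_num) hokf hsf s₁ h2
  refine ⟨_, s₂.setMem a (s₂.reg 60) (s₂.reg 61), s.setMem a (e.eval s) (f.eval s), .seq h1 (.seq g1 (.store _ _ _ _)), le_rfl,
    ⟨fun r hr => g2.1 r hr, ?_⟩, hQ⟩
  rw [g3, g4 60 (by norm_num), h3]
  simp [State.setMem, g2.2]

theorem Runs.cond {w : ℕ} {e : Ex} {p q : Prog} {s : State} {T T' : ℕ} {Q : State → Prop}
    (hok : e.ok 60 = true) (hs : e.Safe w s)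
    (hp : e.eval s ≠ 0 → Runs w p s T Q) (hq : e.eval s = 0 → Runs w q s T' Q) :
    Runs w (cond e p q) s (e.cost + 1 + max T T') Q := by
  intro s₀ h₀
  obtain ⟨s₁, h1, h2, h3, -⟩ := e.exec_code 60 le_rfl hok hs s₀ h₀
  by_cases he : e.eval s = 0
  · obtain ⟨t, s₂, s', g1, g2, g3, g4⟩ := hq he s₁ h2
    exact ⟨_, s₂, s', .seq h1 (.ite_false (h3.trans he) g1), by omega, g3, g4⟩
  · obtain ⟨t, s₂, s', g1, g2, g3, g4⟩ := hp he s₁ h2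
    exact ⟨_, s₂, s', .seq h1 (.ite_true (by rwa [h3]) g1), by omega, g3, g4⟩

theorem Runs.whl {w : ℕ} {e : Ex} {p : Prog} {s : State} {Q : State → Prop}
    (n : ℕ) (I : ℕ → State → Prop) (T : ℕ → ℕ) (hok : e.ok 60 = true) (h0 : I 0 s)
    (hstep : ∀ j < n, ∀ s', I j s' →
      e.Safe w s' ∧ e.eval s' ≠ 0 ∧ Runs w p s' (T j) (I (j + 1)))
    (hend : ∀ s', I n s' → e.Safe w s' ∧ e.eval s' = 0 ∧ Q s') :
    Runs w (whl e p) s (∑ j ∈ Finset.range n, (T j + (e.cost + 1)) + (e.cost + 1)) Q := by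
  -- The guard is evaluated once before the loop and again at the end of every round, so the
  -- induction carries along that register `60` holds its current value.
  have main : ∀ m j, j + m = n → ∀ s s₁, I j s → Sim s s₁ → s₁.reg 60 = e.eval s →
      ∃ t s₂ s', Exec w (.loop 60 (.seq p (e.code 60))) s₁ t s₂ ∧
        t ≤ ∑ i ∈ Finset.range m, (T (j + i) + (e.cost + 1)) + 1 ∧ Sim s' s₂ ∧ Q s' := by
    intro m
    induction m with
    | zero =>
      intro j hj s s₁ hI hs he
      obtain ⟨-, h2, h3⟩ := hend s (by rwa [← hj])
      exact ⟨1, s₁, s, .loop_false (he.trans h2), by simp, hs, h3⟩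
    | succ m ih =>
      intro j hj s s₁ hI hs he
      obtain ⟨-, h2, h3⟩ := hstep j (by omega) s hI
      obtain ⟨t, s₂, s', g1, g2, g3, g4⟩ := h3 s₁ hs
      have hsafe : e.Safe w s' := by
        rcases Nat.eq_zero_or_pos m with rfl | hm
        · exact (hend s' (by rwa [← hj])).1
        · exact (hstep (j + 1) (by omega) s' g4).1
      obtain ⟨s₃, k1, k2, k3, -⟩ := e.exec_code 60 le_rfl hok hsafe s₂ g3
      obtain ⟨t', s₄, s'', l1, l2, l3, l4⟩ := ih (j + 1) (by omega) s' s₃ g4 k2 k3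
      refine ⟨_, s₄, s'', .loop_true (by rwa [he]) (.seq g1 k1) l1, ?_, l3, l4⟩
      rw [Finset.sum_range_succ']
      simp only [add_zero]
      have : ∑ i ∈ Finset.range m, (T (j + 1 + i) + (e.cost + 1))
          = ∑ i ∈ Finset.range m, (T (j + (i + 1)) + (e.cost + 1)) :=
        Finset.sum_congr rfl fun i _ => by rw [add_assoc, add_comm 1 i]
      omega
  intro s₀ h₀
  have hsafe : e.Safe w s := by
    rcases Nat.eq_zero_or_pos n with rfl | hm
    · exact (hend s h0).1
    · exact (hstep 0 hm s h0).1
  obtain ⟨s₁, h1, h2, h3, -⟩ := e.exec_code 60 le_rfl hok hsafe s₀ h₀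
  obtain ⟨t, s₂, s', g1, g2, g3, g4⟩ := main n 0 (by simp) s s₁ h0 h2 h3
  refine ⟨_, s₂, s', .seq h1 g1, ?_, g3, g4⟩
  simp only [zero_add] at g2
  omega

theorem Frame.setReg {p : Prog} {s s' : State} {i v : ℕ} (h : Frame p s s')
    (hi : p.keepR i = false) : Frame p s (s'.setReg i v) := by
  refine ⟨fun r hr => ?_, h.2⟩
  rw [State.setReg_reg, if_neg, h.1 r hr]
  rintro rfl
  simp [hi] at hr

theorem Prog.keepR_forTo (i n : ℕ) (p : Prog) (r : ℕ) (hr : isTemp r = false) :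
    (forTo i n p).keepR r = (p.keepR r && !Nat.beq i r) := by
  have h : Nat.beq 60 r = false ∧ Nat.beq 61 r = false := by
    rw [isTemp_eq_false] at hr
    rw [beq_eq_false, beq_eq_false]; omega
  simp only [Prog.keepR, forTo, WordRAM.asg, WordRAM.whl, Ex.code, Prog.allR, h.1, h.2]
  cases Nat.beq i r <;> simp

theorem Prog.keepM_forTo (i n : ℕ) (p : Prog) (a : ℕ) :
    (forTo i n p).keepM a = p.keepM a := by
  simp [Prog.keepM, forTo, WordRAM.asg, WordRAM.whl, Ex.code, Prog.allM]

theorem Frame.trans_forTo {p : Prog} {i n : ℕ} {s s' s'' : State} (h : Frame (forTo i n p) s s')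
    (h' : Frame p s' s'') : Frame (forTo i n p) s s'' := by
  refine ⟨fun r hr => ?_, fun a ha => ?_⟩
  · have := hr
    simp only [Bool.and_eq_true, Bool.not_eq_true'] at hr
    rw [Prog.keepR_forTo _ _ _ _ hr.1] at hr
    simp only [Bool.and_eq_true, Bool.not_eq_true'] at hr
    rw [h'.1 r (by simp [hr.1, hr.2.1]), h.1 r this]
  · rw [h'.2 a (by rwa [Prog.keepM_forTo] at ha), h.2 a ha]

theorem Runs.forTo {w : ℕ} {i n : ℕ} {p : Prog} {s : State} {Q : State → Prop} (k : ℕ)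
    (I : ℕ → State → Prop) (T : ℕ → ℕ) (hn : s.reg n = k) (hk : k < 2 ^ w)
    (hi : isTemp i = false) (hnt : isTemp n = false) (hin : Nat.beq i n = false)
    (hpi : p.keepR i = true) (hpn : p.keepR n = true)
    (h0 : I 0 (s.setReg i 0))
    (hs : ∀ j < k, ∀ s', I j s' → s'.reg i = j → Frame (forTo i n p) s s' →
      Runs w p s' (T j) (fun s'' => I (j + 1) (s''.setReg i (j + 1))))
    (hQ : ∀ s', I k s' → s'.reg i = k → Frame (forTo i n p) s s' → Q s') :
    Runs w (forTo i n p) s (∑ j ∈ Finset.range k, (T j + 8) + 6) Q := by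
  have hwf : (WordRAM.forTo i n p).keepR i = false := by
    rw [Prog.keepR_forTo _ _ _ _ hi]; simp
  have hwn : (!isTemp n && (WordRAM.forTo i n p).keepR n) = true := by
    rw [Prog.keepR_forTo _ _ _ _ hnt]; simp [hin, hpn, hnt]
  have hpos : 1 ≤ 2 ^ w := Nat.one_le_two_pow
  -- Initialising the counter takes 2 steps, each round adds 4 for the increment and 4 for the
  -- guard, and the last guard takes 4.
  refine Runs.mono (T := 2 + (∑ j ∈ Finset.range k, (T j + 4 + 4) + 4)) (Runs.seq (Runs.asg rfl
    (by simp [Ex.Safe]) ?_)) ?_ (fun _ h => h)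
  · refine Runs.whl k (fun j s' => I j s' ∧ s'.reg i = j ∧ Frame (WordRAM.forTo i n p) s s')
      (fun j => T j + 4) (by simp [Ex.ok, hi, hnt]) ⟨h0, by simp [Ex.eval],
        (Frame.refl _ s).setReg hwf⟩ ?_ ?_
    · rintro j hj s' ⟨h1, h2, h3⟩
      have hn' : s'.reg n = k := by rw [h3.reg n hwn, hn]
      refine ⟨⟨?_, ?_, ?_⟩, ?_, ?_⟩
      · simp [Ex.Safe, h2]; omega
      · simp [Ex.Safe, hn']; omega
      · simp only [Ex.eval, BinOp.eval, h2, hn', hj, if_true]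
        have : 2 ≤ 2 ^ w := by
          rcases w with _ | w
          · simp at hk; omega
          · rw [pow_succ]; have : 1 ≤ 2 ^ w := Nat.one_le_two_pow
            omega
        omega
      · simp [Ex.eval, BinOp.eval, h2, hn', hj]
      · refine Runs.seq (T' := 4) (((hs j hj s' h1 h2 h3).frame).mono le_rfl ?_)
        rintro s'' ⟨g1, g2⟩
        have g3 : s''.reg i = j := by
          rw [g2.reg i (by simp [hi, hpi]), h2]
        refine Runs.asg (by simp [Ex.ok, hi]) ⟨?_, ?_, ?_⟩ ?_
        · simp [Ex.Safe, g3]; omega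
        · change 1 < 2 ^ w; omega
        · simp [Ex.eval, BinOp.eval, g3]; omega
        · have : (Ex.b .add (.r i) (.c 1)).eval s'' = j + 1 := by simp [Ex.eval, BinOp.eval, g3]
          rw [this]
          exact ⟨g1, by simp, (h3.trans_forTo g2).setReg hwf⟩
    · rintro s' ⟨h1, h2, h3⟩
      have hn' : s'.reg n = k := by rw [h3.reg n hwn, hn]
      refine ⟨⟨?_, ?_, ?_⟩, ?_, hQ s' h1 h2 h3⟩
      · simp [Ex.Safe, h2]; omega
      · simp [Ex.Safe, hn']; omega
      · simp [Ex.eval, BinOp.eval, h2, hn']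
      · simp [Ex.eval, BinOp.eval, h2, hn']
  · simp only [add_assoc, Nat.reduceAdd]
    omega

theorem Runs.seq_asg {w x T : ℕ} {e : Ex} {q : Prog} {s : State} {Q : State → Prop}
    (hok : e.ok 60 = true) (hT : e.cost + 1 ≤ T) (hs : e.Safe w s)
    (h : Runs w q (s.setReg x (e.eval s)) (T - (e.cost + 1)) Q) :
    Runs w (.seq (WordRAM.asg x e) q) s T Q :=
  (Runs.seq (Runs.asg hok hs h)).mono (by omega) fun _ h => h

theorem Runs.asg_le {w x T : ℕ} {e : Ex} {s : State} {Q : State → Prop}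
    (hok : e.ok 60 = true) (hT : e.cost + 1 ≤ T) (hs : e.Safe w s)
    (h : Q (s.setReg x (e.eval s))) : Runs w (WordRAM.asg x e) s T Q :=
  (Runs.asg hok hs h).mono hT fun _ h => h

theorem Runs.seq_sto {w a T : ℕ} {e f : Ex} {q : Prog} {s : State} {Q : State → Prop}
    (hoke : e.ok 60 = true) (hokf : f.ok 61 = true) (hT : e.cost + f.cost + 1 ≤ T)
    (hse : e.Safe w s) (hsf : f.Safe w s)
    (h : Runs w q (s.setMem a (e.eval s) (f.eval s)) (T - (e.cost + f.cost + 1)) Q) :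
    Runs w (.seq (WordRAM.sto a e f) q) s T Q :=
  (Runs.seq (Runs.sto hoke hokf hse hsf h)).mono (by omega) fun _ h => h

theorem Runs.sto_le {w a T : ℕ} {e f : Ex} {s : State} {Q : State → Prop}
    (hoke : e.ok 60 = true) (hokf : f.ok 61 = true) (hT : e.cost + f.cost + 1 ≤ T)
    (hse : e.Safe w s) (hsf : f.Safe w s) (h : Q (s.setMem a (e.eval s) (f.eval s))) :
    Runs w (WordRAM.sto a e f) s T Q :=
  (Runs.sto hoke hokf hse hsf h).mono (by omega) fun _ h => h

theorem Runs.seq_le {w T T₁ : ℕ} {p q : Prog} {s : State} {Q Q₁ : State → Prop}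
    (hp : Runs w p s T₁ Q₁) (hT : T₁ ≤ T)
    (h : ∀ s', Q₁ s' → Frame p s s' → Runs w q s' (T - T₁) Q) : Runs w (.seq p q) s T Q :=
  (Runs.seq (hp.frame.mono le_rfl fun s' hs' => h s' hs'.1 hs'.2)).mono (by omega) fun _ h => h

theorem Runs.forTo_le {w i n : ℕ} {p : Prog} {s : State} {Q : State → Prop} {T : ℕ} (k c : ℕ)
    (I : ℕ → State → Prop) (hT : k * (c + 8) + 6 ≤ T) (hn : s.reg n = k) (hk : k < 2 ^ w)
    (hi : isTemp i = false) (hnt : isTemp n = false) (hin : Nat.beq i n = false)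
    (hpi : p.keepR i = true) (hpn : p.keepR n = true)
    (h0 : I 0 (s.setReg i 0))
    (hs : ∀ j < k, ∀ s', I j s' → s'.reg i = j → Frame (WordRAM.forTo i n p) s s' →
      Runs w p s' c (fun s'' => I (j + 1) (s''.setReg i (j + 1))))
    (hQ : ∀ s', I k s' → s'.reg i = k → Frame (WordRAM.forTo i n p) s s' → Q s') :
    Runs w (WordRAM.forTo i n p) s T Q :=
  (Runs.forTo k I (fun _ => c) hn hk hi hnt hin hpi hpn h0 hs hQ).mono
    (by simpa using hT) fun _ h => h

/-! ### Running a guest program inside the host -/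

/-- The program on registers and arrays out of the way of the host program. -/
def Prog.shift : Prog → Prog
  | .skip => .skip
  | .const d c => .const (d + 100) c
  | .op o d a b => .op o (d + 100) (a + 100) (b + 100)
  | .load d r a => .load (d + 100) (r + 50) (a + 100)
  | .store r a b => .store (r + 50) (a + 100) (b + 100)
  | .seq p q => .seq p.shift q.shift
  | .ite a p q => .ite (a + 100) p.shift q.shift
  | .loop a p => .loop (a + 100) p.shift

/-- The part of the state that shifted programs see. -/
def State.guest (s : State) : State where
  reg := fun r => s.reg (r + 100)
  mem := fun a => s.mem (a + 50)

theorem guest_setReg (s : State) (d v : ℕ) :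
    (s.setReg (d + 100) v).guest = s.guest.setReg d v := by
  ext r
  · simp [State.guest]
  · simp [State.guest]

theorem guest_setReg_of_lt (s : State) (d v : ℕ) (hd : d < 100) :
    (s.setReg d v).guest = s.guest := by
  ext r
  · simp only [State.guest, State.setReg_reg]; rw [if_neg (by omega)]
  · simp [State.guest]

theorem guest_setMem (s : State) (a i v : ℕ) :
    (s.setMem (a + 50) i v).guest = s.guest.setMem a i v := by
  ext r
  · simp [State.guest]
  · simp [State.guest]

theorem Exec.shift {w : ℕ} {p : Prog} {s s' : State} {t : ℕ} (h : Exec w p s t s') :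
    ∀ s₀ : State, s₀.guest = s → ∃ s₀', Exec w p.shift s₀ t s₀' ∧ s₀'.guest = s' := by
  induction h with
  | skip s => exact fun s₀ h => ⟨s₀, .skip _, h⟩
  | const d c s hc =>
    rintro s₀ rfl
    exact ⟨_, .const _ _ _ hc, guest_setReg _ _ _⟩
  | op o d a b s h =>
    rintro s₀ rfl
    exact ⟨_, .op _ _ _ _ _ h, guest_setReg _ _ _⟩
  | load d r a s =>
    rintro s₀ rfl
    exact ⟨_, .load _ _ _ _, guest_setReg _ _ _⟩
  | store r a b s =>
    rintro s₀ rfl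
    exact ⟨_, .store _ _ _ _, guest_setMem _ _ _ _⟩
  | seq _ _ ih1 ih2 =>
    intro s₀ hs
    obtain ⟨s₁, h1, h2⟩ := ih1 s₀ hs
    obtain ⟨s₂, h3, h4⟩ := ih2 s₁ h2
    exact ⟨s₂, .seq h1 h3, h4⟩
  | ite_true ha _ ih =>
    rintro s₀ rfl
    obtain ⟨s₁, h1, h2⟩ := ih s₀ rfl
    exact ⟨s₁, .ite_true ha h1, h2⟩
  | ite_false ha _ ih =>
    rintro s₀ rfl
    obtain ⟨s₁, h1, h2⟩ := ih s₀ rfl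
    exact ⟨s₁, .ite_false ha h1, h2⟩
  | loop_false ha =>
    rintro s₀ rfl
    exact ⟨s₀, .loop_false ha, rfl⟩
  | loop_true ha _ _ ih1 ih2 =>
    rintro s₀ rfl
    obtain ⟨s₁, h1, h2⟩ := ih1 s₀ rfl
    obtain ⟨s₂, h3, h4⟩ := ih2 s₁ h2
    exact ⟨s₂, .loop_true ha h1 h3, h4⟩

theorem Prog.allR_shift {f : ℕ → Bool} (hf : ∀ x, 100 ≤ x → f x = true) (p : Prog) :
    p.shift.allR f = true := by
  induction p <;> simp_all [Prog.allR, Prog.shift]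

theorem Prog.allM_shift {f : ℕ → Bool} (hf : ∀ x, 50 ≤ x → f x = true) (p : Prog) :
    p.shift.allM f = true := by
  induction p <;> simp_all [Prog.allM, Prog.shift]

theorem Runs.shift {w w' : ℕ} (hw : w' ≤ w) {p : Prog} {s s' : State} {t : ℕ}
    (h : Exec w' p s.guest t s') :
    Runs w p.shift s t (fun s'' => s''.guest = s' ∧ (∀ r < 100, s''.reg r = s.reg r) ∧
      ∀ a < 50, s''.mem a = s.mem a) := by
  intro s₀ h₀
  have hg : s₀.guest = s.guest := by
    ext r
    · simp only [State.guest]; exact h₀.1 _ (by rw [isTemp_eq_false]; omega)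
    · simp [State.guest, h₀.2]
  obtain ⟨s₁, h1, h2⟩ := (h.mono hw).shift s₀ hg
  have hr : ∀ r < 100, s₁.reg r = s₀.reg r := fun r hr =>
    h1.reg_eq (Prog.allR_shift (fun x hx => by simp [beq_eq_false]; omega) p)
  have ha : ∀ a < 50, s₁.mem a = s₀.mem a := fun a ha =>
    h1.mem_eq (Prog.allM_shift (fun x hx => by simp [beq_eq_false]; omega) p)
  -- The actual state may differ from `s` in the scratch registers, so the final state is glued
  -- together: host registers from `s`, guest registers from the actual run.
  refine ⟨t, s₁, ⟨fun r => if r < 100 then s.reg r else s₁.reg r, s₁.mem⟩, h1, le_rfl,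
    ⟨fun r hr' => ?_, rfl⟩, ?_, ?_, ?_⟩
  · simp only
    split_ifs with h
    · rw [hr r h, h₀.1 r hr']
    · rfl
  · rw [← h2]
    ext r
    · simp [State.guest]
    · simp [State.guest]
  · intro r hr; simp [hr]
  · intro a h; simp [ha a h, h₀.2]

end WordRAM

/-! ### Positional codes -/

open Finset in
/-- The number with digits `d 0, …, d (r - 1)` in base `L`. -/
def pack (L : ℕ) (d : ℕ → ℕ) (r : ℕ) : ℕ := ∑ i ∈ range r, d i * L ^ i

theorem pack_succ (L : ℕ) (d : ℕ → ℕ) (r : ℕ) : pack L d (r + 1) = d r * L ^ r + pack L d r := by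
  rw [pack, Finset.sum_range_succ, add_comm]; rfl

theorem pack_lt {L : ℕ} {d : ℕ → ℕ} {r : ℕ} (h : ∀ i < r, d i < L) : pack L d r < L ^ r := by
  induction r with
  | zero => simp [pack]
  | succ r ih =>
    rw [pack_succ, pow_succ]
    have h1 := ih fun i hi => h i (by omega)
    have h2 := h r (by omega)
    calc d r * L ^ r + pack L d r < d r * L ^ r + L ^ r := by omega
      _ = (d r + 1) * L ^ r := by ring
      _ ≤ L * L ^ r := Nat.mul_le_mul_right _ h2
      _ = L ^ r * L := mul_comm _ _

theorem pack_inj {L : ℕ} {d d' : ℕ → ℕ} {r : ℕ} (h : ∀ i < r, d i < L) (h' : ∀ i < r, d' i < L)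
    (he : pack L d r = pack L d' r) : ∀ i < r, d i = d' i := by
  induction r with
  | zero => simp
  | succ r ih =>
    rw [pack_succ, pack_succ] at he
    have h1 := pack_lt fun i hi => h i (Nat.lt_succ_of_lt hi)
    have h2 := pack_lt fun i hi => h' i (Nat.lt_succ_of_lt hi)
    have hpos : 0 < L ^ r := by omega
    have e1 : d r = d' r := by
      have := congrArg (· / L ^ r) he
      simpa [mul_comm (d r), mul_comm (d' r), Nat.mul_add_div hpos, Nat.div_eq_of_lt h1,
        Nat.div_eq_of_lt h2] using this
    have e2 : pack L d r = pack L d' r := by rw [e1] at he; omega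
    intro i hi
    rcases Nat.lt_succ_iff_lt_or_eq.mp hi with hi | rfl
    · exact ih (fun i hi => h i (by omega)) (fun i hi => h' i (by omega)) e2 i hi
    · exact e1

theorem pack_add (L : ℕ) (d d' : ℕ → ℕ) (r : ℕ) :
    pack L d r + pack L d' r = pack L (fun i => d i + d' i) r := by
  simp [pack, ← Finset.sum_add_distrib, add_mul]

open Finset in
theorem sum_range_mul_eq {R : Type*} [AddCommMonoid R] (m n : ℕ) (f : ℕ → R) :
    ∑ x ∈ range (m * n), f x = ∑ i ∈ range m, ∑ j ∈ range n, f (i * n + j) := by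
  induction m with
  | zero => simp
  | succ m ih =>
    rw [add_mul, one_mul, sum_range_add, ih, sum_range_succ]

/-! ### Kronecker powers of a transformation -/

section Tensor

variable {R : Type*} [CommRing R]

/-- The entry at `(t, s)` of the `j`-th Kronecker power of the matrix `M` of size `L`. -/
def kron (M : ℕ → ℕ → R) (L : ℕ) : ℕ → ℕ → ℕ → R
  | 0, _, _ => 1
  | j + 1, t, s => M (t / L ^ j) (s / L ^ j) * kron M L j (t % L ^ j) (s % L ^ j)

theorem kron_succ (M : ℕ → ℕ → R) (L j t t' s s' : ℕ) (ht : t' < L ^ j) (hs : s' < L ^ j) :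
    kron M L (j + 1) (t * L ^ j + t') (s * L ^ j + s') = M t s * kron M L j t' s' := by
  have h : 0 < L ^ j := by omega
  rw [kron, mul_comm t, mul_comm s, Nat.mul_add_div h, Nat.mul_add_div h, Nat.div_eq_of_lt ht,
    Nat.div_eq_of_lt hs, Nat.mul_add_mod, Nat.mul_add_mod, Nat.mod_eq_of_lt ht, Nat.mod_eq_of_lt hs]
  simp

open Finset in
/-- The lowest digit is transformed by `M` and becomes the highest one. -/
def tensorRound (M : ℕ → ℕ → R) (L D' : ℕ) (f : ℕ → R) (x : ℕ) : R :=
  ∑ a ∈ range L, M (x / D') a * f (x % D' * L + a)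

open Finset in
-- Each round rotates the digits: the lowest one is transformed and put on top. After `j` rounds the
-- transformed digits `t` are above the untouched ones `u`, which originally stood above the digits
-- `s`. The same index arithmetic thus serves every round, and after `r` rounds the digits are back
-- in their original order.
theorem iterate_tensorRound_aux (M : ℕ → ℕ → R) (L r : ℕ) (f : ℕ → R) (j : ℕ) (hj : j ≤ r)
    (t u : ℕ) (ht : t < L ^ j) (hu : u < L ^ (r - j)) :
    (tensorRound M L (L ^ (r - 1)))^[j] f (t * L ^ (r - j) + u) =
      ∑ s ∈ range (L ^ j), kron M L j t s * f (u * L ^ j + s) := by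
  induction j generalizing t u with
  | zero => simp at ht; simp [ht, kron]
  | succ j ih =>
    have hLj : 0 < L ^ j := by
      rcases Nat.eq_zero_or_pos L with rfl | h
      · simp at ht
      · positivity
    have hd : r - 1 = j + (r - (j + 1)) := by omega
    have hd' : r - j = (r - (j + 1)) + 1 := by omega
    obtain ⟨l, t', hl, ht', rfl⟩ : ∃ l t', l < L ∧ t' < L ^ j ∧ t = l * L ^ j + t' :=
      ⟨t / L ^ j, t % L ^ j, by rwa [Nat.div_lt_iff_lt_mul hLj, mul_comm, ← pow_succ],
        Nat.mod_lt _ hLj, (Nat.div_add_mod' _ _).symm⟩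
    rw [Function.iterate_succ_apply', tensorRound]
    have hv : t' * L ^ (r - (j + 1)) + u < L ^ (r - 1) := by
      rw [hd, pow_add]
      calc t' * L ^ (r - (j + 1)) + u < t' * L ^ (r - (j + 1)) + L ^ (r - (j + 1)) := by omega
        _ = (t' + 1) * L ^ (r - (j + 1)) := by ring
        _ ≤ _ := Nat.mul_le_mul_right _ ht'
    have hx : (l * L ^ j + t') * L ^ (r - (j + 1)) + u
        = L ^ (r - 1) * l + (t' * L ^ (r - (j + 1)) + u) := by
      rw [hd, pow_add]; ring
    have hpos : 0 < L ^ (r - 1) := by omega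
    rw [hx, Nat.mul_add_div hpos, Nat.div_eq_of_lt hv, Nat.mul_add_mod, Nat.mod_eq_of_lt hv, add_zero,
      pow_succ', sum_range_mul_eq]
    refine sum_congr rfl fun a ha => ?_
    have e1 : (t' * L ^ (r - (j + 1)) + u) * L + a = t' * L ^ (r - j) + (u * L + a) := by
      rw [hd', pow_succ]; ring
    have hu' : u * L + a < L ^ (r - j) := by
      rw [hd', pow_succ]
      have ha := mem_range.mp ha
      calc u * L + a < u * L + L := by omega
        _ = (u + 1) * L := by ring
        _ ≤ _ := Nat.mul_le_mul_right _ hu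
    rw [e1, ih (by omega) t' _ ht' hu', mul_sum]
    refine sum_congr rfl fun s hs => ?_
    rw [kron_succ _ _ _ _ _ _ _ ht' (mem_range.mp hs), mul_assoc]
    congr 3
    ring

open Finset in
theorem iterate_tensorRound (M : ℕ → ℕ → R) (L r : ℕ) (f : ℕ → R) (t : ℕ) (ht : t < L ^ r) :
    (tensorRound M L (L ^ (r - 1)))^[r] f t = ∑ s ∈ range (L ^ r), kron M L r t s * f s := by
  simpa using iterate_tensorRound_aux M L r f r le_rfl t 0 ht (by simp)

open Finset in
-- The sum factors over the digit positions, since a Kronecker power is a product over digits. Each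
-- factor is the one-digit identity `h`.
theorem sum_kron_mul (V W : ℕ → ℕ → R) (L : ℕ)
    (h : ∀ a b c, a + b < L → c < L →
      ∑ l ∈ range L, V l a * V l b * W l c = if a + b = c then 1 else 0)
    (d d' d'' : ℕ → ℕ) (r : ℕ) (hd : ∀ i < r, d i + d' i < L) (hd'' : ∀ i < r, d'' i < L) :
    ∑ t ∈ range (L ^ r), kron V L r t (pack L d r) * kron V L r t (pack L d' r) *
      kron W L r t (pack L d'' r) = if ∀ i < r, d i + d' i = d'' i then 1 else 0 := by
  induction r with
  | zero => simp [kron]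
  | succ r ih =>
    rw [pow_succ', sum_range_mul_eq]
    have h1 : pack L d r < L ^ r := pack_lt fun i hi => by have := hd i (by omega); omega
    have h2 : pack L d' r < L ^ r := pack_lt fun i hi => by have := hd i (by omega); omega
    have h3 : pack L d'' r < L ^ r := pack_lt fun i hi => hd'' i (by omega)
    have : ∀ l ∈ range L, ∀ t ∈ range (L ^ r),
        kron V L (r + 1) (l * L ^ r + t) (pack L d (r + 1)) *
          kron V L (r + 1) (l * L ^ r + t) (pack L d' (r + 1)) *
          kron W L (r + 1) (l * L ^ r + t) (pack L d'' (r + 1)) =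
        (V l (d r) * V l (d' r) * W l (d'' r)) * (kron V L r t (pack L d r) *
          kron V L r t (pack L d' r) * kron W L r t (pack L d'' r)) := by
      intro l _ t ht
      have ht := mem_range.mp ht
      rw [pack_succ, pack_succ, pack_succ, kron_succ _ _ _ _ _ _ _ ht h1,
        kron_succ _ _ _ _ _ _ _ ht h2, kron_succ _ _ _ _ _ _ _ ht h3]
      ring
    rw [sum_congr rfl fun l hl => sum_congr rfl (this l hl)]
    simp_rw [← mul_sum]
    rw [← sum_mul, h _ _ _ (hd r (by omega)) (hd'' r (by omega)),
      ih (fun i hi => hd i (by omega)) (fun i hi => hd'' i (by omega))]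
    by_cases hr : d r + d' r = d'' r
    · rw [if_pos hr, one_mul]
      refine if_congr ⟨fun hh i hi => ?_, fun hh i hi => hh i (by omega)⟩ rfl rfl
      rcases Nat.lt_succ_iff_lt_or_eq.mp hi with hi | rfl
      · exact hh i hi
      · exact hr
    · rw [if_neg hr, zero_mul, if_neg]
      exact fun hh => hr (hh r (by omega))

end Tensor

/-! ### Roots of unity of order `q - 1` modulo a power of `q` -/

section Teichmuller

/-- Each `q`-th power improves a congruence by one power of `q`. Hence the Teichmüller
representative depends only on the residue modulo `q`, and is multiplicative in it. -/
theorem teichmuller_congr {q m : ℕ} {x y : ℕ} (h : x ≡ y [MOD q]) :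
    (x : ZMod (q ^ (m + 1))) ^ q ^ m = (y : ZMod (q ^ (m + 1))) ^ q ^ m := by
  have h1 : ((q : ℕ) : ℤ) ∣ (x : ℤ) - y := by
    have := (Int.natCast_modEq_iff.mpr h).symm.dvd
    simpa using this
  have h2 := dvd_sub_pow_of_dvd_sub h1 m
  have h3 : (((x : ℤ) ^ q ^ m - (y : ℤ) ^ q ^ m : ℤ) : ZMod (q ^ (m + 1))) = 0 := by
    rw [ZMod.intCast_zmod_eq_zero_iff_dvd]
    simpa using h2
  push_cast at h3
  exact sub_eq_zero.mp h3

open Finset in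
-- Orthogonality of characters. If `q - 1` divides `j`, every term is `1` by Euler's theorem, as `φ
-- (q ^ (m + 1)) = q ^ m * (q - 1)`. Otherwise, multiplying the summation variable by a generator
-- `g` multiplies the sum by `τ g ^ j`, and `τ g ^ j - 1` is a unit. That this factor is nonzero
-- would not suffice, for the ring has zero divisors.
theorem sum_teichmuller_pow (q : ℕ) [hq : Fact q.Prime] (m j : ℕ) :
    ∑ l ∈ range (q - 1), (((l + 1 : ℕ) : ZMod (q ^ (m + 1))) ^ q ^ m) ^ j =
      if q - 1 ∣ j then ((q - 1 : ℕ) : ZMod (q ^ (m + 1))) else 0 := by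
  have hcop : ∀ l, l < q - 1 → Nat.Coprime (l + 1) (q ^ (m + 1)) := fun l hl =>
    Nat.Coprime.pow_right _ (Nat.coprime_of_lt_prime (by omega) (by omega) hq.out).symm
  split_ifs with hj
  · obtain ⟨k, rfl⟩ := hj
    have : ∀ l ∈ range (q - 1),
        (((l + 1 : ℕ) : ZMod (q ^ (m + 1))) ^ q ^ m) ^ ((q - 1) * k) = 1 := by
      intro l hl
      have h1 := ZMod.pow_totient (ZMod.unitOfCoprime _ (hcop l (mem_range.mp hl)))
      rw [Nat.totient_prime_pow_succ hq.out] at h1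
      have h2 := congrArg Units.val h1
      rw [Units.val_pow_eq_pow_val, ZMod.coe_unitOfCoprime, Units.val_one] at h2
      rw [← pow_mul, ← mul_assoc, pow_mul, h2, one_pow]
    rw [sum_congr rfl this]
    simp
  · obtain ⟨g, hg⟩ := IsCyclic.exists_generator (α := (ZMod q)ˣ)
    have hord : orderOf g = q - 1 := by
      rw [orderOf_eq_card_of_forall_mem_zpowers hg, Nat.card_eq_fintype_card, ZMod.card_units q]
    have hgj : g ^ j ≠ 1 := fun h => hj (hord ▸ orderOf_dvd_of_pow_eq_one h)
    set τ : ℕ → ZMod (q ^ (m + 1)) := fun x => (x : ZMod (q ^ (m + 1))) ^ q ^ m with hτ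
    have hsum : ∑ l ∈ range (q - 1), (((l + 1 : ℕ) : ZMod (q ^ (m + 1))) ^ q ^ m) ^ j =
        ∑ v : (ZMod q)ˣ, τ (v : ZMod q).val ^ j := by
      symm
      refine sum_bij (fun v _ => (v : ZMod q).val - 1) ?_ ?_ ?_ ?_
      · intro v _
        have h1 := ZMod.val_lt (v : ZMod q)
        have h2 : (v : ZMod q).val ≠ 0 := by
          rw [Ne, ZMod.val_eq_zero]; exact v.ne_zero
        rw [mem_range]; omega
      · intro v _ v' _ h
        have h2 : (v : ZMod q).val ≠ 0 := by
          rw [Ne, ZMod.val_eq_zero]; exact v.ne_zero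
        have h3 : (v' : ZMod q).val ≠ 0 := by
          rw [Ne, ZMod.val_eq_zero]; exact v'.ne_zero
        exact Units.ext (ZMod.val_injective q (by omega))
      · intro l hl
        have hl := mem_range.mp hl
        refine ⟨ZMod.unitOfCoprime (l + 1)
          (Nat.coprime_of_lt_prime (by omega) (by omega) hq.out).symm, mem_univ _, ?_⟩
        rw [ZMod.coe_unitOfCoprime, ZMod.val_natCast, Nat.mod_eq_of_lt (by omega)]
        simp
      · intro v _
        have h2 : (v : ZMod q).val ≠ 0 := by
          rw [Ne, ZMod.val_eq_zero]; exact v.ne_zero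
        rw [Nat.sub_add_cancel (by omega)]
    rw [hsum]
    have hmul : ∀ v : (ZMod q)ˣ, τ ((g * v : (ZMod q)ˣ) : ZMod q).val =
        τ (g : ZMod q).val * τ (v : ZMod q).val := by
      intro v
      simp only [hτ]
      rw [← mul_pow, ← Nat.cast_mul]
      refine teichmuller_congr ?_
      rw [Units.val_mul, ZMod.val_mul]
      exact Nat.mod_modEq _ _
    have hshift : ∑ v : (ZMod q)ˣ, τ (v : ZMod q).val ^ j =
        τ (g : ZMod q).val ^ j * ∑ v : (ZMod q)ˣ, τ (v : ZMod q).val ^ j := by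
      conv_lhs => rw [← Equiv.sum_comp (Equiv.mulLeft g)]
      rw [mul_sum]
      refine sum_congr rfl fun v _ => ?_
      rw [Equiv.coe_mulLeft, hmul, mul_pow]
    -- Modulo `q` the power `q ^ m` acts as the identity, so divisibility of `τ g ^ j - 1` by `q`
    -- would force `g ^ j = 1`.
    have hunit : IsUnit (τ (g : ZMod q).val ^ j - 1) := by
      have hg0 : (g : ZMod q).val ≠ 0 := by
        rw [Ne, ZMod.val_eq_zero]; exact g.ne_zero
      have hpos : 1 ≤ ((g : ZMod q).val ^ q ^ m) ^ j :=
        Nat.one_le_iff_ne_zero.mpr (pow_ne_zero _ (pow_ne_zero _ hg0))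
      have e : τ (g : ZMod q).val ^ j - 1 =
          ((((g : ZMod q).val ^ q ^ m) ^ j - 1 : ℕ) : ZMod (q ^ (m + 1))) := by
        rw [Nat.cast_sub hpos]; simp [hτ]
      rw [e, ZMod.isUnit_iff_coprime]
      refine Nat.Coprime.pow_right _ (Nat.Coprime.symm ((Nat.Prime.coprime_iff_not_dvd hq.out).mpr ?_))
      rw [← ZMod.natCast_eq_zero_iff, Nat.cast_sub hpos]
      intro h
      have h1 : ((g : ZMod q)) ^ j = 1 := by
        have : (((g : ZMod q)) ^ q ^ m) ^ j = 1 := by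
          simpa [sub_eq_zero] using h
        rwa [ZMod.pow_card_pow] at this
      exact hgj (Units.ext (by simpa using h1))
    have : (τ (g : ZMod q).val ^ j - 1) * ∑ v : (ZMod q)ˣ, τ (v : ZMod q).val ^ j = 0 := by
      rw [sub_mul, one_mul, ← hshift, sub_self]
    exact (hunit.mul_right_eq_zero).mp this

/-- The geometric sum `(q ^ e - 1) / (q - 1)` times `q - 1` is `-1` modulo `q ^ e`. The inverse is
thus found by one division, with no Euclidean algorithm. -/
theorem inv_mul_pred (q e : ℕ) (hq : 2 ≤ q) :
    ((q ^ e - (q ^ e - 1) / (q - 1) : ℕ) : ZMod (q ^ e)) * ((q - 1 : ℕ) : ZMod (q ^ e)) = 1 := by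
  have h1 : 1 ≤ q ^ e := Nat.one_le_pow _ _ (by omega)
  have hdvd : q - 1 ∣ q ^ e - 1 := by simpa using Nat.sub_dvd_pow_sub_pow q 1 e
  have h2 : (q ^ e - 1) / (q - 1) ≤ q ^ e := (Nat.div_le_self _ _).trans (Nat.sub_le _ _)
  have h3 := Nat.div_mul_cancel hdvd
  rw [Nat.cast_sub h2, sub_mul, ← Nat.cast_mul ((q ^ e - 1) / (q - 1)), h3, Nat.cast_sub h1]
  simp only [ZMod.natCast_self, zero_mul, Nat.cast_one]
  ring

open Finset in
/-- The trilinear form of the cyclic group algebra diagonalised over `ZMod (q ^ (m + 1))`. -/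
theorem sum_teichmuller_trilinear (q : ℕ) [hq : Fact q.Prime] (m a b c : ℕ) (hab : a + b < q - 1)
    (hc : c < q - 1) (τ : ℕ → ZMod (q ^ (m + 1)))
    (hτ : ∀ l, τ l = ((l + 1 : ℕ) : ZMod (q ^ (m + 1))) ^ q ^ m) (u : ZMod (q ^ (m + 1)))
    (hu : u * ((q - 1 : ℕ) : ZMod (q ^ (m + 1))) = 1) :
    ∑ l ∈ range (q - 1), τ l ^ a * τ l ^ b * (u * τ l ^ (q - 1 - c)) =
      if a + b = c then 1 else 0 := by
  have : ∀ l ∈ range (q - 1), τ l ^ a * τ l ^ b * (u * τ l ^ (q - 1 - c)) =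
      u * (((l + 1 : ℕ) : ZMod (q ^ (m + 1))) ^ q ^ m) ^ (a + b + (q - 1 - c)) := by
    intro l _
    rw [← hτ l, pow_add _ _ (q - 1 - c), pow_add _ a b]; ring
  rw [sum_congr rfl this, ← mul_sum, sum_teichmuller_pow]
  -- The exponent lies strictly between `0` and twice `q - 1`, so it is a multiple of `q - 1` only
  -- when it equals `q - 1`, that is, when `a + b = c`. The assumption on `a + b` rules out a cyclic
  -- wraparound.
  by_cases h : a + b = c
  · rw [if_pos h, if_pos ⟨1, by omega⟩, hu]
  · rw [if_neg h, if_neg, mul_zero]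
    rintro ⟨k, hk⟩
    rcases k with _ | _ | k
    · omega
    · omega
    · have : (q - 1) * (k + 1 + 1) = (q - 1) * k + (q - 1) + (q - 1) := by ring
      have := Nat.zero_le ((q - 1) * k)
      omega

end Teichmuller

/-! ### Residue digits and carry patterns -/

/-- The digit `i` of the code of `x`: the residue modulo `P i`, or this residue plus `P i`, as the
`i`-th bit of `e` says. -/
def dig (P : ℕ → ℕ) (x e i : ℕ) : ℕ := x % P i + (e >>> i) % 2 * P i

theorem dig_zero (P : ℕ → ℕ) (x i : ℕ) : dig P x 0 i = x % P i := by simp [dig]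

theorem dig_lt {P : ℕ → ℕ} {L i : ℕ} (h1 : 1 ≤ P i) (h2 : 2 * P i ≤ L) (x e : ℕ) : dig P x e i < L := by
  have h3 := Nat.mod_lt x (show 0 < P i by omega)
  have h4 : (e >>> i) % 2 * P i ≤ 1 * P i := Nat.mul_le_mul_right _ (by omega)
  rw [dig]; omega

theorem dig_zero_add_lt {P : ℕ → ℕ} {L i : ℕ} (h1 : 1 ≤ P i) (h2 : 2 * P i ≤ L) (x y : ℕ) :
    dig P x 0 i + dig P y 0 i < L := by
  have h3 := Nat.mod_lt x (show 0 < P i by omega)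
  have h4 := Nat.mod_lt y (show 0 < P i by omega)
  rw [dig_zero, dig_zero]; omega

open Finset in
-- The sum of two residues is below `2 * p`, so it is either the residue of the sum or this residue
-- plus `p`, and never both.
theorem sum_carry_eq (p x y z : ℕ) (hp : 1 ≤ p) :
    ∑ β ∈ range 2, (if x % p + y % p = z % p + β * p then 1 else 0) =
      if x + y ≡ z [MOD p] then 1 else 0 := by
  have hx := Nat.mod_lt x (show 0 < p by omega)
  have hy := Nat.mod_lt y (show 0 < p by omega)
  have hz := Nat.mod_lt z (show 0 < p by omega)
  simp only [sum_range_succ, range_zero, sum_empty, zero_add, zero_mul, add_zero, one_mul]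
  have : x + y ≡ z [MOD p] ↔ (x % p + y % p) % p = z % p := by
    rw [Nat.ModEq, Nat.add_mod]
  rw [if_congr this rfl rfl]
  by_cases h : x % p + y % p < p
  · rw [Nat.mod_eq_of_lt h, if_neg (show ¬ x % p + y % p = z % p + p by omega)]
    rfl
  · have e : (x % p + y % p) % p = x % p + y % p - p := by
      rw [Nat.mod_eq_sub_mod (by omega), Nat.mod_eq_of_lt (by omega)]
    rw [e, if_neg (show ¬ x % p + y % p = z % p by omega), zero_add]
    exact if_congr (by omega) rfl rfl

theorem shiftRight_mod_two_of_lt (r e β i : ℕ) (hi : i < r) :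
    ((β * 2 ^ r + e) >>> i) % 2 = (e >>> i) % 2 := by
  have : 2 ^ r = 2 ^ i * (2 * 2 ^ (r - i - 1)) := by
    rw [← pow_succ', ← pow_add]; congr 1; omega
  rw [Nat.shiftRight_eq_div_pow, Nat.shiftRight_eq_div_pow, this,
    show β * (2 ^ i * (2 * 2 ^ (r - i - 1))) + e = 2 ^ i * (2 * (β * 2 ^ (r - i - 1))) + e by ring,
    Nat.mul_add_div (by positivity), Nat.mul_add_mod]

open Finset in
-- Each modulus determines its own carry bit, so a triple satisfying all congruences is found with
-- exactly one pattern `e` and any other triple with none. Nothing is missed or counted twice when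
-- all patterns are tried. The induction splits off the top bit of `e`.
theorem sum_dig_eq (P : ℕ → ℕ) (x y z r : ℕ) (hP : ∀ i < r, 1 ≤ P i) :
    ∑ e ∈ range (2 ^ r), (if ∀ i < r, dig P x 0 i + dig P y 0 i = dig P z e i then 1 else 0) =
      if ∀ i < r, x + y ≡ z [MOD P i] then 1 else 0 := by
  induction r with
  | zero => simp
  | succ r ih =>
    rw [pow_succ', sum_range_mul_eq]
    have : ∀ β ∈ range 2, ∀ e ∈ range (2 ^ r),
        (if ∀ i < r + 1, dig P x 0 i + dig P y 0 i = dig P z (β * 2 ^ r + e) i then 1 else 0) =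
        (if x % P r + y % P r = z % P r + β * P r then 1 else 0) *
          (if ∀ i < r, dig P x 0 i + dig P y 0 i = dig P z e i then 1 else 0) := by
      intro β hβ e he
      rw [ite_zero_mul_ite_zero, one_mul]
      refine if_congr ?_ rfl rfl
      have h1 : dig P z (β * 2 ^ r + e) r = z % P r + β * P r := by
        rw [dig, Nat.shiftRight_eq_div_pow, mul_comm β, Nat.mul_add_div (by positivity),
          Nat.div_eq_of_lt (mem_range.mp he), add_zero, Nat.mod_eq_of_lt (mem_range.mp hβ)]
      have h2 : ∀ i < r, dig P z (β * 2 ^ r + e) i = dig P z e i := fun i hi => by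
        rw [dig, shiftRight_mod_two_of_lt r e β i hi, dig]
      constructor
      · intro h
        refine ⟨?_, fun i hi => ?_⟩
        · have := h r (by omega)
          rwa [h1, dig_zero, dig_zero] at this
        · have := h i (by omega)
          rwa [h2 i hi] at this
      · rintro ⟨g1, g2⟩ i hi
        rcases Nat.lt_succ_iff_lt_or_eq.mp hi with hi | rfl
        · rw [h2 i hi, g2 i hi]
        · rw [h1, dig_zero, dig_zero, g1]
    rw [sum_congr rfl fun β hβ => sum_congr rfl (this β hβ)]
    simp_rw [← mul_sum]
    rw [← sum_mul, sum_carry_eq _ _ _ _ (hP r (by omega)), ih fun i hi => hP i (by omega),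
      ite_zero_mul_ite_zero, one_mul]
    refine if_congr ⟨?_, fun h => ⟨h r (by omega), fun i hi => h i (by omega)⟩⟩ rfl rfl
    rintro ⟨g1, g2⟩ i hi
    rcases Nat.lt_succ_iff_lt_or_eq.mp hi with hi | rfl
    · exact g2 i hi
    · exact g1

/-! ### Pseudo-solutions and the greedy choice of moduli -/

open Finset in
/-- The number of triples which satisfy `x + y = z` modulo all `P i`. -/
def pseudoCount (a : ℕ → ℕ) (N r : ℕ) (P : ℕ → ℕ) : ℕ :=
  ∑ x ∈ range N, ∑ y ∈ range N, ∑ z ∈ range N,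
    if ∀ i < r, a x + a y ≡ a z [MOD P i] then 1 else 0

theorem pseudoCount_le (a : ℕ → ℕ) (N r : ℕ) (P : ℕ → ℕ) : pseudoCount a N r P ≤ N ^ 3 := by
  refine (Finset.sum_le_sum fun x _ => Finset.sum_le_sum fun y _ => Finset.sum_le_sum
    (g := fun _ => 1) fun z _ => ?_).trans ?_
  · split_ifs <;> simp
  · simp; ring_nf; rfl

theorem card_primeFactors_le {n k : ℕ} (hn : n ≠ 0) (h : n < 2 ^ k) : n.primeFactors.card ≤ k := by
  by_contra! hk
  have h1 : 2 ^ n.primeFactors.card ≤ ∏ p ∈ n.primeFactors, p :=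
    Finset.pow_card_le_prod _ _ _ fun p hp => (Nat.prime_of_mem_primeFactors hp).two_le
  have h2 : ∏ p ∈ n.primeFactors, p ≤ n := Nat.le_of_dvd (by omega) (Nat.prod_primeFactors_dvd n)
  have h3 : 2 ^ k ≤ 2 ^ n.primeFactors.card := Nat.pow_le_pow_right (by norm_num) hk.le
  omega

open Finset in
-- The modulus `P i = 1` imposes no condition. A pseudo-solution for `P` survives a prime `p` in
-- this place only if `p` divides the difference `d` of the two sides. Without solutions `d` is
-- nonzero, and being below `2 ^ k` it has at most `k` prime factors.
theorem sum_pseudoCount_le (a : ℕ → ℕ) (N r i H k : ℕ) (P : ℕ → ℕ) (hi : i < r) (hPi : P i = 1)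
    (ha : ∀ x < N, 2 * a x < 2 ^ k)
    (hno : ∀ x < N, ∀ y < N, ∀ z < N, a x + a y ≠ a z) :
    ∑ p ∈ (Icc 1 H).filter Nat.Prime, pseudoCount a N r (Function.update P i p) ≤
      pseudoCount a N r P * k := by
  simp only [pseudoCount]
  rw [sum_comm, sum_mul]
  refine sum_le_sum fun x hx => ?_
  rw [sum_comm, sum_mul]
  refine sum_le_sum fun y hy => ?_
  rw [sum_comm, sum_mul]
  refine sum_le_sum fun z hz => ?_
  rw [mem_range] at hx hy hz
  have hax := ha x hx
  have hay := ha y hy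
  have haz := ha z hz
  have hne := hno x hx y hy z hz
  set d : ℕ := ((a z : ℤ) - (a x + a y : ℕ)).natAbs with hd
  have hd0 : d ≠ 0 := by omega
  have hdk : d < 2 ^ k := by omega
  have hiff : ∀ p, a x + a y ≡ a z [MOD p] ↔ p ∣ d := by
    intro p
    rw [Nat.modEq_iff_dvd, hd, Int.natCast_dvd]
  split_ifs with h
  · rw [one_mul, sum_boole]
    refine (Nat.cast_id _).le.trans ((card_le_card ?_).trans (card_primeFactors_le hd0 hdk))
    intro p hp
    simp only [mem_filter, mem_Icc] at hp
    rw [Nat.mem_primeFactors]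
    refine ⟨hp.1.2, ?_, hd0⟩
    have := hp.2 i hi
    rwa [Function.update_self, hiff] at this
  · rw [zero_mul]
    refine (sum_eq_zero fun p _ => ?_).le
    rw [if_neg]
    intro hh
    refine h fun j hj => ?_
    by_cases hji : j = i
    · rw [hji, hPi]; exact Nat.modEq_one
    · have := hh j hj
      rwa [Function.update_of_ne hji] at this

open Finset in
-- The minimum over all candidates is at most the average over the primes among them. The algorithm
-- therefore need not know which candidates are prime.
theorem exists_pseudoCount_le (a : ℕ → ℕ) (N r i H k : ℕ) (P : ℕ → ℕ) (hi : i < r) (hPi : P i = 1)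
    (ha : ∀ x < N, 2 * a x < 2 ^ k)
    (hno : ∀ x < N, ∀ y < N, ∀ z < N, a x + a y ≠ a z) (best : ℕ)
    (hbest : ∀ p, 1 ≤ p → p ≤ H → best ≤ pseudoCount a N r (Function.update P i p)) :
    best * ((Icc 1 H).filter Nat.Prime).card ≤ pseudoCount a N r P * k := by
  refine le_trans ?_ (sum_pseudoCount_le a N r i H k P hi hPi ha hno)
  rw [mul_comm, ← smul_eq_mul, ← sum_const]
  refine sum_le_sum fun p hp => ?_
  simp only [mem_filter, mem_Icc] at hp
  exact hbest p hp.1.1 hp.1.2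

/-- With `l` a binary logarithm, this says that any fixed power of a logarithm is absorbed by a
linear factor. -/
theorem pow_le_mul_two_pow (k l : ℕ) (hk : 1 ≤ k) : l ^ k ≤ k ^ k * 2 ^ l := by
  have h1 : l ≤ k * (l / k + 1) := (Nat.lt_mul_div_succ l (by omega)).le
  have h2 : l / k + 1 ≤ 2 ^ (l / k) := Nat.lt_two_pow_self
  calc l ^ k ≤ (k * 2 ^ (l / k)) ^ k := Nat.pow_le_pow_left (h1.trans (Nat.mul_le_mul_left _ h2)) k
    _ = k ^ k * 2 ^ (l / k * k) := by rw [mul_pow, pow_mul]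
    _ ≤ _ := Nat.mul_le_mul_left _ (Nat.pow_le_pow_right (by norm_num) (Nat.div_mul_le_self _ _))

/-- Chebyshev's argument: the least common multiple of `1, …, H` is at least `2 ^ H / (H + 1)`,
while every prime contributes to it a power of at most `H < 2 ^ l`. -/
theorem le_mul_card_primes (H l : ℕ) (hH : 2 ≤ H) (hl : H < 2 ^ l) :
    H ≤ 2 * l * ((Finset.Icc 1 H).filter Nat.Prime).card := by
  set S := (Finset.Icc 1 H).filter Nat.Prime with hS
  have hS' : Nat.primesLE H = S := by
    ext p
    simp only [Nat.mem_primesLE, hS, Finset.mem_filter, Finset.mem_Icc]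
    exact ⟨fun h => ⟨⟨h.2.one_lt.le, h.1⟩, h.2⟩, fun h => ⟨h.1.2, h.2⟩⟩
  have hpos : 1 ≤ S.card := Finset.card_pos.mpr ⟨2, by
    simp only [hS, Finset.mem_filter, Finset.mem_Icc]; exact ⟨⟨by norm_num, hH⟩, Nat.prime_two⟩⟩
  have h1 := Chebyshev.two_pow_le_mul_lcmUpto H
  rw [Nat.lcmUpto_eq_prod_pow_log, hS'] at h1
  have h2 : ∏ p ∈ S, p ^ Nat.log p H ≤ (2 ^ l) ^ S.card :=
    Finset.prod_le_pow_card _ _ _ fun p _ => (Nat.pow_log_le_self p (by omega)).trans hl.le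
  have h3 : 2 ^ H ≤ 2 ^ (l * (S.card + 1)) := by
    calc 2 ^ H ≤ (H + 1) * ∏ p ∈ S, p ^ Nat.log p H := h1
      _ ≤ 2 ^ l * (2 ^ l) ^ S.card := Nat.mul_le_mul hl h2
      _ = _ := by rw [← pow_mul, ← pow_add]; ring_nf
  have h4 : H ≤ l * (S.card + 1) := (Nat.pow_le_pow_iff_right (by norm_num)).mp h3
  nlinarith

/-- The constant of the threshold for the number of pseudo-solutions. -/
def threshConst (m r : ℕ) : ℕ := (6 * m) ^ r * (2 * (2 * r + 1) ^ (2 * r + 1))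

/-- There are at least `q / (6 * l)` primes among the candidates, so `r` choices gain `q ^ r` up to
a factor `l ^ (2 * r)`, counting the `l` in the number of prime factors as well. That factor is
`O(q)`, which is why only `q ^ (r - 1)` is claimed. -/
theorem pow_mul_pow_le_threshConst (m r q : ℕ) (hr : 1 ≤ r) (hq : 5 ≤ q) :
    (m * (Nat.log 2 q + 1)) ^ r * q ^ (r - 1) ≤
      threshConst m r * ((Finset.Icc 1 ((q - 1) / 2)).filter Nat.Prime).card ^ r := by
  set l := Nat.log 2 q + 1 with hl
  set S := ((Finset.Icc 1 ((q - 1) / 2)).filter Nat.Prime).card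
  have hql : q < 2 ^ l := Nat.lt_pow_succ_log_self (by norm_num) q
  have h1 := le_mul_card_primes ((q - 1) / 2) l (by omega) (by omega)
  have h2 : q ≤ 6 * l * S := by
    change (q - 1) / 2 ≤ 2 * l * S at h1
    have : q ≤ 3 * ((q - 1) / 2) := by omega
    nlinarith
  have h3 : l ^ (2 * r) ≤ 2 * (2 * r + 1) ^ (2 * r + 1) * q := by
    have e1 : l ^ (2 * r) ≤ l ^ (2 * r + 1) := Nat.pow_le_pow_right (by omega) (by omega)
    have e2 := pow_le_mul_two_pow (2 * r + 1) l (by omega)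
    have e3 : 2 ^ l ≤ 2 * q := by
      rw [hl, pow_succ, mul_comm]
      exact Nat.mul_le_mul_left _ (Nat.pow_log_le_self 2 (by omega))
    calc l ^ (2 * r) ≤ (2 * r + 1) ^ (2 * r + 1) * 2 ^ l := e1.trans e2
      _ ≤ (2 * r + 1) ^ (2 * r + 1) * (2 * q) := Nat.mul_le_mul_left _ e3
      _ = _ := by ring
  refine Nat.le_of_mul_le_mul_right (c := q) ?_ (by omega)
  have hqr : q ^ (r - 1) * q = q ^ r := by rw [← pow_succ]; congr 1; omega
  calc (m * l) ^ r * q ^ (r - 1) * q = (m * l) ^ r * q ^ r := by rw [mul_assoc, hqr]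
    _ ≤ (m * l) ^ r * (6 * l * S) ^ r := Nat.mul_le_mul_left _ (Nat.pow_le_pow_left h2 r)
    _ = (6 * m) ^ r * l ^ (2 * r) * S ^ r := by
      rw [← mul_pow, pow_mul l 2 r, ← mul_pow, ← mul_pow]; congr 1; ring
    _ ≤ (6 * m) ^ r * (2 * (2 * r + 1) ^ (2 * r + 1) * q) * S ^ r := by gcongr
    _ = threshConst m r * S ^ r * q := by rw [threshConst]; ring

/-- The greedy choice of moduli leaves few pseudo-solutions if there are no solutions. -/
theorem le_threshold (N C q r S Λ cnt : ℕ) (hS : 1 ≤ S)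
    (h1 : cnt * S ^ r ≤ N ^ 3 * Λ ^ r) (h2 : Λ ^ r * q ^ (r - 1) ≤ C * S ^ r) (hq : 1 ≤ q) :
    cnt ≤ C * N ^ 3 / q ^ (r - 1) := by
  rw [Nat.le_div_iff_mul_le (by positivity)]
  refine Nat.le_of_mul_le_mul_right (c := S ^ r) ?_ (by positivity)
  calc cnt * q ^ (r - 1) * S ^ r = cnt * S ^ r * q ^ (r - 1) := by ring
    _ ≤ N ^ 3 * Λ ^ r * q ^ (r - 1) := Nat.mul_le_mul_right _ h1
    _ = N ^ 3 * (Λ ^ r * q ^ (r - 1)) := by ring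
    _ ≤ N ^ 3 * (C * S ^ r) := Nat.mul_le_mul_left _ h2
    _ = _ := by ring

/-! ### Counting pseudo-solutions through histograms of codes -/

section Histogram

open Finset

/-- The number of pairs `(x, e)` with the code `s`. -/
def hist (a : ℕ → ℕ) (L r : ℕ) (P : ℕ → ℕ) (N E s : ℕ) : ℕ :=
  ∑ x ∈ range N, ∑ e ∈ range E, if pack L (dig P (a x) e) r = s then 1 else 0

theorem hist_le (a : ℕ → ℕ) (L r : ℕ) (P : ℕ → ℕ) (N E s : ℕ) : hist a L r P N E s ≤ N * E := by
  refine (sum_le_sum fun x _ => sum_le_sum (g := fun _ => 1) fun e _ => ?_).trans ?_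
  · split_ifs <;> simp
  · simp

theorem sum_mul_hist {R : Type*} [CommRing R] (f : ℕ → R) (a : ℕ → ℕ) (L r : ℕ) (P : ℕ → ℕ)
    (N E : ℕ) (h : ∀ i < r, 1 ≤ P i ∧ 2 * P i ≤ L) :
    ∑ s ∈ range (L ^ r), f s * (hist a L r P N E s : R) =
      ∑ x ∈ range N, ∑ e ∈ range E, f (pack L (dig P (a x) e) r) := by
  simp only [hist, Nat.cast_sum, mul_sum]
  rw [sum_comm]
  refine sum_congr rfl fun x _ => ?_
  rw [sum_comm]
  refine sum_congr rfl fun e _ => ?_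
  simp only [Nat.cast_ite, Nat.cast_one, Nat.cast_zero, mul_ite, mul_one, mul_zero]
  rw [sum_ite_eq, if_pos]
  exact mem_range.mpr (pack_lt fun i hi => dig_lt (h i hi).1 (h i hi).2 _ _)

theorem pseudoCount_eq (a : ℕ → ℕ) (N r : ℕ) (P : ℕ → ℕ) (h : ∀ i < r, 1 ≤ P i) :
    pseudoCount a N r P = ∑ x ∈ range N, ∑ y ∈ range N, ∑ z ∈ range N, ∑ e ∈ range (2 ^ r),
      if ∀ i < r, dig P (a x) 0 i + dig P (a y) 0 i = dig P (a z) e i then 1 else 0 := by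
  simp only [sum_dig_eq P _ _ _ r h]
  rfl

/-- Expanding the three transforms gives a sum over `x`, `y`, `z` and `e` in which the sum over `t`
tests whether the digits add up. Only the summands `x` and `y` are coded without carries, whence `1`
and `2 ^ r` in the histograms. No inverse transform is needed, since only the total is wanted. -/
theorem sum_transform_eq_pseudoCount {R : Type*} [CommRing R] (V W : ℕ → ℕ → R) (L : ℕ)
    (hVW : ∀ a b c, a + b < L → c < L →
      ∑ l ∈ range L, V l a * V l b * W l c = if a + b = c then 1 else 0)
    (a : ℕ → ℕ) (N r : ℕ) (P : ℕ → ℕ) (h : ∀ i < r, 1 ≤ P i ∧ 2 * P i ≤ L) :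
    ∑ t ∈ range (L ^ r),
      (∑ s ∈ range (L ^ r), kron V L r t s * (hist a L r P N 1 s : R)) *
      (∑ s ∈ range (L ^ r), kron V L r t s * (hist a L r P N 1 s : R)) *
      (∑ s ∈ range (L ^ r), kron W L r t s * (hist a L r P N (2 ^ r) s : R)) =
    (pseudoCount a N r P : R) := by
  rw [pseudoCount_eq a N r P fun i hi => (h i hi).1]
  simp only [sum_mul_hist _ a L r P N _ h, range_one, sum_singleton, Nat.cast_sum]
  have : ∀ f : ℕ → R, ∀ g : ℕ → ℕ → R, (∑ x ∈ range N, f x) * (∑ x ∈ range N, f x) *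
      (∑ z ∈ range N, ∑ e ∈ range (2 ^ r), g z e) = ∑ x ∈ range N, ∑ y ∈ range N,
        ∑ z ∈ range N, ∑ e ∈ range (2 ^ r), f x * f y * g z e := by
    intro f g
    rw [sum_mul_sum, sum_mul]
    refine sum_congr rfl fun x _ => ?_
    rw [sum_mul]
    refine sum_congr rfl fun y _ => ?_
    rw [mul_sum]
    exact sum_congr rfl fun z _ => mul_sum _ _ _
  simp only [this]
  rw [sum_comm]
  refine sum_congr rfl fun x _ => ?_
  rw [sum_comm]
  refine sum_congr rfl fun y _ => ?_
  rw [sum_comm]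
  refine sum_congr rfl fun z _ => ?_
  rw [sum_comm]
  refine sum_congr rfl fun e _ => ?_
  rw [sum_kron_mul V W L hVW _ _ _ r (fun i hi => dig_zero_add_lt (h i hi).1 (h i hi).2 _ _)
    (fun i hi => dig_lt (h i hi).1 (h i hi).2 _ _)]
  push_cast
  rfl

/-- The total work on witnesses is the number of pseudo-solutions. -/
theorem sum_hist_mul_hist (a : ℕ → ℕ) (L N r : ℕ) (P : ℕ → ℕ)
    (h : ∀ i < r, 1 ≤ P i ∧ 2 * P i ≤ L) :
    ∑ z ∈ range N, ∑ e ∈ range (2 ^ r), ∑ q ∈ antidiagonal (pack L (dig P (a z) e) r),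
      hist a L r P N 1 q.1 * hist a L r P N 1 q.2 = pseudoCount a N r P := by
  rw [pseudoCount_eq a N r P fun i hi => (h i hi).1]
  simp only [hist, range_one, sum_singleton]
  have : ∀ z ∈ range N, ∀ e ∈ range (2 ^ r),
      (∑ q ∈ antidiagonal (pack L (dig P (a z) e) r),
        (∑ x ∈ range N, if pack L (dig P (a x) 0) r = q.1 then 1 else 0) *
          ∑ y ∈ range N, if pack L (dig P (a y) 0) r = q.2 then 1 else 0) =
      ∑ x ∈ range N, ∑ y ∈ range N,
        if ∀ i < r, dig P (a x) 0 i + dig P (a y) 0 i = dig P (a z) e i then 1 else 0 := by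
    intro z _ e _
    simp_rw [sum_mul_sum]
    rw [sum_comm]
    refine sum_congr rfl fun x _ => ?_
    rw [sum_comm]
    refine sum_congr rfl fun y _ => ?_
    simp_rw [ite_zero_mul_ite_zero, one_mul]
    -- All digits involved are below `L`, so equality of the packed numbers is equality of their
    -- digits.
    have hiff : (∀ i < r, dig P (a x) 0 i + dig P (a y) 0 i = dig P (a z) e i) ↔
        pack L (dig P (a x) 0) r + pack L (dig P (a y) 0) r = pack L (dig P (a z) e) r := by
      rw [pack_add]
      constructor
      · intro hh
        exact sum_congr rfl fun i hi => congrArg (· * L ^ i) (hh i (mem_range.mp hi))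
      · exact pack_inj (fun i hi => dig_zero_add_lt (h i hi).1 (h i hi).2 _ _)
          (fun i hi => dig_lt (h i hi).1 (h i hi).2 _ _)
    rw [if_congr hiff rfl rfl]
    have : ∀ q : ℕ × ℕ, (pack L (dig P (a x) 0) r = q.1 ∧ pack L (dig P (a y) 0) r = q.2) ↔
        (pack L (dig P (a x) 0) r, pack L (dig P (a y) 0) r) = q := fun q => by
      rw [Prod.ext_iff]
    simp_rw [this]
    rw [sum_ite_eq]
    simp only [HasAntidiagonal.mem_antidiagonal]
  rw [sum_congr rfl fun z hz => sum_congr rfl (this z hz)]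
  rw [sum_congr rfl fun z _ => sum_comm, sum_comm]
  refine sum_congr rfl fun x _ => ?_
  rw [sum_congr rfl fun z _ => sum_comm, sum_comm]

end Histogram

/-! ### Parameters of the algorithm and the layout of its memory -/

namespace WordRAM

attribute [simp] BinOp.eval Ex.eval Ex.Safe Ex.cost

infixr:60 ";;" => Prog.seq

/-- The parameters of a run: the input `a 0, …, a (N - 1)`, the prime `q`, the number `r` of moduli,
the exponent of the prime in the modulus of the arithmetic, and the word length. -/
structure Par where
  N : ℕ
  a : ℕ → ℕ
  q : ℕ
  r : ℕ
  m : ℕ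
  w : ℕ

namespace Par

variable (p : Par)

/-- The base of the positional codes. -/
def L : ℕ := p.q - 1

/-- A bound for the codes. -/
def D : ℕ := p.L ^ p.r

/-- The weight of the highest digit. -/
def D' : ℕ := p.L ^ (p.r - 1)

/-- The modulus of the arithmetic. -/
def Q : ℕ := p.q ^ (p.m + 1)

/-- The number of carry patterns. -/
def E : ℕ := 2 ^ p.r

/-- The candidates for the moduli are `1, …, H`. -/
def H : ℕ := p.L / 2

/-- The Teichmüller representatives. -/
def τ (l : ℕ) : ZMod p.Q := ((l + 1 : ℕ) : ZMod p.Q) ^ p.q ^ p.m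

/-- The inverse of `L` modulo `Q`. -/
def u : ℕ := p.Q - (p.Q - 1) / (p.q - 1)

/-- The matrix of the transformation. -/
def V (l s : ℕ) : ZMod p.Q := p.τ l ^ s

/-- The matrix of the dual transformation. -/
def W (l s : ℕ) : ZMod p.Q := p.u * p.τ l ^ (p.L - s)

/-- The parameters are admissible, and numbers up to `8 * M ^ 4` fit into a word. -/
structure Ok (M : ℕ) : Prop where
  prime : p.q.Prime
  five_le : 5 ≤ p.q
  one_le_r : 1 ≤ p.r
  one_le_N : 1 ≤ p.N
  hN3 : p.N ^ 3 < p.Q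
  hM : 8 ≤ M
  hN : p.N ≤ M
  hq : p.q ≤ M
  hr : p.r ≤ M
  hm : p.m + 1 ≤ M
  hD : p.D ≤ M
  hQ : p.Q ≤ M
  hE : p.E ≤ M
  ha : ∀ x < p.N, p.a x ≤ M
  hw : 8 * M ^ 4 ≤ 2 ^ p.w

/-- The parameters, the input and the tables are in place. -/
structure Env (s : State) : Prop where
  r0 : s.reg 0 = p.N
  r1 : s.reg 1 = p.q
  r2 : s.reg 2 = p.L
  r3 : s.reg 3 = p.D
  r4 : s.reg 4 = p.D'
  r5 : s.reg 5 = p.Q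
  r6 : s.reg 6 = p.E
  r7 : s.reg 7 = p.r
  r8 : s.reg 8 = p.H
  inp : ∀ x < p.N, s.mem 0 (x + 1) = p.a x
  tabV : ∀ l < p.L, ∀ i < p.L, s.mem 1 (l * p.L + i) < p.Q ∧
    (s.mem 1 (l * p.L + i) : ZMod p.Q) = p.V l i
  tabW : ∀ l < p.L, ∀ i < p.L, s.mem 2 (l * p.L + i) < p.Q ∧
    (s.mem 2 (l * p.L + i) : ZMod p.Q) = p.W l i

/-- The moduli are in place. -/
def Moduli (P : ℕ → ℕ) (s : State) : Prop :=
  ∀ i < p.r, s.mem 3 i = P i ∧ 1 ≤ P i ∧ P i ≤ p.H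

variable {p}

theorem Env.of_eq {s s' : State} (h : p.Env s) (hr : ∀ i < 9, s'.reg i = s.reg i)
    (hm : ∀ a < 3, s'.mem a = s.mem a) : p.Env s' := by
  obtain ⟨h0, h1, h2, h3, h4, h5, h6, h7, h8, i0, i1, i2⟩ := h
  constructor <;> simp only [hr, hm, Nat.reduceLT] <;> assumption

theorem Env.frame {s s' : State} {b : Prog} (h : p.Env s) (hF : Frame b s s')
    (hr : b.allR (Nat.ble 20) = true) (hm : b.allM (Nat.ble 3) = true) : p.Env s' := by
  refine h.of_eq (fun i hi => hF.reg i ?_) fun a ha => hF.mem a ?_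
  · rw [Bool.and_eq_true, Bool.not_eq_true', isTemp_eq_false]
    refine ⟨by omega, Prog.allR_mono (fun x hx => ?_) hr⟩
    rw [Nat.ble_eq] at hx
    rw [Bool.not_eq_true', beq_eq_false]; omega
  · refine Prog.allM_mono (fun x hx => ?_) hm
    rw [Nat.ble_eq] at hx
    rw [Bool.not_eq_true', beq_eq_false]; omega

theorem Env.setReg {s : State} (h : p.Env s) {i : ℕ} (v : ℕ) (hi : 20 ≤ i) : p.Env (s.setReg i v) :=
  h.of_eq (fun j hj => by rw [State.setReg_reg, if_neg (by omega)]) fun _ _ => rfl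

theorem Env.setMem {s : State} (h : p.Env s) {b : ℕ} (i v : ℕ) (hb : 3 ≤ b) : p.Env (s.setMem b i v) :=
  h.of_eq (fun _ _ => rfl) fun a ha => by rw [State.setMem_mem, if_neg (by omega)]

theorem Moduli.of_eq {P : ℕ → ℕ} {s s' : State} (h : p.Moduli P s) (hm : s'.mem 3 = s.mem 3) :
    p.Moduli P s' := by
  intro i hi; rw [hm]; exact h i hi

theorem Moduli.digits {P : ℕ → ℕ} {s : State} (h : p.Moduli P s) :
    ∀ i < p.r, 1 ≤ P i ∧ 2 * P i ≤ p.L := by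
  intro i hi
  have := h i hi
  refine ⟨this.2.1, ?_⟩
  have h2 := this.2.2
  rw [H] at h2; omega

/-- With `M * M` and `M * M * M` as atoms, overflow conditions up to degree three become linear
arithmetic. -/
theorem Ok.bounds {M : ℕ} (h : p.Ok M) : 1 ≤ p.L ∧ p.L ≤ M ∧ 8 * M ≤ M * M ∧
    8 * (M * M) ≤ M * M * M ∧ 8 * (M * M * M) ≤ 2 ^ p.w := by
  have h1 := h.five_le
  have h2 := h.hq
  have h3 := h.hM
  refine ⟨by rw [L]; omega, by rw [L]; omega, Nat.mul_le_mul_right _ h3, ?_,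
    le_trans ?_ ((Nat.le_mul_of_pos_left _ (by norm_num)).trans h.hw)⟩
  · rw [mul_comm 8]; exact Nat.mul_le_mul_left _ h3
  · rw [mul_comm 8, show M ^ 4 = M * M * M * M by ring]; exact Nat.mul_le_mul_left _ h3

theorem D_eq (h1 : 1 ≤ p.r) : p.D = p.L * p.D' := by
  rw [D, D', ← pow_succ']; congr 1; omega

/-! ### Codes, buckets and histograms -/

/-- The code of the number in register `20` and the carry pattern in register `21`. -/
def codeProg : Prog :=
  asg 22 (.c 0) ;; asg 24 (.c 1) ;;
  forTo 23 7
    (asg 22 (.b .add (.r 22) (.b .mul (.b .add (.b .mod (.r 20) (.ld 3 (.r 23)))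
      (.b .mul (.b .mod (.b .shiftr (.r 21) (.r 23)) (.c 2)) (.ld 3 (.r 23)))) (.r 24))) ;;
    asg 24 (.b .mul (.r 24) (.r 2)))

theorem runs_codeProg {M : ℕ} (hp : p.Ok M) {P : ℕ → ℕ} {s : State} (hs : p.Env s)
    (hP : p.Moduli P s) (hx : s.reg 20 ≤ M) (he : s.reg 21 ≤ M) :
    Runs p.w codeProg s (p.r * 40 + 20) (fun s' =>
      s'.reg 22 = pack p.L (dig P (s.reg 20) (s.reg 21)) p.r) := by
  obtain ⟨hL1, hLM, hM2, hM3, hw⟩ := hp.bounds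
  obtain ⟨-, -, -, -, -, hM, -, -, hr, -, hD, -, -, -, -⟩ := hp
  obtain ⟨B, hB⟩ : ∃ B, B = 2 ^ p.w := ⟨_, rfl⟩
  rw [← hB] at hw
  refine Runs.seq_asg rfl (by simp) (by simp) ?_
  refine Runs.seq_asg rfl (by simp) (by simp [← hB]; omega) ?_
  refine Runs.forTo_le p.r 30
    (fun j s' => s'.reg 22 = pack p.L (dig P (s.reg 20) (s.reg 21)) j ∧ s'.reg 24 = p.L ^ j)
    (by simp; omega) (by simpa using hs.r7) (by omega) rfl rfl rfl rfl rfl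
    (by simp [pack]) ?_ (fun s' h _ _ => h.1)
  rintro j hj s' ⟨h1, h2⟩ h3 hF
  have e20 : s'.reg 20 = s.reg 20 := (hF.reg 20 rfl).trans (by simp)
  have e21 : s'.reg 21 = s.reg 21 := (hF.reg 21 rfl).trans (by simp)
  have e2 : s'.reg 2 = p.L := (hF.reg 2 rfl).trans (by simpa using hs.r2)
  have e3 : s'.mem 3 j = P j := by rw [hF.mem 3 rfl]; exact (hP j hj).1
  have hPj := hP.digits j hj
  have hd : dig P (s.reg 20) (s.reg 21) j < p.L := dig_lt hPj.1 hPj.2 _ _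
  -- The next partial code is below `L ^ (j + 1) ≤ D ≤ M`; this bounds the result of the update,
  -- product included.
  have hpk : pack p.L (dig P (s.reg 20) (s.reg 21)) (j + 1) < p.L ^ (j + 1) :=
    pack_lt fun i hi => dig_lt (hP.digits i (by omega)).1 (hP.digits i (by omega)).2 _ _
  have hLj : p.L ^ (j + 1) ≤ M := (Nat.pow_le_pow_right hL1 hj).trans hD
  have hLj' : p.L ^ j ≤ M := (Nat.pow_le_pow_right hL1 hj.le).trans hD
  rw [pack_succ] at hpk
  refine Runs.seq_asg rfl (by simp) ?_ ?_
  · simp [← hB, h1, h2, h3, e20, e21, e3]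
    have b1 := Nat.shiftRight_le (s.reg 21) j
    have b2 := Nat.mod_le (s.reg 20) (P j)
    have b3 := Nat.mod_lt (s.reg 21 >>> j) (show 0 < 2 by norm_num)
    rw [dig] at hpk hd
    and_intros <;> omega
  · have e : p.L ^ j * p.L ≤ M := by rwa [← pow_succ]
    refine Runs.asg_le rfl (by simp) ?_ ?_
    · simp [← hB, h2, e2]
      omega
    · simp [h1, h2, h3, e20, e21, e2, e3, pack_succ, pow_succ, dig]
      ring

/-- The code of an input number. -/
def code (p : Par) (P : ℕ → ℕ) (x : ℕ) : ℕ := pack p.L (dig P (p.a x) 0) p.r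

/-- The distribution of the codes in array `10`, and the numbers with the code `c` in the cells from
`c * N` on of array `13`. -/
def bucketProg : Prog :=
  forTo 25 3 (sto 10 (.r 25) (.c 0)) ;;
  asg 21 (.c 0) ;;
  forTo 26 0
    (asg 20 (.ld 0 (.b .add (.r 26) (.c 1))) ;;
    codeProg ;;
    sto 13 (.b .add (.b .mul (.r 22) (.r 0)) (.ld 10 (.r 22))) (.r 20) ;;
    sto 10 (.r 22) (.b .add (.ld 10 (.r 22)) (.c 1)))

/-- The arrays `10` and `13` after the treatment of the first `j` numbers. -/
def Buckets (p : Par) (P : ℕ → ℕ) (j : ℕ) (s : State) : Prop :=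
  (∀ c < p.D, s.mem 10 c = hist p.a p.L p.r P j 1 c) ∧
  (∀ c < p.D, ∀ k < hist p.a p.L p.r P j 1 c,
    ∃ x < j, p.code P x = c ∧ s.mem 13 (c * p.N + k) = p.a x) ∧
  ∀ x < j, ∃ k < hist p.a p.L p.r P j 1 (p.code P x), s.mem 13 (p.code P x * p.N + k) = p.a x

theorem hist_one_succ (P : ℕ → ℕ) (j c : ℕ) : hist p.a p.L p.r P (j + 1) 1 c =
    hist p.a p.L p.r P j 1 c + if p.code P j = c then 1 else 0 := by
  simp only [hist, Finset.sum_range_succ, Finset.range_zero, Finset.sum_empty, zero_add, code]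
  rfl

theorem code_lt {P : ℕ → ℕ} {s : State} (h : p.Moduli P s) (x : ℕ) : p.code P x < p.D :=
  pack_lt fun i hi => dig_lt (h.digits i hi).1 (h.digits i hi).2 _ _

theorem mul_add_inj {N c c' k k' : ℕ} (hk : k < N) (hk' : k' < N) (h : c * N + k = c' * N + k') :
    c = c' ∧ k = k' := by
  have hN : 0 < N := by omega
  have h1 := congrArg (· / N) h
  simp only [mul_comm _ N, Nat.mul_add_div hN, Nat.div_eq_of_lt hk, Nat.div_eq_of_lt hk',
    add_zero] at h1
  subst h1
  exact ⟨rfl, by omega⟩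

/-- The new number goes to the first free cell of its bucket. A bucket has fewer than `N` occupied
cells so far, so the blocks of length `N` do not overlap and nothing is overwritten. -/
theorem Buckets.step {P : ℕ → ℕ} {j : ℕ} {s s' : State} (h : p.Buckets P j s) (hj : j < p.N)
    (h13 : s'.mem 13 = Function.update (s.mem 13)
      (p.code P j * p.N + hist p.a p.L p.r P j 1 (p.code P j)) (p.a j))
    (h10 : s'.mem 10 = Function.update (s.mem 10) (p.code P j)
      (hist p.a p.L p.r P j 1 (p.code P j) + 1)) : p.Buckets P (j + 1) s' := by
  obtain ⟨h1, h2, h3⟩ := h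
  have hle : ∀ c, hist p.a p.L p.r P j 1 c ≤ j := fun c => by
    simpa using hist_le p.a p.L p.r P j 1 c
  have hle' := hle (p.code P j)
  refine ⟨fun c hc => ?_, fun c hc k hk => ?_, fun x hx => ?_⟩
  · rw [h10, hist_one_succ, Function.update_apply, h1 c hc]
    by_cases hcc : c = p.code P j
    · simp [hcc]
    · rw [if_neg hcc, if_neg (Ne.symm hcc), add_zero]
  · rw [hist_one_succ] at hk
    rw [h13, Function.update_apply]
    split_ifs with heq
    · have hk' : k < p.N := by have := hle c; split_ifs at hk <;> omega
      exact ⟨j, by omega, ((mul_add_inj hk' (by omega) heq).1).symm, rfl⟩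
    · have hk' : k < hist p.a p.L p.r P j 1 c := by
        by_contra! hge
        split_ifs at hk with hcc
        · subst hcc
          exact heq (by congr 1; omega)
        · omega
      obtain ⟨x, hx, hx'⟩ := h2 c hc k hk'
      exact ⟨x, by omega, hx'⟩
  · rcases Nat.lt_succ_iff_lt_or_eq.mp hx with hx | rfl
    · obtain ⟨k, hk, hk'⟩ := h3 x hx
      refine ⟨k, by rw [hist_one_succ]; omega, ?_⟩
      rw [h13, Function.update_apply, if_neg, hk']
      intro heq
      have := hle (p.code P x)
      obtain ⟨e1, e2⟩ := mul_add_inj (by omega) (by omega) heq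
      rw [e1] at hk
      omega
    · refine ⟨hist p.a p.L p.r P x 1 (p.code P x), by rw [hist_one_succ]; simp, ?_⟩
      rw [h13]; simp

theorem runs_bucketProg {M : ℕ} (hp : p.Ok M) {P : ℕ → ℕ} {s : State} (hs : p.Env s)
    (hP : p.Moduli P s) :
    Runs p.w bucketProg s (p.D * 20 + p.N * (p.r * 40 + 60) + 20) (p.Buckets P p.N) := by
  obtain ⟨hL1, hLM, hM2, hM3, hw⟩ := hp.bounds
  obtain ⟨B, hB⟩ : ∃ B, B = 2 ^ p.w := ⟨_, rfl⟩
  rw [← hB] at hw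
  have hD := hp.hD
  have hN := hp.hN
  refine Runs.seq_le (T₁ := p.D * (4 + 8) + 6) (Q₁ := fun s' => ∀ c < p.D, s'.mem 10 c = 0)
    (Runs.forTo_le p.D 4 (fun j s' => ∀ c < j, s'.mem 10 c = 0) le_rfl hs.r3 (by omega) rfl rfl rfl
      rfl rfl (by simp) ?_ (fun s' h _ _ => h)) (by omega) ?_
  · intro j hj s' h1 h2 hF
    refine Runs.sto_le rfl rfl (by simp) (by simp [h2, ← hB]; omega) (by simp) ?_
    intro c hc
    simp only [State.setReg_mem, State.setMem_mem, if_pos, Ex.eval, h2, Function.update_apply]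
    split_ifs with h
    · rfl
    · exact h1 c (by omega)
  intro s₁ h10 hF₁
  have hs₁ := hs.frame hF₁ rfl rfl
  have hP₁ := hP.of_eq (hF₁.mem 3 rfl)
  refine Runs.seq_asg rfl (by simp; omega) (by simp) ?_
  refine Runs.forTo_le p.N (p.r * 40 + 50) (fun j s' => p.Buckets P j s' ∧ s'.reg 21 = 0) (by
    simp only [Ex.cost, show p.N * (p.r * 40 + 60) = p.N * (p.r * 40 + 50 + 8) + p.N * 2 by ring]
    omega) (by simpa using hs₁.r0) (by omega) rfl rfl rfl rfl rfl ⟨⟨?_, ?_, ?_⟩, by simp⟩ ?_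
    (fun s' h _ _ => h.1)
  · intro c hc; simp [h10 c hc, hist]
  · simp [hist]
  · simp
  rintro j hj s' ⟨hbuck, h21⟩ h26 hF
  have hs' : p.Env s' := (hs₁.setReg _ (by norm_num)).frame hF rfl rfl
  have hP' : p.Moduli P s' := hP₁.of_eq (hF.mem 3 rfl)
  have haj := hp.ha j hj
  refine Runs.seq_asg rfl (by simp) (by simp [h26, ← hB, hs'.inp j hj]; omega) ?_
  simp only [Ex.eval, BinOp.eval, h26, hs'.inp j hj, Ex.cost]
  refine Runs.seq_le (runs_codeProg hp (hs'.setReg _ (by norm_num))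
    (hP'.of_eq (by simp)) (by simpa using haj) (by simp [h21])) (by omega) ?_
  intro s₂ h22 hF₂
  have hs₂ : p.Env s₂ := (hs'.setReg _ (by norm_num)).frame hF₂ rfl rfl
  replace h22 : s₂.reg 22 = p.code P j := by rw [h22]; simp [h21, code]
  have e20 : s₂.reg 20 = p.a j := (hF₂.reg 20 rfl).trans (by simp)
  have e21 : s₂.reg 21 = 0 := (hF₂.reg 21 rfl).trans (by simp [h21])
  have e10 : s₂.mem 10 = s'.mem 10 := hF₂.mem 10 rfl
  have e13 : s₂.mem 13 = s'.mem 13 := hF₂.mem 13 rfl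
  have hc := code_lt hP' j
  have hcN : p.code P j * p.N ≤ M * M := Nat.mul_le_mul (by omega) hN
  have hh := hbuck.1 _ hc
  have hle : hist p.a p.L p.r P j 1 (p.code P j) ≤ j := by
    simpa using hist_le p.a p.L p.r P j 1 (p.code P j)
  refine Runs.seq_sto rfl rfl (by simp)
    (by simp [← hB, h22, hs₂.r0, e10, hh]; omega) (by simp [← hB, e20]; omega) ?_
  refine Runs.sto_le rfl rfl (by simp) (by simp [← hB, h22]; omega)
    (by simp [← hB, h22, e10, hh]; omega) ⟨hbuck.step hj ?_ ?_, by simp [e21]⟩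
  · simp [h22, e10, hh, e13, hs₂.r0, e20]
  · simp [h22, e10, hh]

/-- The distribution of the codes with all carry patterns in array `11`. -/
def histProg : Prog :=
  forTo 25 3 (sto 11 (.r 25) (.c 0)) ;;
  forTo 26 0
    (asg 20 (.ld 0 (.b .add (.r 26) (.c 1))) ;;
    forTo 21 6 (codeProg ;; sto 11 (.r 22) (.b .add (.ld 11 (.r 22)) (.c 1))))

theorem runs_histProg {M : ℕ} (hp : p.Ok M) {P : ℕ → ℕ} {s : State} (hs : p.Env s)
    (hP : p.Moduli P s) :
    Runs p.w histProg s (p.D * 20 + p.N * (p.E * (p.r * 40 + 50) + 30) + 20)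
      (fun s' => ∀ c < p.D, s'.mem 11 c = hist p.a p.L p.r P p.N p.E c) := by
  obtain ⟨hL1, hLM, hM2, hM3, hw⟩ := hp.bounds
  obtain ⟨B, hB⟩ : ∃ B, B = 2 ^ p.w := ⟨_, rfl⟩
  rw [← hB] at hw
  have hD := hp.hD
  have hN := hp.hN
  have hE := hp.hE
  refine Runs.seq_le (T₁ := p.D * (4 + 8) + 6) (Q₁ := fun s' => ∀ c < p.D, s'.mem 11 c = 0)
    (Runs.forTo_le p.D 4 (fun j s' => ∀ c < j, s'.mem 11 c = 0) le_rfl hs.r3 (by omega) rfl rfl rfl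
      rfl rfl (by simp) ?_ (fun s' h _ _ => h)) (by omega) ?_
  · intro j hj s' h1 h2 hF
    refine Runs.sto_le rfl rfl (by simp) (by simp [h2, ← hB]; omega) (by simp) ?_
    intro c hc
    simp only [State.setReg_mem, State.setMem_mem, if_pos, Ex.eval, h2, Function.update_apply]
    split_ifs with h
    · rfl
    · exact h1 c (by omega)
  intro s₁ h10 hF₁
  have hs₁ := hs.frame hF₁ rfl rfl
  have hP₁ := hP.of_eq (hF₁.mem 3 rfl)
  refine Runs.forTo_le p.N (p.E * (p.r * 40 + 50) + 20)
    (fun j s' => ∀ c < p.D, s'.mem 11 c = hist p.a p.L p.r P j p.E c) (by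
    simp only [show p.N * (p.E * (p.r * 40 + 50) + 30) =
      p.N * (p.E * (p.r * 40 + 50) + 20 + 8) + p.N * 2 by ring]
    omega) hs₁.r0 (by omega) rfl rfl rfl rfl rfl ?_ ?_ (fun s' h _ _ => h)
  · intro c hc; simp [h10 c hc, hist]
  intro j hj s' h11 h26 hF
  have hs' : p.Env s' := hs₁.frame hF rfl rfl
  have hP' : p.Moduli P s' := hP₁.of_eq (hF.mem 3 rfl)
  have haj := hp.ha j hj
  refine Runs.seq_asg rfl (by simp) (by simp [h26, ← hB, hs'.inp j hj]; omega) ?_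
  simp only [Ex.eval, BinOp.eval, h26, hs'.inp j hj, Ex.cost]
  refine Runs.forTo_le p.E (p.r * 40 + 40)
    (fun e s' => ∀ c < p.D, s'.mem 11 c = hist p.a p.L p.r P j p.E c +
      ∑ e' ∈ Finset.range e, if pack p.L (dig P (p.a j) e') p.r = c then 1 else 0) (by
    simp only [show p.E * (p.r * 40 + 50) = p.E * (p.r * 40 + 40 + 8) + p.E * 2 by ring]
    omega) (by simpa using hs'.r6) (by omega) rfl rfl rfl rfl rfl (by simpa using h11) ?_ ?_
  · intro e he s₂ h₂ h21 hF₂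
    have hs₂ : p.Env s₂ := (hs'.setReg _ (by norm_num)).frame hF₂ rfl rfl
    have hP₂ : p.Moduli P s₂ := hP'.of_eq (by rw [hF₂.mem 3 rfl]; simp)
    have e20 : s₂.reg 20 = p.a j := (hF₂.reg 20 rfl).trans (by simp)
    refine Runs.seq_le (runs_codeProg hp hs₂ hP₂ (by omega) (by omega)) (by omega) ?_
    intro s₃ h22 hF₃
    rw [e20, h21] at h22
    have e11 : s₃.mem 11 = s₂.mem 11 := hF₃.mem 11 rfl
    have hc : pack p.L (dig P (p.a j) e) p.r < p.D :=
      pack_lt fun i hi => dig_lt (hP'.digits i hi).1 (hP'.digits i hi).2 _ _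
    have hh := h₂ _ hc
    have hle : hist p.a p.L p.r P j p.E (pack p.L (dig P (p.a j) e) p.r) ≤ M * M :=
      (hist_le _ _ _ _ _ _ _).trans (Nat.mul_le_mul (by omega) (by omega))
    have hle' : (∑ e' ∈ Finset.range e, if pack p.L (dig P (p.a j) e') p.r =
        pack p.L (dig P (p.a j) e) p.r then 1 else 0) ≤ e := by
      rw [Finset.sum_boole]
      exact (Finset.card_filter_le _ _).trans (by simp)
    refine Runs.sto_le rfl rfl (by simp) (by simp [← hB, h22]; omega)
      (by simp only [Ex.Safe, Ex.eval, BinOp.eval, ← hB, h22, e11, hh]; omega) ?_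
    intro c hcD
    simp only [State.setReg_mem, State.setMem_mem, if_pos, Ex.eval, BinOp.eval, h22, e11,
      Function.update_apply, Finset.sum_range_succ]
    by_cases hcc : c = pack p.L (dig P (p.a j) e) p.r
    · rw [if_pos hcc, hh, if_pos hcc.symm, hcc, add_assoc]
    · rw [if_neg hcc, if_neg (Ne.symm hcc), add_zero, h₂ c hcD]
  · intro s₂ h₂ h21 hF₂ c hc
    simp only [State.setReg_mem, h₂ c hc, hist, Finset.sum_range_succ]

/-! ### The transformation and the exact count -/

/-- `r` rounds of the transformation of the array `b` by the matrix in the array `t`. -/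
def transProg (b t : ℕ) : Prog :=
  forTo 27 7
    (forTo 28 3
      (asg 29 (.b .mul (.b .mod (.r 28) (.r 4)) (.r 2)) ;;
      asg 30 (.b .mul (.b .div (.r 28) (.r 4)) (.r 2)) ;;
      asg 31 (.c 0) ;;
      forTo 32 2
        (asg 31 (.b .mod (.b .add (.r 31) (.b .mul (.ld t (.b .add (.r 30) (.r 32)))
          (.ld b (.b .add (.r 29) (.r 32))))) (.r 5))) ;;
      sto 12 (.r 28) (.r 31)) ;;
    forTo 28 3 (sto b (.r 28) (.ld 12 (.r 28))))

/-- Entries are only assumed to be at most `M * M`, not below `Q`: the first round starts from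
histograms that have not been reduced. The output is collected in array `12`, as every input entry
is read `L` times. -/
theorem runs_round {M : ℕ} (hp : p.Ok M) (b t : ℕ) (T : ℕ → ℕ → ZMod p.Q) {s : State}
    (hs : p.Env s) (hb : b = 10 ∨ b = 11)
    (hT : ∀ l < p.L, ∀ i < p.L, s.mem t (l * p.L + i) < p.Q ∧
      (s.mem t (l * p.L + i) : ZMod p.Q) = T l i) (ht : t < 3) (f : ℕ → ZMod p.Q)
    (hf : ∀ x < p.D, s.mem b x ≤ M * M ∧ (s.mem b x : ZMod p.Q) = f x) :
    Runs p.w (forTo 28 3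
      (asg 29 (.b .mul (.b .mod (.r 28) (.r 4)) (.r 2)) ;;
      asg 30 (.b .mul (.b .div (.r 28) (.r 4)) (.r 2)) ;;
      asg 31 (.c 0) ;;
      forTo 32 2
        (asg 31 (.b .mod (.b .add (.r 31) (.b .mul (.ld t (.b .add (.r 30) (.r 32)))
          (.ld b (.b .add (.r 29) (.r 32))))) (.r 5))) ;;
      sto 12 (.r 28) (.r 31)) ;;
    forTo 28 3 (sto b (.r 28) (.ld 12 (.r 28)))) s (p.D * (p.L * 30 + 70) + 20)
      (fun s' => ∀ x < p.D, s'.mem b x ≤ M * M ∧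
        (s'.mem b x : ZMod p.Q) = tensorRound T p.L p.D' f x) := by
  obtain ⟨hL1, hLM, hM2, hM3, hw⟩ := hp.bounds
  obtain ⟨B, hB⟩ : ∃ B, B = 2 ^ p.w := ⟨_, rfl⟩
  rw [← hB] at hw
  have hD := hp.hD
  have hQ := hp.hQ
  have hQ0 : 0 < p.Q := pow_pos hp.prime.pos _
  have hDD := D_eq hp.one_le_r
  have hD'0 : 0 < p.D' := by rw [D']; positivity
  have hb12 : b ≠ 12 := by omega
  have ht12 : t ≠ 12 := by omega
  refine Runs.seq_le (T₁ := p.D * (p.L * 30 + 40 + 8) + 6)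
    (Q₁ := fun s' => ∀ x < p.D, s'.mem 12 x ≤ M * M ∧
      (s'.mem 12 x : ZMod p.Q) = tensorRound T p.L p.D' f x)
    (Runs.forTo_le p.D (p.L * 30 + 40) (fun j s' => (∀ a, a ≠ 12 → s'.mem a = s.mem a) ∧
      ∀ x < j, s'.mem 12 x ≤ M * M ∧
      (s'.mem 12 x : ZMod p.Q) = tensorRound T p.L p.D' f x) le_rfl hs.r3 (by omega) rfl rfl rfl
      rfl rfl (by simp) ?_ (fun s' h _ _ => h.2)) ?_ ?_
  · rintro x hx s₁ ⟨hmem, h12⟩ h28 hF₁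
    have e2 : s₁.reg 2 = p.L := (hF₁.reg 2 rfl).trans hs.r2
    have e4 : s₁.reg 4 = p.D' := (hF₁.reg 4 rfl).trans hs.r4
    have e5 : s₁.reg 5 = p.Q := (hF₁.reg 5 rfl).trans hs.r5
    have hmod := Nat.mod_lt x hD'0
    have hdiv : x / p.D' < p.L := by rwa [Nat.div_lt_iff_lt_mul hD'0, ← hDD]
    have hm1 : (x % p.D' + 1) * p.L ≤ p.D := by
      rw [hDD, mul_comm]; exact Nat.mul_le_mul_left _ hmod
    have hm2 : (x / p.D' + 1) * p.L ≤ M * M := Nat.mul_le_mul (by omega) hLM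
    rw [add_mul, one_mul] at hm1 hm2
    have hD'D : p.D' ≤ p.D := by rw [hDD]; exact Nat.le_mul_of_pos_left _ hL1
    refine Runs.seq_asg rfl (by simp) (by simp [← hB, h28, e4, e2]; omega) ?_
    refine Runs.seq_asg rfl (by simp) (by simp [← hB, h28, e4, e2]; omega) ?_
    refine Runs.seq_asg rfl (by simp) (by simp) ?_
    simp only [Ex.eval, BinOp.eval, h28, e4, e2, State.setReg_reg, Nat.reduceEqDiff, if_false,
      Ex.cost]
    refine Runs.seq_le (T₁ := p.L * (14 + 8) + 6)
      (Q₁ := fun s' => s'.reg 31 < p.Q ∧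
        (s'.reg 31 : ZMod p.Q) = tensorRound T p.L p.D' f x)
      (Runs.forTo_le p.L 14 (fun k s' => s'.reg 31 < p.Q ∧ (s'.reg 31 : ZMod p.Q) =
        ∑ a ∈ Finset.range k, T (x / p.D') a * f (x % p.D' * p.L + a)) le_rfl (by simpa using e2)
        (by omega) rfl rfl rfl rfl rfl (by simpa using hQ0) ?_ (fun s' h _ _ => h)) (by omega) ?_
    · rintro k hk s₂ ⟨hlt, hval⟩ h32 hF₂
      have g5 : s₂.reg 5 = p.Q := (hF₂.reg 5 rfl).trans (by simpa using e5)
      have g29 : s₂.reg 29 = x % p.D' * p.L := (hF₂.reg 29 rfl).trans (by simp)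
      have g30 : s₂.reg 30 = x / p.D' * p.L := (hF₂.reg 30 rfl).trans (by simp)
      have gt : s₂.mem t = s.mem t := (hF₂.mem t rfl).trans (by simp [hmem t ht12])
      have gb : s₂.mem b = s.mem b := (hF₂.mem b rfl).trans (by simp [hmem b hb12])
      obtain ⟨t1, t2⟩ := hT _ hdiv k hk
      obtain ⟨f1, f2⟩ := hf (x % p.D' * p.L + k) (by omega)
      have hprod : s.mem t (x / p.D' * p.L + k) * s.mem b (x % p.D' * p.L + k) ≤ M * (M * M) :=
        Nat.mul_le_mul (by omega) f1
      rw [← mul_assoc] at hprod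
      refine Runs.asg_le rfl (by simp) ?_ ?_
      · have := Nat.mod_lt (s₂.reg 31 + s.mem t (x / p.D' * p.L + k) * s.mem b (x % p.D' * p.L + k))
          hQ0
        simp [← hB, h32, g5, g29, g30, gt, gb]
        and_intros <;> omega
      · refine ⟨?_, ?_⟩
        · simpa [g5] using Nat.mod_lt _ hQ0
        · simp [g5, h32, g29, g30, gt, gb, t2, f2, hval, Finset.sum_range_succ]
    · rintro s₂ ⟨hlt, hval⟩ hF₂
      have g28 : s₂.reg 28 = x := (hF₂.reg 28 rfl).trans (by simp [h28])
      have gm : s₂.mem = s₁.mem := by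
        ext a; rw [hF₂.mem a rfl]; simp
      refine Runs.sto_le rfl rfl (by simp; omega) (by simp [← hB, g28]; omega)
        (by simp [← hB]; omega) ⟨fun a ha => ?_, fun y hy => ?_⟩
      · simp [ha, gm, hmem]
      · simp only [State.setReg_mem, State.setMem_mem, if_pos, Ex.eval, g28, Function.update_apply]
        split_ifs with hyx
        · rw [hyx]; exact ⟨by omega, hval⟩
        · rw [gm]; exact h12 y (by omega)
  · have e : p.D * (p.L * 30 + 70) = p.D * (p.L * 30 + 40 + 8) + p.D * 22 := by ring
    omega
  intro s₁ h12 hF₁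
  have e3 : s₁.reg 3 = p.D := (hF₁.reg 3 rfl).trans hs.r3
  refine Runs.forTo_le p.D 5 (fun j s' => s'.mem 12 = s₁.mem 12 ∧
    ∀ x < j, s'.mem b x = s₁.mem 12 x) ?_ e3 (by omega) rfl rfl rfl rfl rfl (by simp) ?_ ?_
  · have e : p.D * (p.L * 30 + 70) = p.D * (p.L * 30 + 40 + 8) + p.D * 22 := by ring
    omega
  · rintro x hx s₂ ⟨h1, h2⟩ h28 hF₂
    have := (h12 x hx).1
    refine Runs.sto_le rfl rfl (by simp) (by simp [← hB, h28]; omega)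
      (by simp [← hB, h28, h1]; omega) ⟨?_, fun y hy => ?_⟩
    · simp [hb12.symm, h1]
    · simp only [State.setReg_mem, State.setMem_mem, if_pos, Ex.eval, h28, Function.update_apply, h1]
      split_ifs with hyx
      · rw [hyx]
      · exact h2 y (by omega)
  · rintro s₂ ⟨h1, h2⟩ - - x hx
    rw [h2 x hx]; exact h12 x hx

theorem runs_transProg {M : ℕ} (hp : p.Ok M) (b t : ℕ) (T : ℕ → ℕ → ZMod p.Q) {s : State}
    (hs : p.Env s) (hb : b = 10 ∨ b = 11)
    (hT : ∀ s, p.Env s → ∀ l < p.L, ∀ i < p.L, s.mem t (l * p.L + i) < p.Q ∧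
      (s.mem t (l * p.L + i) : ZMod p.Q) = T l i) (ht : t < 3) (f : ℕ → ZMod p.Q)
    (hf : ∀ x < p.D, s.mem b x ≤ M * M ∧ (s.mem b x : ZMod p.Q) = f x) :
    Runs p.w (transProg b t) s (p.r * (p.D * (p.L * 30 + 70) + 20 + 8) + 10)
      (fun s' => ∀ x < p.D, s'.mem b x ≤ M * M ∧ (s'.mem b x : ZMod p.Q) =
        ∑ c ∈ Finset.range p.D, kron T p.L p.r x c * f c) := by
  obtain ⟨hL1, hLM, hM2, hM3, hw⟩ := hp.bounds
  have hr := hp.hr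
  refine Runs.forTo_le p.r (p.D * (p.L * 30 + 70) + 20)
    (fun j s' => ∀ x < p.D, s'.mem b x ≤ M * M ∧
      (s'.mem b x : ZMod p.Q) = (tensorRound T p.L p.D')^[j] f x) (by omega) hs.r7 (by omega) rfl rfl
      rfl rfl rfl (by simpa using hf) ?_ ?_
  · intro j hj s₁ h1 h27 hF₁
    have hs₁ : p.Env s₁ := by
      rcases hb with rfl | rfl <;> exact hs.frame hF₁ rfl rfl
    refine (runs_round hp b t T hs₁ hb (hT s₁ hs₁) ht _ h1).mono le_rfl ?_
    intro s₂ h2 x hx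
    rw [Function.iterate_succ_apply']
    exact h2 x hx
  · rintro s₁ h1 - - x hx
    refine ⟨(h1 x hx).1, (h1 x hx).2.trans ?_⟩
    exact iterate_tensorRound T p.L p.r f x hx

/-- The number of pseudo-solutions is left in register `33`. -/
def countProg : Prog :=
  bucketProg ;; histProg ;; transProg 10 1 ;; transProg 11 2 ;; asg 33 (.c 0) ;;
  forTo 28 3 (asg 33 (.b .mod (.b .add (.r 33) (.b .mul (.b .mod
    (.b .mul (.ld 10 (.r 28)) (.ld 10 (.r 28))) (.r 5)) (.ld 11 (.r 28)))) (.r 5)))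

theorem sum_V_W {M : ℕ} (hp : p.Ok M) (a b c : ℕ) (hab : a + b < p.L) (hc : c < p.L) :
    ∑ l ∈ Finset.range p.L, p.V l a * p.V l b * p.W l c = if a + b = c then 1 else 0 := by
  have : Fact p.q.Prime := ⟨hp.prime⟩
  exact sum_teichmuller_trilinear p.q p.m a b c hab hc p.τ (fun _ => rfl) p.u
    (inv_mul_pred p.q (p.m + 1) hp.prime.two_le)

/-- A bound for the running time of `countProg`. -/
def countTime (p : Par) : ℕ :=
  p.D * (p.r * (p.L * 60 + 200) + 80) + p.N * (p.E * (p.r * 80 + 60) + 100) + p.r * 60 + 100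

theorem runs_countProg {M : ℕ} (hp : p.Ok M) {P : ℕ → ℕ} {s : State} (hs : p.Env s)
    (hP : p.Moduli P s) :
    Runs p.w countProg s p.countTime (fun s' => s'.reg 33 = pseudoCount p.a p.N p.r P) := by
  obtain ⟨hL1, hLM, hM2, hM3, hw⟩ := hp.bounds
  obtain ⟨B, hB⟩ : ∃ B, B = 2 ^ p.w := ⟨_, rfl⟩
  rw [← hB] at hw
  have hD := hp.hD
  have hN := hp.hN
  have hE := hp.hE
  have hQ := hp.hQ
  have hQ0 : 0 < p.Q := pow_pos hp.prime.pos _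
  obtain ⟨T₁, hT₁⟩ : ∃ T₁, T₁ = p.D * 20 + p.N * (p.r * 40 + 60) + 20 := ⟨_, rfl⟩
  obtain ⟨T₂, hT₂⟩ : ∃ T₂, T₂ = p.D * 20 + p.N * (p.E * (p.r * 40 + 50) + 30) + 20 := ⟨_, rfl⟩
  obtain ⟨T₃, hT₃⟩ : ∃ T₃, T₃ = p.r * (p.D * (p.L * 30 + 70) + 20 + 8) + 10 := ⟨_, rfl⟩
  have hT : T₁ + (T₂ + (T₃ + (T₃ + (p.D * 30 + 20)))) ≤ p.countTime := by
    have hE1 : 1 ≤ p.E := Nat.one_le_two_pow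
    have e1 : p.N * (p.r * 40 * 1) ≤ p.N * (p.r * 40 * p.E) := by gcongr
    rw [hT₁, hT₂, hT₃, countTime]
    nlinarith
  have hb := runs_bucketProg hp hs hP
  rw [← hT₁] at hb
  refine Runs.seq_le hb (by omega) ?_
  intro s₁ h₁ hF₁
  have hs₁ := hs.frame hF₁ rfl rfl
  have hP₁ := hP.of_eq (hF₁.mem 3 rfl)
  have hb := runs_histProg hp hs₁ hP₁
  rw [← hT₂] at hb
  refine Runs.seq_le hb (by omega) ?_
  intro s₂ h₂ hF₂
  have hs₂ := hs₁.frame hF₂ rfl rfl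
  have hle : ∀ n e c, n ≤ M → e ≤ M → hist p.a p.L p.r P n e c ≤ M * M := fun n e c hn he =>
    (hist_le _ _ _ _ _ _ _).trans (Nat.mul_le_mul hn he)
  have hb := runs_transProg hp 10 1 p.V hs₂ (by simp) (fun s hs => hs.tabV) (by norm_num)
    (fun c => (hist p.a p.L p.r P p.N 1 c : ZMod p.Q)) (fun c hc => by
      rw [hF₂.mem 10 rfl, h₁.1 c hc]; exact ⟨hle _ _ _ hN (by omega), rfl⟩)
  rw [← hT₃] at hb
  refine Runs.seq_le hb (by omega) ?_
  intro s₃ h₃ hF₃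
  have hs₃ := hs₂.frame hF₃ rfl rfl
  have hb := runs_transProg hp 11 2 p.W hs₃ (by simp) (fun s hs => hs.tabW) (by norm_num)
    (fun c => (hist p.a p.L p.r P p.N p.E c : ZMod p.Q)) (fun c hc => by
      rw [hF₃.mem 11 rfl, h₂ c hc]; exact ⟨hle _ _ _ hN hE, rfl⟩)
  rw [← hT₃] at hb
  refine Runs.seq_le hb (by omega) ?_
  intro s₄ h₄ hF₄
  have hs₄ := hs₃.frame hF₄ rfl rfl
  have e10 : s₄.mem 10 = s₃.mem 10 := hF₄.mem 10 rfl
  rw [← e10] at h₃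
  set f : ℕ → ZMod p.Q := fun t =>
    (∑ c ∈ Finset.range p.D, kron p.V p.L p.r t c * (hist p.a p.L p.r P p.N 1 c : ZMod p.Q)) with hf
  set g : ℕ → ZMod p.Q := fun t =>
    (∑ c ∈ Finset.range p.D, kron p.W p.L p.r t c * (hist p.a p.L p.r P p.N p.E c : ZMod p.Q))
    with hg
  refine Runs.seq_asg rfl (by simp; omega) (by simp) ?_
  refine Runs.forTo_le p.D 20 (fun j s' => s'.reg 33 < p.Q ∧
    (s'.reg 33 : ZMod p.Q) = ∑ t ∈ Finset.range j, f t * f t * g t) (by simp; omega)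
    (by simpa using hs₄.r3) (by omega) rfl rfl rfl rfl rfl (by simpa using hQ0) ?_ ?_
  · rintro j hj s₅ ⟨hlt, hval⟩ h28 hF₅
    have g5 : s₅.reg 5 = p.Q := (hF₅.reg 5 rfl).trans (by simpa using hs₄.r5)
    have g10 : s₅.mem 10 = s₄.mem 10 := hF₅.mem 10 rfl
    have g11 : s₅.mem 11 = s₄.mem 11 := hF₅.mem 11 rfl
    obtain ⟨f1, f2⟩ := h₃ j hj
    obtain ⟨f3, f4⟩ := h₄ j hj
    -- The square of a transformed entry is the one product for which the word length must allow for
    -- `M ^ 4`.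
    have hff : s₄.mem 10 j * s₄.mem 10 j ≤ M ^ 4 := by
      calc _ ≤ (M * M) * (M * M) := Nat.mul_le_mul f1 f1
        _ = _ := by ring
    have hw4 := hp.hw
    rw [← hB] at hw4
    have hmod := Nat.mod_lt (s₄.mem 10 j * s₄.mem 10 j) hQ0
    have hfg : s₄.mem 10 j * s₄.mem 10 j % p.Q * s₄.mem 11 j ≤ M * (M * M) :=
      Nat.mul_le_mul (by omega) f3
    rw [← mul_assoc] at hfg
    have hmod' := Nat.mod_lt (s₅.reg 33 + s₄.mem 10 j * s₄.mem 10 j % p.Q * s₄.mem 11 j) hQ0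
    refine Runs.asg_le rfl (by simp) ?_ ⟨?_, ?_⟩
    · simp [← hB, h28, g5, g10, g11]
      and_intros <;> omega
    · simpa [g5] using Nat.mod_lt _ hQ0
    · simp [h28, g5, g10, g11, f2, f4, hval, Finset.sum_range_succ, hf, hg]
  · rintro s₅ ⟨hlt, hval⟩ - -
    have h1 := sum_transform_eq_pseudoCount p.V p.W p.L (sum_V_W hp) p.a p.N p.r P hP.digits
    have h2 : (s₅.reg 33 : ZMod p.Q) = (pseudoCount p.a p.N p.r P : ZMod p.Q) := by
      rw [hval, ← h1]; rfl
    -- Both numbers are below `Q`, the count because it is at most `N ^ 3`; the congruence is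
    -- therefore an equality.
    rw [ZMod.natCast_eq_natCast_iff'] at h2
    rwa [Nat.mod_eq_of_lt hlt, Nat.mod_eq_of_lt
      ((pseudoCount_le _ _ _ _).trans_lt hp.hN3)] at h2

/-! ### The greedy search for moduli -/

/-- The moduli are chosen one after the other; each one minimises the number of
pseudo-solutions. The final number is left in register `34`. -/
def greedyProg : Prog :=
  forTo 36 7 (sto 3 (.r 36) (.c 1)) ;;
  forTo 36 7
    (asg 34 (.r 5) ;;
    asg 35 (.c 1) ;;
    forTo 37 8
      (sto 3 (.r 36) (.b .add (.r 37) (.c 1)) ;;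
      countProg ;;
      cond (.b .lt (.r 33) (.r 34)) (asg 34 (.r 33) ;; asg 35 (.b .add (.r 37) (.c 1))) .skip) ;;
    sto 3 (.r 36) (.r 35))

theorem Moduli.update {P : ℕ → ℕ} {s s' : State} (h : p.Moduli P s) {i v : ℕ}
    (hv : 1 ≤ v) (hv' : v ≤ p.H) (hm : s'.mem 3 = Function.update (s.mem 3) i v) :
    p.Moduli (Function.update P i v) s' := by
  intro j hj
  rw [hm, Function.update_apply, Function.update_apply]
  split_ifs with hij
  · exact ⟨rfl, hv, hv'⟩
  · exact h j hj

/-- There are no solutions. -/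
def NoSol (p : Par) : Prop := ∀ x < p.N, ∀ y < p.N, ∀ z < p.N, p.a x + p.a y ≠ p.a z

/-- The number of primes among the candidates. -/
def S (p : Par) : ℕ := ((Finset.Icc 1 p.H).filter Nat.Prime).card

/-- A bound for the running time of `greedyProg`. -/
def greedyTime (p : Par) : ℕ := p.r * (p.H * (p.countTime + 40) + 60) + 20

theorem runs_greedyProg {M : ℕ} (hp : p.Ok M) {s : State} (hs : p.Env s) (k : ℕ)
    (hk : ∀ x < p.N, 2 * p.a x < 2 ^ k) :
    Runs p.w greedyProg s p.greedyTime (fun s' => ∃ P, p.Moduli P s' ∧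
      s'.reg 34 = pseudoCount p.a p.N p.r P ∧
      (p.NoSol → pseudoCount p.a p.N p.r P * p.S ^ p.r ≤ p.N ^ 3 * k ^ p.r)) := by
  obtain ⟨hL1, hLM, hM2, hM3, hw⟩ := hp.bounds
  obtain ⟨B, hB⟩ : ∃ B, B = 2 ^ p.w := ⟨_, rfl⟩
  rw [← hB] at hw
  have hr := hp.hr
  have hr1 := hp.one_le_r
  have hQ := hp.hQ
  have hH : 1 ≤ p.H := by have := hp.five_le; rw [H, L]; omega
  have hHM : p.H ≤ M := by rw [H]; omega
  have hT : p.greedyTime = p.r * (p.H * (p.countTime + 40) + 60) + 20 := rfl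
  refine Runs.seq_le (T₁ := p.r * (4 + 8) + 6) (Q₁ := fun s' => ∀ i < p.r, s'.mem 3 i = 1)
    (Runs.forTo_le p.r 4 (fun j s' => ∀ c < j, s'.mem 3 c = 1) le_rfl hs.r7 (by omega) rfl rfl rfl
      rfl rfl (by simp) ?_ (fun s' h _ _ => h)) ?_ ?_
  · intro j hj s' h1 h2 hF
    refine Runs.sto_le rfl rfl (by simp) (by simp [h2, ← hB]; omega) (by simp [← hB]; omega) ?_
    intro c hc
    simp only [State.setReg_mem, State.setMem_mem, if_pos, Ex.eval, h2, Function.update_apply]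
    split_ifs with h
    · rfl
    · exact h1 c (by omega)
  · have e : p.r * (p.H * (p.countTime + 40) + 60) =
      p.r * (p.H * (p.countTime + 40) + 40 + 8) + p.r * (4 + 8) := by ring
    omega
  intro s₁ h₁ hF₁
  have hs₁ := hs.frame hF₁ rfl rfl
  refine Runs.forTo_le p.r (p.H * (p.countTime + 40) + 40)
    -- Places from `i` on still hold the trivial modulus `1`. Without solutions, each chosen modulus
    -- has gained a factor `k / S` over the initial bound `N ^ 3`.
    (fun i s' => ∃ P, p.Moduli P s' ∧ (∀ j, i ≤ j → P j = 1) ∧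
      (p.NoSol → pseudoCount p.a p.N p.r P * p.S ^ i ≤ p.N ^ 3 * k ^ i) ∧
      (i ≠ 0 → s'.reg 34 = pseudoCount p.a p.N p.r P)) ?_ hs₁.r7 (by omega) rfl rfl rfl rfl rfl
      ⟨fun _ => 1, fun i hi => ⟨h₁ i hi, le_rfl, hH⟩, fun _ _ => rfl,
        fun _ => by simpa using pseudoCount_le _ _ _ _, by simp⟩ ?_ ?_
  · have e : p.r * (p.H * (p.countTime + 40) + 60) =
      p.r * (p.H * (p.countTime + 40) + 40 + 8) + p.r * (4 + 8) := by ring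
    omega
  · rintro i hi s₂ ⟨P, hP, hP1, hPc, -⟩ h36 hF₂
    have hs₂ := hs₁.frame hF₂ rfl rfl
    refine Runs.seq_asg rfl (by simp) (by simp [← hB, hs₂.r5]; omega) ?_
    refine Runs.seq_asg rfl (by simp) (by simp [← hB]; omega) ?_
    simp only [Ex.eval, hs₂.r5, Ex.cost]
    -- Array `3` contains the candidate tried last, not the best one, so the invariant only claims
    -- that some `v` is stored there. The best one is kept in register `35`.
    refine Runs.seq_le (T₁ := p.H * (p.countTime + 30 + 8) + 6)
      (Q₁ := fun s' => ∃ v, 1 ≤ s'.reg 35 ∧ s'.reg 35 ≤ p.H ∧ p.Moduli (Function.update P i v) s' ∧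
        s'.reg 34 = pseudoCount p.a p.N p.r (Function.update P i (s'.reg 35)) ∧
        ∀ c, 1 ≤ c → c ≤ p.H → s'.reg 34 ≤ pseudoCount p.a p.N p.r (Function.update P i c))
      (Runs.forTo_le p.H (p.countTime + 30)
        (fun j s' => ∃ v, 1 ≤ s'.reg 35 ∧ s'.reg 35 ≤ p.H ∧ p.Moduli (Function.update P i v) s' ∧
        -- The initial value `Q` exceeds every possible count, so the first candidate always
        -- replaces it.
        ((j = 0 ∧ s'.reg 34 = p.Q) ∨
          s'.reg 34 = pseudoCount p.a p.N p.r (Function.update P i (s'.reg 35))) ∧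
        ∀ c, 1 ≤ c → c ≤ j → s'.reg 34 ≤ pseudoCount p.a p.N p.r (Function.update P i c))
        le_rfl (by simpa using hs₂.r8) (by omega) rfl rfl rfl rfl rfl ?_ ?_ ?_) ?_ ?_
    · refine ⟨P i, by simp, by simpa using hH, ?_, by simp, ?_⟩
      · rw [Function.update_eq_self]; exact hP.of_eq rfl
      · intro c h1 h2; omega
    · rintro j hj s₃ ⟨v, v1, v2, hPv, hbest, hmin⟩ h37 hF₃
      have hs₃ : p.Env s₃ :=
        ((hs₂.setReg _ (by norm_num)).setReg _ (by norm_num)).frame hF₃ rfl rfl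
      have g36 : s₃.reg 36 = i := (hF₃.reg 36 rfl).trans (by simp [h36])
      refine Runs.seq_sto rfl rfl (by simp) (by simp [← hB, g36]; omega)
        (by simp [← hB, h37]; omega) ?_
      simp only [Ex.eval, BinOp.eval, g36, h37, Ex.cost]
      have hP₃ : p.Moduli (Function.update P i (j + 1)) (s₃.setMem 3 i (j + 1)) := by
        have := hPv.update (s' := s₃.setMem 3 i (j + 1)) (i := i) (v := j + 1) (by omega) (by omega)
          (by simp)
        rwa [Function.update_idem] at this
      refine Runs.seq_le (runs_countProg hp (hs₃.setMem _ _ (by norm_num)) hP₃) (by omega) ?_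
      intro s₄ h33 hF₄
      have hP₄ : p.Moduli (Function.update P i (j + 1)) s₄ := hP₃.of_eq (hF₄.mem 3 rfl)
      have g34 : s₄.reg 34 = s₃.reg 34 := (hF₄.reg 34 rfl).trans (by simp)
      have g35 : s₄.reg 35 = s₃.reg 35 := (hF₄.reg 35 rfl).trans (by simp)
      have g37 : s₄.reg 37 = j := (hF₄.reg 37 rfl).trans (by simp [h37])
      have hc : pseudoCount p.a p.N p.r (Function.update P i (j + 1)) < p.Q :=
        (pseudoCount_le _ _ _ _).trans_lt hp.hN3
      have hb : s₃.reg 34 ≤ p.Q := by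
        rcases hbest with ⟨-, h⟩ | h
        · exact h.le
        · rw [h]; exact ((pseudoCount_le _ _ _ _).trans_lt hp.hN3).le
      have hmin' : ∀ b, b ≤ s₃.reg 34 → b ≤ pseudoCount p.a p.N p.r (Function.update P i (j + 1)) →
          ∀ c, 1 ≤ c → c ≤ j + 1 → b ≤ pseudoCount p.a p.N p.r (Function.update P i c) := by
        intro b b1 b2 c c1 c2
        rcases Nat.lt_succ_iff_lt_or_eq.mp (Nat.lt_succ_of_le c2) with h | rfl
        · exact b1.trans (hmin c c1 (by omega))
        · exact b2
      refine (Runs.cond (T := 6) (T' := 1) rfl ?_ ?_ ?_).mono (by simp) fun _ h => h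
      · simp only [Ex.Safe, Ex.eval, BinOp.eval, h33, g34, ← hB]
        and_intros
        · omega
        · omega
        · split_ifs <;> omega
      · intro hlt
        have hlt : s₄.reg 33 < s₄.reg 34 := by
          by_contra h; simp [h] at hlt
        rw [h33, g34] at hlt
        refine Runs.seq_asg rfl (by simp) (by simp [← hB, h33]; omega) ?_
        refine Runs.asg_le rfl (by simp) (by simp [← hB, g37]; omega) ?_
        refine ⟨j + 1, ?_, ?_, hP₄.of_eq rfl, Or.inr ?_, ?_⟩
        · simp
        · simp [g37]; omega
        · simp [h33, g37]
        · intro c c1 c2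
          simpa [h33] using hmin' _ hlt.le le_rfl c c1 c2
      · intro hge
        have hge : ¬ s₄.reg 33 < s₄.reg 34 := by
          intro h; simp [h] at hge
        rw [h33, g34] at hge
        refine Runs.skip ⟨j + 1, ?_, ?_, hP₄.of_eq rfl, Or.inr ?_, ?_⟩
        · simpa [g35] using v1
        · simpa [g35] using v2
        · rcases hbest with ⟨-, h⟩ | h
          · omega
          · simpa [g34, g35] using h
        · intro c c1 c2
          simpa [g34] using hmin' _ le_rfl (by omega) c c1 c2
    · rintro s₃ ⟨v, v1, v2, hPv, hbest, hmin⟩ - -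
      exact ⟨v, v1, v2, hPv, hbest.resolve_left (by omega), hmin⟩
    · have e : p.H * (p.countTime + 40) = p.H * (p.countTime + 30 + 8) + p.H * 2 := by ring
      omega
    · rintro s₃ ⟨v, v1, v2, hPv, hbest, hmin⟩ hF₃
      have g36 : s₃.reg 36 = i := (hF₃.reg 36 rfl).trans (by simp [h36])
      refine Runs.sto_le rfl rfl ?_ (by simp [← hB, g36]; omega) (by simp [← hB]; omega) ?_
      · have e : p.H * (p.countTime + 40) = p.H * (p.countTime + 30 + 8) + p.H * 2 := by ring
        simp only [Ex.cost]
        omega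
      refine ⟨Function.update P i (s₃.reg 35), ?_, ?_, ?_, ?_⟩
      · have := hPv.update (s' := s₃.setMem 3 i (s₃.reg 35)) (i := i) v1 v2 (by simp)
        rw [Function.update_idem] at this
        simp only [Ex.eval, g36]
        exact this.of_eq rfl
      · intro j hj
        rw [Function.update_of_ne (by omega), hP1 j (by omega)]
      · intro hno
        have h1 := exists_pseudoCount_le p.a p.N p.r i p.H k P hi (hP1 i le_rfl) hk hno _ hmin
        rw [← hbest, pow_succ, pow_succ]
        calc s₃.reg 34 * (p.S ^ i * p.S) = s₃.reg 34 * p.S * p.S ^ i := by ring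
          _ ≤ pseudoCount p.a p.N p.r P * k * p.S ^ i := Nat.mul_le_mul_right _ h1
          _ = pseudoCount p.a p.N p.r P * p.S ^ i * k := by ring
          _ ≤ p.N ^ 3 * k ^ i * k := Nat.mul_le_mul_right _ (hPc hno)
          _ = _ := by ring
      · intro _
        simpa using hbest
  · rintro s₂ ⟨P, hP, -, hPc, h34⟩ - -
    exact ⟨P, hP, h34 (by omega), hPc⟩

/-! ### The prime, the parameters and the tables -/

/-- A power is left in register `21`. -/
def powProg (x y : ℕ) : Prog :=
  asg 21 (.c 1) ;; forTo 22 y (asg 21 (.b .mul (.r 21) (.r x)))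

theorem runs_powProg {w : ℕ} {s : State} (x y v n : ℕ) (hx : s.reg x = v) (hy : s.reg y = n)
    (hxr : (!isTemp x && (forTo 22 y (asg 21 (.b .mul (.r 21) (.r x)))).keepR x) = true)
    (hx21 : Nat.beq 21 x = false)
    (hyt : isTemp y = false) (hy22 : Nat.beq 22 y = false) (hy21 : Nat.beq 21 y = false)
    (hyr : (asg 21 (.b .mul (.r 21) (.r x))).keepR y = true)
    (hv : 1 ≤ v) (hw : v ^ n < 2 ^ w) (hvw : v < 2 ^ w) (hn : n < 2 ^ w) :
    Runs w (powProg x y) s (n * 12 + 8) (fun s' => s'.reg 21 = v ^ n) := by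
  rw [beq_eq_false] at hx21 hy21
  have hxt : isTemp x = false := by simp only [Bool.and_eq_true, Bool.not_eq_true'] at hxr; exact hxr.1
  have h1 : 1 < 2 ^ w := by
    rcases Nat.lt_or_ge 1 v with h | h
    · omega
    · have : v = 1 := by omega
      subst this; exact hvw
  refine Runs.seq_asg rfl (by simp) h1 ?_
  refine Runs.forTo_le n 4 (fun j s' => s'.reg 21 = v ^ j) (by simp)
    (by simp [hy21.symm, hy]) hn rfl hyt hy22 rfl hyr (by simp) ?_ (fun s' h _ _ => h)
  intro j hj s' h21 h22 hF
  have gx : s'.reg x = v := (hF.reg x hxr).trans (by simp [hx21.symm, hx])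
  have e1 : v ^ j ≤ v ^ n := Nat.pow_le_pow_right hv hj.le
  have e2 : v ^ j * v ≤ v ^ n := by rw [← pow_succ]; exact Nat.pow_le_pow_right hv hj
  refine Runs.asg_le (by simp only [Ex.ok, hxt]; rfl) (by simp) ?_ ?_
  · simp only [Ex.Safe, Ex.eval, BinOp.eval, h21, gx]
    omega
  · simp [h21, gx, pow_succ]

/-- The least prime `q ≥ 5` with `N < q ^ b` is left in register `1`. -/
def primeProg : Prog :=
  asg 1 (.c 4) ;; asg 20 (.c 1) ;;
  whl (.r 20)
    (asg 1 (.b .add (.r 1) (.c 1)) ;;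
    powProg 1 10 ;;
    asg 23 (.c 0) ;;
    forTo 22 1 (asg 23 (.b .add (.r 23) (.b .eq (.b .mod (.r 1) (.r 22)) (.c 0)))) ;;
    asg 20 (.b .sub (.c 1) (.b .mul (.b .lt (.r 0) (.r 21)) (.b .eq (.r 23) (.c 1)))))

/-- The term for `j = 0` vanishes because `q % 0 = q`. What is counted are the proper divisors. -/
theorem prime_iff_card_divisors (q : ℕ) (hq : 2 ≤ q) :
    q.Prime ↔ ∑ j ∈ Finset.range q, (if q % j = 0 then 1 else 0) = 1 := by
  have h : (Finset.range q).filter (fun j => q % j = 0) = q.properDivisors := by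
    ext j
    simp only [Finset.mem_filter, Finset.mem_range, Nat.mem_properDivisors, Nat.dvd_iff_mod_eq_zero]
    tauto
  rw [Finset.sum_boole, Nat.cast_id, h, Finset.card_eq_one,
    ← Nat.properDivisors_eq_singleton_one_iff_prime]
  refine ⟨fun h => ⟨1, h⟩, ?_⟩
  rintro ⟨x, hx⟩
  have h1 : 1 ∈ q.properDivisors := Nat.mem_properDivisors.mpr ⟨one_dvd _, by omega⟩
  rw [hx, Finset.mem_singleton] at h1
  rw [hx, h1]

theorem runs_primeProg {w N q b M : ℕ} {s : State} (h0 : s.reg 0 = N) (h10 : s.reg 10 = b)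
    (hq : q.Prime) (hq5 : 5 ≤ q) (hqb : N < q ^ b)
    (hmin : ∀ q', 5 ≤ q' → q' < q → ¬ (q'.Prime ∧ N < q' ^ b))
    (hM : 8 ≤ M) (hw : 8 * M ≤ 2 ^ w) (hqM : q ≤ M) (hb : b ≤ M) (hpM : q ^ b ≤ M) :
    Runs w primeProg s (q * (q * 20 + b * 12 + 60) + 20) (fun s' => s'.reg 1 = q) := by
  obtain ⟨B, hB⟩ : ∃ B, B = 2 ^ w := ⟨_, rfl⟩
  rw [← hB] at hw
  refine Runs.seq_asg rfl (by simp) (by simp [← hB]; omega) ?_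
  refine Runs.seq_asg rfl (by simp) (by simp [← hB]; omega) ?_
  simp only [Ex.eval, Ex.cost]
  -- The search starts from `4` and increments first, so it stops after `q - 4` rounds.
  refine (Runs.whl (q - 4) (fun j s' => s'.reg 1 = 4 + j ∧ s'.reg 0 = N ∧ s'.reg 10 = b ∧
    s'.reg 20 = if j = q - 4 then 0 else 1) (fun _ => q * 20 + b * 12 + 55) rfl ?_ ?_ ?_).mono ?_
    fun _ h => h
  · refine ⟨by simp, by simp [h0], by simp [h10], ?_⟩
    rw [if_neg (by omega)]; simp
  · rintro j hj s₁ ⟨h1, h0, h10, h20⟩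
    rw [if_neg (by omega)] at h20
    refine ⟨by simp [h20, ← hB]; omega, by simp [h20], ?_⟩
    have hpow : (4 + j + 1) ^ b ≤ q ^ b := Nat.pow_le_pow_left (by omega) _
    refine Runs.seq_asg rfl (by simp) (by simp [h1, ← hB]; omega) ?_
    simp only [Ex.eval, BinOp.eval, Ex.cost, h1]
    refine Runs.seq_le (runs_powProg 1 10 (4 + j + 1) b (by simp) (by simp [h10]) rfl rfl rfl rfl rfl
      rfl (by omega) (by omega) (by omega) (by omega)) (by omega) ?_
    intro s₂ h21 hF₂
    have g1 : s₂.reg 1 = 4 + j + 1 := (hF₂.reg 1 rfl).trans (by simp)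
    have g0 : s₂.reg 0 = N := (hF₂.reg 0 rfl).trans (by simp [h0])
    have g10 : s₂.reg 10 = b := (hF₂.reg 10 rfl).trans (by simp [h10])
    refine Runs.seq_asg rfl (by simp; omega) (by simp) ?_
    simp only [Ex.eval, Ex.cost]
    refine Runs.seq_le (T₁ := (4 + j + 1) * (8 + 8) + 6) (Q₁ := fun s' => s'.reg 23 =
      ∑ i ∈ Finset.range (4 + j + 1), (if (4 + j + 1) % i = 0 then 1 else 0))
      (Runs.forTo_le (4 + j + 1) 8 (fun k s' => s'.reg 23 =
      ∑ i ∈ Finset.range k, (if (4 + j + 1) % i = 0 then 1 else 0)) le_rfl (by simp [g1])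
      (by omega) rfl rfl rfl rfl rfl (by simp) ?_ (fun s' h _ _ => h)) (by omega) ?_
    · intro k hk s₃ h23 h22 hF₃
      have k1 : s₃.reg 1 = 4 + j + 1 := (hF₃.reg 1 rfl).trans (by simp [g1])
      have hle : ∑ i ∈ Finset.range k, (if (4 + j + 1) % i = 0 then 1 else 0) ≤ k := by
        rw [Finset.sum_boole]
        exact (Finset.card_filter_le _ _).trans (by simp)
      have hmod := Nat.mod_le (4 + j + 1) k
      refine Runs.asg_le rfl (by simp) ?_ ?_
      · simp only [Ex.Safe, Ex.eval, BinOp.eval, h23, h22, k1, ← hB]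
        split_ifs <;> omega
      · simp only [State.setReg_reg, Nat.reduceEqDiff, if_false, if_true, Ex.eval, BinOp.eval, h23,
          h22, k1, Finset.sum_range_succ]
    · intro s₃ h23 hF₃
      have k21 : s₃.reg 21 = (4 + j + 1) ^ b := (hF₃.reg 21 rfl).trans (by simp [h21])
      have k0 : s₃.reg 0 = N := (hF₃.reg 0 rfl).trans (by simp [g0])
      have k1 : s₃.reg 1 = 4 + j + 1 := (hF₃.reg 1 rfl).trans (by simp [g1])
      have k10 : s₃.reg 10 = b := (hF₃.reg 10 rfl).trans (by simp [g10])
      have hle : s₃.reg 23 ≤ 4 + j + 1 := by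
        rw [h23, Finset.sum_boole]
        exact (Finset.card_filter_le _ _).trans (by simp)
      refine Runs.asg_le rfl (by simp; omega) ?_ ?_
      · simp only [Ex.Safe, Ex.eval, BinOp.eval, k21, k0, ← hB]
        by_cases c1 : N < (4 + j + 1) ^ b <;> by_cases c2 : s₃.reg 23 = 1 <;>
          simp only [c1, c2, if_true, if_false] <;> omega
      · refine ⟨by simp [k1]; omega, by simp [k0], by simp [k10], ?_⟩
        have hpr := prime_iff_card_divisors (4 + j + 1) (by omega)
        rw [← h23] at hpr
        simp only [State.setReg_reg, if_true, Ex.eval, BinOp.eval, k21, k0, ← hpr]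
        by_cases hj' : j + 1 = q - 4
        · have e : 4 + j + 1 = q := by omega
          rw [e]
          simp [hj', hq, hqb]
        · have := hmin (4 + j + 1) (by omega) (by omega)
          rw [if_neg hj']
          by_cases h1 : N < (4 + j + 1) ^ b
          · rw [if_neg (show ¬ (4 + j + 1).Prime from fun h => this ⟨h, h1⟩)]; simp
          · simp [h1]
  · rintro s₁ ⟨h1, -, -, h20⟩
    rw [if_pos rfl] at h20
    exact ⟨by simp [h20], by simp [h20], by omega⟩
  · simp only [Finset.sum_const, Finset.card_range, smul_eq_mul, Ex.cost]
    have : (q - 4) * (q * 20 + b * 12 + 55 + (1 + 1)) ≤ q * (q * 20 + b * 12 + 60) :=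
      Nat.mul_le_mul (by omega) (by omega)
    omega

/-- The parameters in the registers `1, …, 8` and `u` in register `9`. -/
def paramProg (r b m : ℕ) : Prog :=
  asg 7 (.c r) ;; asg 10 (.c b) ;; asg 11 (.c m) ;; asg 12 (.c (r - 1)) ;; asg 13 (.c (m + 1)) ;;
  primeProg ;;
  asg 2 (.b .sub (.r 1) (.c 1)) ;;
  powProg 2 7 ;; asg 3 (.r 21) ;;
  powProg 2 12 ;; asg 4 (.r 21) ;;
  powProg 1 13 ;; asg 5 (.r 21) ;;
  asg 6 (.b .shiftl (.c 1) (.r 7)) ;;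
  asg 8 (.b .div (.r 2) (.c 2)) ;;
  asg 9 (.b .sub (.r 5) (.b .div (.b .sub (.r 5) (.c 1)) (.r 2)))

/-- The registers `0, …, 9` and `11` are in place. -/
structure Regs (p : Par) (s : State) : Prop where
  r0 : s.reg 0 = p.N
  r1 : s.reg 1 = p.q
  r2 : s.reg 2 = p.L
  r3 : s.reg 3 = p.D
  r4 : s.reg 4 = p.D'
  r5 : s.reg 5 = p.Q
  r6 : s.reg 6 = p.E
  r7 : s.reg 7 = p.r
  r8 : s.reg 8 = p.H
  r9 : s.reg 9 = p.u
  r11 : s.reg 11 = p.m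

theorem Regs.of_eq {s s' : State} (h : p.Regs s) (hr : ∀ i < 12, s'.reg i = s.reg i) :
    p.Regs s' := by
  obtain ⟨h0, h1, h2, h3, h4, h5, h6, h7, h8, h9, h10⟩ := h
  constructor <;> simp only [hr, Nat.reduceLT] <;> assumption

theorem Regs.frame {s s' : State} {b : Prog} (h : p.Regs s) (hF : Frame b s s')
    (hr : b.allR (Nat.ble 20) = true) : p.Regs s' := by
  refine h.of_eq fun i hi => hF.reg i ?_
  rw [Bool.and_eq_true, Bool.not_eq_true', isTemp_eq_false]
  refine ⟨by omega, Prog.allR_mono (fun x hx => ?_) hr⟩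
  rw [Nat.ble_eq] at hx
  rw [Bool.not_eq_true', beq_eq_false]; omega

theorem Regs.setReg {s : State} (h : p.Regs s) {i : ℕ} (v : ℕ) (hi : 20 ≤ i) :
    p.Regs (s.setReg i v) :=
  h.of_eq fun j hj => by rw [State.setReg_reg, if_neg (by omega)]

theorem runs_paramProg {M b : ℕ} (hp : p.Ok M) {s : State} (h0 : s.reg 0 = p.N) (hb : b ≤ p.m + 1)
    (hqb : p.N < p.q ^ b)
    (hmin : ∀ q', 5 ≤ q' → q' < p.q → ¬ (q'.Prime ∧ p.N < q' ^ b)) :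
    Runs p.w (paramProg p.r b p.m) s
      (p.q * (p.q * 20 + b * 12 + 60) + 24 * p.r + 12 * p.m + 120) p.Regs := by
  obtain ⟨hL1, hLM, hM2, hM3, hw⟩ := hp.bounds
  obtain ⟨-, h5, hr1, -, -, hM, -, hq, hr, hm, hD, hQ, hE, -, -⟩ := id hp
  obtain ⟨B, hB⟩ : ∃ B, B = 2 ^ p.w := ⟨_, rfl⟩
  rw [← hB] at hw
  have hqbM : p.q ^ b ≤ M := (Nat.pow_le_pow_right (by omega) hb).trans hQ
  have hD'D : p.D' ≤ M := by
    refine le_trans ?_ hD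
    rw [D_eq hr1]; exact Nat.le_mul_of_pos_left _ hL1
  refine Runs.seq_asg rfl (by simp) (by simp [← hB]; omega) ?_
  refine Runs.seq_asg rfl (by simp) (by simp [← hB]; omega) ?_
  refine Runs.seq_asg rfl (by simp) (by simp [← hB]; omega) ?_
  refine Runs.seq_asg rfl (by simp) (by simp [← hB]; omega) ?_
  refine Runs.seq_asg rfl (by simp) (by simp [← hB]; omega) ?_
  simp only [Ex.eval, Ex.cost]
  refine Runs.seq_le (runs_primeProg (N := p.N) (b := b) (M := M) (by simp [h0]) (by simp)
    hp.prime h5 hqb hmin hM (by omega) hq (by omega) hqbM) (by omega) ?_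
  intro s₁ e1 hF₁
  have e0 : s₁.reg 0 = p.N := (hF₁.reg 0 rfl).trans (by simp [h0])
  have e7 : s₁.reg 7 = p.r := (hF₁.reg 7 rfl).trans (by simp)
  have e11 : s₁.reg 11 = p.m := (hF₁.reg 11 rfl).trans (by simp)
  have e12 : s₁.reg 12 = p.r - 1 := (hF₁.reg 12 rfl).trans (by simp)
  have e13 : s₁.reg 13 = p.m + 1 := (hF₁.reg 13 rfl).trans (by simp)
  refine Runs.seq_asg rfl (by simp; omega) (by simp [← hB, e1]; omega) ?_
  have hL : p.q - 1 = p.L := rfl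
  simp only [Ex.eval, BinOp.eval, Ex.cost, e1, hL]
  refine Runs.seq_le (runs_powProg 2 7 p.L p.r (by simp) (by simp [e7]) rfl rfl rfl rfl rfl rfl hL1
    (by change p.D < _; omega) (by omega) (by omega)) (by omega) ?_
  intro s₂ e21 hF₂
  replace e21 : s₂.reg 21 = p.D := e21
  refine Runs.seq_asg rfl (by simp; omega) (by simp [← hB, e21]; omega) ?_
  simp only [Ex.eval, e21, Ex.cost]
  refine Runs.seq_le (runs_powProg 2 12 p.L (p.r - 1) ((hF₂.reg 2 rfl).trans (by simp))
    ((hF₂.reg 12 rfl).trans (by simp [e12])) rfl rfl rfl rfl rfl rfl hL1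
    (by change p.D' < _; omega) (by omega) (by omega)) (by omega) ?_
  intro s₃ e21 hF₃
  replace e21 : s₃.reg 21 = p.D' := e21
  refine Runs.seq_asg rfl (by simp; omega) (by simp [← hB, e21]; omega) ?_
  simp only [Ex.eval, e21, Ex.cost]
  have f1 : s₃.reg 1 = p.q := by
    rw [hF₃.reg 1 rfl]; simp; rw [hF₂.reg 1 rfl]; simp [e1]
  have f2 : s₃.reg 2 = p.L := by
    rw [hF₃.reg 2 rfl]; simp; rw [hF₂.reg 2 rfl]; simp
  have f3 : s₃.reg 3 = p.D := by
    rw [hF₃.reg 3 rfl]; simp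
  have f0 : s₃.reg 0 = p.N := by
    rw [hF₃.reg 0 rfl]; simp; rw [hF₂.reg 0 rfl]; simp [e0]
  have f7 : s₃.reg 7 = p.r := by
    rw [hF₃.reg 7 rfl]; simp; rw [hF₂.reg 7 rfl]; simp [e7]
  have f11 : s₃.reg 11 = p.m := by
    rw [hF₃.reg 11 rfl]; simp; rw [hF₂.reg 11 rfl]; simp [e11]
  have f13 : s₃.reg 13 = p.m + 1 := by
    rw [hF₃.reg 13 rfl]; simp; rw [hF₂.reg 13 rfl]; simp [e13]
  refine Runs.seq_le (runs_powProg 1 13 p.q (p.m + 1) (by simp [f1])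
    (by simp [f13]) rfl rfl rfl rfl rfl rfl (by omega)
    (by change p.Q < _; omega) (by omega) (by omega)) (by omega) ?_
  intro s₄ e21 hF₄
  replace e21 : s₄.reg 21 = p.Q := e21
  have g1 : s₄.reg 1 = p.q := (hF₄.reg 1 rfl).trans (by simp [f1])
  have g2 : s₄.reg 2 = p.L := (hF₄.reg 2 rfl).trans (by simp [f2])
  have g3 : s₄.reg 3 = p.D := (hF₄.reg 3 rfl).trans (by simp [f3])
  have g4 : s₄.reg 4 = p.D' := (hF₄.reg 4 rfl).trans (by simp)
  have g0 : s₄.reg 0 = p.N := (hF₄.reg 0 rfl).trans (by simp [f0])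
  have g7 : s₄.reg 7 = p.r := (hF₄.reg 7 rfl).trans (by simp [f7])
  have g11 : s₄.reg 11 = p.m := (hF₄.reg 11 rfl).trans (by simp [f11])
  have hE' : 1 <<< p.r = p.E := by rw [Nat.one_shiftLeft]; rfl
  have hdiv := Nat.div_le_self (p.Q - 1) p.L
  refine Runs.seq_asg rfl (by simp; omega) (by simp [← hB, e21]; omega) ?_
  refine Runs.seq_asg rfl (by simp; omega) ?_ ?_
  · simp only [Ex.Safe, Ex.eval, BinOp.eval, State.setReg_reg, Nat.reduceEqDiff, if_false, g7, hE',
      ← hB]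
    omega
  refine Runs.seq_asg rfl (by simp; omega) (by simp [← hB, g2]; omega) ?_
  refine Runs.asg_le rfl (by simp; omega) ?_ ?_
  · simp [← hB, e21, g2]
    generalize (p.Q - 1) / p.L = d at hdiv ⊢
    omega
  constructor <;> simp [g0, g1, g2, g3, g4, g7, g11, e21, hE', H, u, hL]

/-- The tables of the two transformations. -/
def tableProg : Prog :=
  forTo 23 2
    (asg 24 (.b .add (.r 23) (.c 1)) ;;
    forTo 25 11
      (asg 26 (.c 1) ;;
      forTo 27 1 (asg 26 (.b .mod (.b .mul (.r 26) (.r 24)) (.r 5))) ;;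
      asg 24 (.r 26)) ;;
    asg 26 (.c 1) ;;
    forTo 27 2
      (sto 1 (.b .add (.b .mul (.r 23) (.r 2)) (.r 27)) (.r 26) ;;
      asg 26 (.b .mod (.b .mul (.r 26) (.r 24)) (.r 5)) ;;
      sto 2 (.b .add (.b .mul (.r 23) (.r 2)) (.b .sub (.b .sub (.r 2) (.c 1)) (.r 27)))
        (.b .mod (.b .mul (.r 9) (.r 26)) (.r 5))))

/-- A table entry is right. -/
def Entry (p : Par) (T : ℕ → ℕ → ZMod p.Q) (f : ℕ → ℕ) (l i : ℕ) : Prop :=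
  f (l * p.L + i) < p.Q ∧ (f (l * p.L + i) : ZMod p.Q) = T l i

theorem Entry.update {T : ℕ → ℕ → ZMod p.Q} {f : ℕ → ℕ} {l i l' i' v : ℕ} (hi : i < p.L)
    (hi' : i' < p.L) (h : (l = l' ∧ i = i') ∨ p.Entry T f l i) (hv : v < p.Q)
    (hv' : (v : ZMod p.Q) = T l' i') :
    p.Entry T (Function.update f (l' * p.L + i') v) l i := by
  rw [Entry, Function.update_apply]
  split_ifs with heq
  · obtain ⟨rfl, rfl⟩ := mul_add_inj hi hi' heq
    exact ⟨hv, hv'⟩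
  · rcases h with ⟨rfl, rfl⟩ | h
    · exact absurd rfl heq
    · exact h

theorem runs_tableProg {M : ℕ} (hp : p.Ok M) {s : State} (hs : p.Regs s)
    (hin : ∀ x < p.N, s.mem 0 (x + 1) = p.a x) :
    Runs p.w tableProg s (p.L * (p.m * (p.q * 14 + 20) + p.L * 40 + 50) + 10) p.Env := by
  obtain ⟨hL1, hLM, hM2, hM3, hw⟩ := hp.bounds
  obtain ⟨-, h5, hr1, -, -, hM, -, hq, hr, hm, hD, hQ, hE, -, -⟩ := id hp
  obtain ⟨B, hB⟩ : ∃ B, B = 2 ^ p.w := ⟨_, rfl⟩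
  rw [← hB] at hw
  have hqQ : p.q ≤ p.Q := Nat.le_self_pow (by omega) _
  have hLq : p.L < p.q := by rw [L]; omega
  have hu : p.u ≤ M := (Nat.sub_le _ _).trans hQ
  have hQ0 : 0 < p.Q := by omega
  have hmul : ∀ x y, x < p.Q → y ≤ M → x * y ≤ M * M := fun x y hx hy =>
    Nat.mul_le_mul (by omega) hy
  refine Runs.forTo_le p.L (p.m * (p.q * 14 + 20) + p.L * 40 + 40)
    (fun j s' => ∀ l < j, ∀ i < p.L, p.Entry p.V (s'.mem 1) l i ∧ p.Entry p.W (s'.mem 2) l i)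
    ?_ hs.r2 (by omega) rfl rfl rfl rfl rfl (by simp) ?_ ?_
  · have e : p.L * (p.m * (p.q * 14 + 20) + p.L * 40 + 50) =
      p.L * (p.m * (p.q * 14 + 20) + p.L * 40 + 40 + 8) + p.L * 2 := by ring
    omega
  · intro l hl s₁ h₁ h23 hF₁
    have hs₁ := hs.frame hF₁ rfl
    refine Runs.seq_asg rfl (by simp) (by simp [← hB, h23]; omega) ?_
    simp only [Ex.eval, BinOp.eval, h23, Ex.cost]
    refine Runs.seq_le (T₁ := p.m * (p.q * 14 + 12 + 8) + 6)
      (Q₁ := fun s' => s'.reg 24 < p.Q ∧ (s'.reg 24 : ZMod p.Q) = p.τ l)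
      -- Taking a `q`-th power `m` times gives the exponent `q ^ m` of the Teichmüller
      -- representative.
      (Runs.forTo_le p.m (p.q * 14 + 12) (fun k s' => s'.reg 24 < p.Q ∧
        (s'.reg 24 : ZMod p.Q) = ((l + 1 : ℕ) : ZMod p.Q) ^ p.q ^ k) le_rfl
        (by simpa using hs₁.r11) (by omega) rfl rfl rfl rfl rfl ?_ ?_ (fun s' h _ _ => h)) ?_ ?_
    · simp; omega
    · rintro k hk s₂ ⟨hlt, hval⟩ h25 hF₂
      have hs₂ := (hs₁.setReg _ (by norm_num)).frame hF₂ rfl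
      refine Runs.seq_asg rfl (by simp) (by simp [← hB]; omega) ?_
      simp only [Ex.eval, Ex.cost]
      refine Runs.seq_le (T₁ := p.q * (6 + 8) + 6)
        (Q₁ := fun s' => s'.reg 26 < p.Q ∧ (s'.reg 26 : ZMod p.Q) = (s₂.reg 24 : ZMod p.Q) ^ p.q)
        (Runs.forTo_le p.q 6 (fun i s' => s'.reg 26 < p.Q ∧
        (s'.reg 26 : ZMod p.Q) = (s₂.reg 24 : ZMod p.Q) ^ i) le_rfl
        (by simpa using hs₂.r1) (by omega) rfl rfl rfl rfl rfl ?_ ?_ (fun s' h _ _ => h)) (by omega)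
        ?_
      · simp; omega
      · rintro i hi s₃ ⟨hlt3, hval3⟩ h27 hF₃
        have hs₃ := (hs₂.setReg _ (by norm_num)).frame hF₃ rfl
        have g24 : s₃.reg 24 = s₂.reg 24 := (hF₃.reg 24 rfl).trans (by simp)
        have := hmul _ _ hlt3 (show s₂.reg 24 ≤ M by omega)
        have hmod := Nat.mod_lt (s₃.reg 26 * s₂.reg 24) hQ0
        refine Runs.asg_le rfl (by simp) (by simp [← hB, g24, hs₃.r5]; omega) ⟨?_, ?_⟩
        · simpa [g24, hs₃.r5] using hmod
        · simp [g24, hs₃.r5, hval3, pow_succ]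
      · rintro s₃ ⟨hlt3, hval3⟩ hF₃
        refine Runs.asg_le rfl (by simp) (by simp [← hB]; omega) ⟨?_, ?_⟩
        · simpa using hlt3
        · simp only [State.setReg_reg, if_true, Nat.reduceEqDiff, if_false, Ex.eval, hval3, hval,
            pow_succ, pow_mul]
    · have e : p.m * (p.q * 14 + 20) = p.m * (p.q * 14 + 12 + 8) := by ring
      omega
    rintro s₂ ⟨hlt, hval⟩ hF₂
    have hs₂ := (hs₁.setReg _ (by norm_num)).frame hF₂ rfl
    have g23 : s₂.reg 23 = l := (hF₂.reg 23 rfl).trans (by simp [h23])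
    have g1 : s₂.mem 1 = s₁.mem 1 := hF₂.mem 1 rfl
    have g2 : s₂.mem 2 = s₁.mem 2 := hF₂.mem 2 rfl
    have e : p.m * (p.q * 14 + 20) = p.m * (p.q * 14 + 12 + 8) := by ring
    refine Runs.seq_asg rfl (by simp; omega) (by simp [← hB]; omega) ?_
    simp only [Ex.eval, Ex.cost]
    -- Column `s` of the dual matrix contains the power `L - s`. The same running power thus fills
    -- one table from the left and the other from the right.
    refine Runs.forTo_le p.L 30 (fun k s' => s'.reg 26 < p.Q ∧
      (s'.reg 26 : ZMod p.Q) = p.τ l ^ k ∧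
      (∀ l' i, i < p.L → (l' < l ∨ (l' = l ∧ i < k)) → p.Entry p.V (s'.mem 1) l' i) ∧
      (∀ l' i, i < p.L → (l' < l ∨ (l' = l ∧ p.L ≤ i + k)) → p.Entry p.W (s'.mem 2) l' i))
      (by omega) (by simpa using hs₂.r2) (by omega) rfl rfl rfl rfl rfl ?_ ?_ ?_
    · refine ⟨by simp; omega, by simp, fun l' i hi h => ?_, fun l' i hi h => ?_⟩
      · simp only [State.setReg_mem, g1]
        exact (h₁ l' (by omega) i hi).1
      · simp only [State.setReg_mem, g2]
        exact (h₁ l' (by omega) i hi).2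
    · rintro k hk s₃ ⟨hlt3, hval3, hV, hW⟩ h27 hF₃
      have hs₃ := (hs₂.setReg _ (by norm_num)).frame hF₃ rfl
      have k23 : s₃.reg 23 = l := (hF₃.reg 23 rfl).trans (by simp [g23])
      have k24 : s₃.reg 24 = s₂.reg 24 := (hF₃.reg 24 rfl).trans (by simp)
      have m1 := hmul _ _ hlt3 (show s₂.reg 24 ≤ M by omega)
      have m2 : l * p.L ≤ M * M := Nat.mul_le_mul (by omega) hLM
      have hmod := Nat.mod_lt (s₃.reg 26 * s₂.reg 24) hQ0
      obtain ⟨v, hv⟩ : ∃ v, v = s₃.reg 26 * s₂.reg 24 % p.Q := ⟨_, rfl⟩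
      have hvv : (v : ZMod p.Q) = p.τ l ^ (k + 1) := by
        rw [hv, ZMod.natCast_mod, Nat.cast_mul, hval3, hval, pow_succ]
      have hvQ : v < p.Q := hv ▸ hmod
      have m3 : p.u * v ≤ M * M := Nat.mul_le_mul hu (by omega)
      have hmod2 := Nat.mod_lt (p.u * v) hQ0
      refine Runs.seq_sto rfl rfl (by simp) (by simp [← hB, k23, hs₃.r2, h27]; omega)
        (by simp [← hB]; omega) ?_
      refine Runs.seq_asg rfl (by simp) (by simp [← hB, hs₃.r5, k24]; omega) ?_
      simp only [Ex.eval, BinOp.eval, State.setMem_reg, hs₃.r5, k24, Ex.cost, ← hv, k23, hs₃.r2, h27]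
      refine Runs.sto_le rfl rfl (by simp) (by simp [← hB, k23, hs₃.r2, h27]; omega)
        (by simp [← hB, hs₃.r9, hs₃.r5]; omega) ?_
      refine ⟨by simpa using hvQ, by simpa using hvv, fun l' i hi h => ?_, fun l' i hi h => ?_⟩
      · have : ((s₃.setMem 1 (l * p.L + k) (s₃.reg 26)).mem 1) =
            Function.update (s₃.mem 1) (l * p.L + k) (s₃.reg 26) := by simp
        refine Entry.update hi hk ?_ hlt3 hval3
        by_cases hlk : l' = l ∧ i = k
        · exact Or.inl hlk
        · exact Or.inr (hV l' i hi (by omega))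
      · simp only [State.setReg_mem, State.setMem_mem, if_true, Ex.eval, BinOp.eval,
          State.setReg_reg, State.setMem_reg, Nat.reduceEqDiff, if_false, k23, hs₃.r2, h27, hs₃.r9,
          hs₃.r5]
        refine Entry.update hi (by omega) ?_ hmod2 ?_
        · by_cases hlk : l' = l ∧ i = p.L - 1 - k
          · exact Or.inl hlk
          · exact Or.inr (hW l' i hi (by omega))
        · rw [ZMod.natCast_mod, Nat.cast_mul, hvv, W]
          congr 2
          omega
    · rintro s₃ ⟨-, -, hV, hW⟩ - - l' hl' i hi
      simp only [State.setReg_mem]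
      exact ⟨hV l' i hi (by omega), hW l' i hi (by omega)⟩
  · rintro s₁ h₁ - hF₁
    have hs₁ := hs.frame hF₁ rfl
    refine ⟨hs₁.r0, hs₁.r1, hs₁.r2, hs₁.r3, hs₁.r4, hs₁.r5, hs₁.r6, hs₁.r7, hs₁.r8, ?_,
      fun l hl i hi => (h₁ l hl i hi).1, fun l hl i hi => (h₁ l hl i hi).2⟩
    rw [hF₁.mem 0 rfl]
    exact hin

end Par

/-! ### Searching for a solution with the data structure -/

theorem Frame.guest_eq {b : Prog} {s s' : State} (hF : Frame b s s')
    (hr : b.allR (fun x => Nat.ble x 99) = true) (hm : b.allM (fun x => Nat.ble x 49) = true) :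
    s'.guest = s.guest := by
  ext r
  · refine hF.reg _ ?_
    rw [Bool.and_eq_true, Bool.not_eq_true', isTemp_eq_false]
    refine ⟨by omega, Prog.allR_mono (fun x hx => ?_) hr⟩
    rw [Nat.ble_eq] at hx
    rw [Bool.not_eq_true', beq_eq_false]; omega
  · refine congrFun (hF.mem _ (Prog.allM_mono (fun x hx => ?_) hm)) _
    rw [Nat.ble_eq] at hx
    rw [Bool.not_eq_true', beq_eq_false]; omega

theorem Prog.keepR_seq (b c : Prog) (r : ℕ) : (b ;; c).keepR r = (b.keepR r && c.keepR r) := rfl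

theorem Prog.keepR_shift (b : Prog) (r : ℕ) (hr : r < 100) : b.shift.keepR r = true :=
  Prog.allR_shift (fun x hx => by rw [Bool.not_eq_true', beq_eq_false]; omega) b

namespace Par

variable {p : Par}

/-- Register `41` is set if a pair of numbers from the two buckets named by the witness number
`R[27]` has the sum `R[20]`. -/
def pairProg : Prog :=
  asg 42 (.b .sub (.ld 52 (.r 27)) (.c 1)) ;;
  asg 43 (.b .sub (.ld 53 (.r 27)) (.c 1)) ;;
  asg 44 (.ld 10 (.r 42)) ;;
  asg 45 (.ld 10 (.r 43)) ;;
  forTo 28 44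
    (asg 46 (.ld 13 (.b .add (.b .mul (.r 42) (.r 0)) (.r 28))) ;;
    forTo 29 45
      (asg 41 (.b .lor (.r 41) (.b .eq (.b .add (.r 46)
        (.ld 13 (.b .add (.b .mul (.r 43) (.r 0)) (.r 29)))) (.r 20)))))

/-- The number of input numbers with the code `c`. -/
def bucketSize (p : Par) (P : ℕ → ℕ) (c : ℕ) : ℕ := hist p.a p.L p.r P p.N 1 c

theorem bucketSize_le (P : ℕ → ℕ) (c : ℕ) : p.bucketSize P c ≤ p.N := by
  simpa [bucketSize] using hist_le p.a p.L p.r P p.N 1 c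

theorem Buckets.of_eq {P : ℕ → ℕ} {j : ℕ} {s s' : State} (h : p.Buckets P j s)
    (h10 : s'.mem 10 = s.mem 10) (h13 : s'.mem 13 = s.mem 13) : p.Buckets P j s' := by
  unfold Buckets; rw [h10, h13]; exact h

theorem Buckets.le {M : ℕ} (hp : p.Ok M) {P : ℕ → ℕ} {s : State} (h : p.Buckets P p.N s) {c k : ℕ}
    (hc : c < p.D) (hk : k < p.bucketSize P c) : s.mem 13 (c * p.N + k) ≤ M := by
  obtain ⟨x, hx, -, hx'⟩ := h.2.1 c hc k hk
  rw [hx']; exact hp.ha x hx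

theorem runs_pairProg {M : ℕ} (hp : p.Ok M) {P : ℕ → ℕ} {s : State} (hs : p.Env s)
    (hB : p.Buckets P p.N s) {i j t z : ℕ} (h27 : s.reg 27 = t) (hi : s.mem 52 t = i + 1)
    (hj : s.mem 53 t = j + 1) (hiD : i < p.D) (hjD : j < p.D) (h20 : s.reg 20 = z) (hz : z ≤ M)
    (ht : t < 2 ^ p.w) (h41 : s.reg 41 ≤ 1) (hi1 : 1 ≤ p.bucketSize P i) (hj1 : 1 ≤ p.bucketSize P j) :
    Runs p.w pairProg s (100 * (p.bucketSize P i * p.bucketSize P j)) (fun s' => s'.reg 41 ≤ 1 ∧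
      (s'.reg 41 = 1 ↔ s.reg 41 = 1 ∨ ∃ u < p.bucketSize P i, ∃ v < p.bucketSize P j,
        s.mem 13 (i * p.N + u) + s.mem 13 (j * p.N + v) = z)) := by
  obtain ⟨hL1, hLM, hM2, hM3, hw⟩ := hp.bounds
  have hM := hp.hM
  have hD := hp.hD
  have hN := hp.hN
  obtain ⟨B, hBw⟩ : ∃ B, B = 2 ^ p.w := ⟨_, rfl⟩
  rw [← hBw] at hw ht
  have hiN := p.bucketSize_le P i
  have hjN := p.bucketSize_le P j
  have e10i : s.mem 10 i = p.bucketSize P i := hB.1 i hiD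
  have e10j : s.mem 10 j = p.bucketSize P j := hB.1 j hjD
  have hBi : ∀ k < p.bucketSize P i, s.mem 13 (i * p.N + k) ≤ M := fun k hk => hB.le hp hiD hk
  have hBj : ∀ k < p.bucketSize P j, s.mem 13 (j * p.N + k) ≤ M := fun k hk => hB.le hp hjD hk
  have hiM : i * p.N ≤ M * M := Nat.mul_le_mul (by omega) hN
  have hjM : j * p.N ≤ M * M := Nat.mul_le_mul (by omega) hN
  generalize p.bucketSize P i = ci at *
  generalize p.bucketSize P j = cj at *
  -- Both buckets are nonempty, so the overheads are covered by the product of their sizes.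
  have hT : ci * (cj * 22 + 30) + 40 ≤ 100 * (ci * cj) := by nlinarith
  refine Runs.seq_asg rfl (by simp; omega) (by simp [← hBw, h27, hi]; omega) ?_
  refine Runs.seq_asg rfl (by simp; omega) (by simp [← hBw, h27, hj]; omega) ?_
  refine Runs.seq_asg rfl (by simp; omega) (by simp [← hBw, h27, hi, e10i]; omega) ?_
  refine Runs.seq_asg rfl (by simp; omega) (by simp [← hBw, h27, hj, e10j]; omega) ?_
  simp only [Ex.eval, BinOp.eval, State.setReg_reg, State.setReg_mem, Nat.reduceEqDiff, if_false,
    if_true, h27, hi, hj, Nat.add_sub_cancel, e10i, e10j, Ex.cost]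
  refine Runs.forTo_le ci (cj * 22 + 20) (fun k s' => s'.reg 41 ≤ 1 ∧
    (s'.reg 41 = 1 ↔ s.reg 41 = 1 ∨ ∃ u < k, ∃ v < cj,
        s.mem 13 (i * p.N + u) + s.mem 13 (j * p.N + v) = z)) ?_ (by simp) (by omega) rfl rfl rfl rfl
    rfl (by simpa using h41) ?_ (fun s' h _ _ => h)
  · have : ci * (cj * 22 + 30) = ci * (cj * 22 + 20 + 8) + ci * 2 := by ring
    omega
  rintro k hk s₁ ⟨h1, h2⟩ h28 hF₁
  have e42 : s₁.reg 42 = i := (hF₁.reg 42 rfl).trans (by simp)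
  have e43 : s₁.reg 43 = j := (hF₁.reg 43 rfl).trans (by simp)
  have e45 : s₁.reg 45 = cj := (hF₁.reg 45 rfl).trans (by simp)
  have e20 : s₁.reg 20 = z := (hF₁.reg 20 rfl).trans (by simp [h20])
  have e0 : s₁.reg 0 = p.N := (hF₁.reg 0 rfl).trans (by simp [hs.r0])
  have e13 : s₁.mem 13 = s.mem 13 := hF₁.mem 13 rfl
  have hBk := hBi k hk
  refine Runs.seq_asg rfl (by simp) (by simp [← hBw, e42, e0, h28, e13]; omega) ?_
  simp only [Ex.eval, BinOp.eval, e42, e0, h28, e13, Ex.cost]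
  refine Runs.forTo_le cj 14 (fun l s' => s'.reg 41 ≤ 1 ∧
    (s'.reg 41 = 1 ↔ s₁.reg 41 = 1 ∨ ∃ v < l,
        s.mem 13 (i * p.N + k) + s.mem 13 (j * p.N + v) = z)) (by omega) (by simpa using e45)
    (by omega) rfl rfl rfl rfl rfl (by simpa using h1) ?_ ?_
  · rintro l hl s₂ ⟨g1, g2⟩ h29 hF₂
    have f43 : s₂.reg 43 = j := (hF₂.reg 43 rfl).trans (by simp [e43])
    have f46 : s₂.reg 46 = s.mem 13 (i * p.N + k) := (hF₂.reg 46 rfl).trans (by simp)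
    have f20 : s₂.reg 20 = z := (hF₂.reg 20 rfl).trans (by simp [e20])
    have f0 : s₂.reg 0 = p.N := (hF₂.reg 0 rfl).trans (by simp [e0])
    have f13 : s₂.mem 13 = s.mem 13 := (hF₂.mem 13 rfl).trans (by simp [e13])
    have hBl := hBj l hl
    have hex : (∃ v < l + 1, s.mem 13 (i * p.N + k) + s.mem 13 (j * p.N + v) = z) ↔
        (∃ v < l, s.mem 13 (i * p.N + k) + s.mem 13 (j * p.N + v) = z) ∨
        s.mem 13 (i * p.N + k) + s.mem 13 (j * p.N + l) = z := Nat.exists_lt_succ_right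
    have h41' : s₂.reg 41 = 0 ∨ s₂.reg 41 = 1 := by omega
    refine Runs.asg_le rfl (by simp) ?_ ?_
    · simp only [Ex.Safe, Ex.eval, BinOp.eval, f43, f46, f20, f0, f13, h29, ← hBw]
      rcases h41' with h | h <;> rw [h] <;> split_ifs <;> simp <;> omega
    · simp only [Ex.eval, BinOp.eval, State.setReg_reg, Nat.reduceEqDiff, if_false,
        if_true, f43, f46, f20, f0, f13, h29]
      rw [hex, ← or_assoc, ← g2]
      rcases h41' with h | h <;> rw [h] <;> split_ifs with h' <;> simp [h']
  · rintro s₂ ⟨g1, g2⟩ - -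
    refine ⟨by simpa using g1, ?_⟩
    simp only [State.setReg_reg, Nat.reduceEqDiff, if_false]
    rw [Nat.exists_lt_succ_right, ← or_assoc, ← h2, g2]

/-- The bit vector of the codes. -/
def vec (p : Par) (P : ℕ → ℕ) (i : ℕ) : Bool :=
  decide (1 ≤ i ∧ i ≤ p.D ∧ 0 < p.bucketSize P (i - 1))

/-- The code of `z` with the carry pattern `e`. -/
def target (p : Par) (P : ℕ → ℕ) (z e : ℕ) : ℕ := pack p.L (dig P (p.a z) e) p.r

/-- Codes start at `0` but vector indices at `1`, so a sum of two codes is shifted by `2`. The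
length `D + 1` makes `c + 2` an admissible query for every `c < D`. -/
theorem mem_witnesses {P : ℕ → ℕ} {c : ℕ} {i j : ℕ} :
    (i, j) ∈ convWitnesses (p.D + 1) (p.vec P) (p.vec P) (c + 2) ↔
      ∃ i' j', i = i' + 1 ∧ j = j' + 1 ∧ i' + j' = c ∧ i' < p.D ∧ j' < p.D ∧
        1 ≤ p.bucketSize P i' ∧ 1 ≤ p.bucketSize P j' := by
  simp only [convWitnesses, Finset.mem_filter, Finset.mem_product, Finset.mem_Icc, vec,
    decide_eq_true_eq]
  constructor
  · rintro ⟨⟨⟨h1, h2⟩, h3, h4⟩, h5, ⟨-, h6, h7⟩, -, h8, h9⟩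
    exact ⟨i - 1, j - 1, by omega, by omega, by omega, by omega, by omega, h7, h9⟩
  · rintro ⟨i', j', rfl, rfl, h1, h2, h3, h4, h5⟩
    simp only [Nat.add_sub_cancel]
    refine ⟨⟨⟨?_, ?_⟩, ?_, ?_⟩, ?_, ⟨?_, ?_, h4⟩, ?_, ?_, h5⟩ <;> omega

open Finset in
/-- The total work on the witnesses of a query. -/
def work (p : Par) (P : ℕ → ℕ) (c : ℕ) : ℕ :=
  ∑ q ∈ antidiagonal c, p.bucketSize P q.1 * p.bucketSize P q.2

open Finset in
theorem sum_witnesses_le (P : ℕ → ℕ) (c : ℕ) :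
    ∑ q ∈ convWitnesses (p.D + 1) (p.vec P) (p.vec P) (c + 2),
      p.bucketSize P (q.1 - 1) * p.bucketSize P (q.2 - 1) ≤ p.work P c := by
  have hinj : Set.InjOn (fun q : ℕ × ℕ => (q.1 + 1, q.2 + 1)) (antidiagonal c : Set (ℕ × ℕ)) := by
    rintro ⟨x, y⟩ - ⟨x', y'⟩ - h
    simp only [Prod.mk.injEq, Nat.add_right_cancel_iff] at h
    rw [h.1, h.2]
  have hsub : convWitnesses (p.D + 1) (p.vec P) (p.vec P) (c + 2) ⊆
      (antidiagonal c).image (fun q : ℕ × ℕ => (q.1 + 1, q.2 + 1)) := by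
    rintro ⟨i, j⟩ h
    obtain ⟨i', j', rfl, rfl, h1, -⟩ := mem_witnesses.mp h
    exact mem_image.mpr ⟨(i', j'), HasAntidiagonal.mem_antidiagonal.mpr h1, rfl⟩
  refine (sum_le_sum_of_subset hsub).trans ?_
  rw [sum_image hinj]
  rfl

open Finset in
-- Each witness names two nonempty buckets and so stands for at least one pair; the time per witness
-- can be charged to the pairs.
theorem card_witnesses_le (P : ℕ → ℕ) (c : ℕ) :
    (convWitnesses (p.D + 1) (p.vec P) (p.vec P) (c + 2)).card ≤ p.work P c := by
  refine le_trans ?_ (sum_witnesses_le P c)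
  rw [card_eq_sum_ones]
  refine sum_le_sum ?_
  rintro ⟨i, j⟩ h
  obtain ⟨i', j', rfl, rfl, -, -, -, h1, h2⟩ := mem_witnesses.mp h
  exact Nat.mul_le_mul h1 h2

/-- The answer to a query, with all pairs of numbers that belong to it. -/
def queryProg (qry : Prog) : Prog :=
  codeProg ;; asg 100 (.b .add (.r 22) (.c 2)) ;; qry.shift ;; forTo 27 100 pairProg

/-- The data structure answers all queries in time `c` per witness. -/
def Answers (p : Par) (P : ℕ → ℕ) (w' : ℕ) (qry : Prog) (s₀ : State) (c : ℕ) : Prop :=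
  ∀ s, AfterQueries w' qry (p.D + 1) s₀ s → ∀ k ∈ Finset.Icc 1 (p.D + 1), ∃ t s',
    Exec w' qry (s.setReg 0 k) t s' ∧
    ReturnsPairs s' (convWitnesses (p.D + 1) (p.vec P) (p.vec P) k) ∧
    t ≤ c * (1 + (convWitnesses (p.D + 1) (p.vec P) (p.vec P) k).card)

/-- What holds between two queries. -/
structure Ready (p : Par) (P : ℕ → ℕ) (w' : ℕ) (qry : Prog) (s₀ s : State) : Prop where
  env : p.Env s
  moduli : p.Moduli P s
  buckets : p.Buckets P p.N s
  guest : AfterQueries w' qry (p.D + 1) s₀ s.guest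
  r41 : s.reg 41 ≤ 1

/-- A solution for `z` is found with the query for `z` and `e`. -/
def Hit (p : Par) (P : ℕ → ℕ) (z e : ℕ) : Prop :=
  ∃ x < p.N, ∃ y < p.N, p.code P x + p.code P y = p.target P z e ∧ p.a x + p.a y = p.a z

/-- The guest reports pairs of codes, and the host tests every pair of numbers behind them against
`a z` itself. Pseudo-solutions hence cost time but never produce a wrong answer. The state left by
the guest is again one reached by answering queries, so the next query may follow. -/
theorem runs_queryProg {M : ℕ} (hp : p.Ok M) {P : ℕ → ℕ} {w' : ℕ} (hw' : w' ≤ p.w) {qry : Prog}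
    {s₀ : State} {c : ℕ} (hA : p.Answers P w' qry s₀ c) {s : State}
    (hs : p.Ready P w' qry s₀ s) {z e : ℕ} (hz : z < p.N) (he : e < p.E) (h20 : s.reg 20 = p.a z)
    (h21 : s.reg 21 = e) :
    Runs p.w (queryProg qry) s (p.r * 40 + 50 + c + (c + 120) * p.work P (p.target P z e))
      (fun s' => p.Ready P w' qry s₀ s' ∧ s'.reg 20 = p.a z ∧
        (s'.reg 41 = 1 ↔ s.reg 41 = 1 ∨ p.Hit P z e)) := by
  obtain ⟨hL1, hLM, hM2, hM3, hw⟩ := hp.bounds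
  have hM := hp.hM
  have hD := hp.hD
  have hE := hp.hE
  have haz := hp.ha z hz
  obtain ⟨B, hBw⟩ : ∃ B, B = 2 ^ p.w := ⟨_, rfl⟩
  rw [← hBw] at hw
  refine Runs.seq_le (runs_codeProg hp hs.env hs.moduli (by omega) (by omega)) (by omega) ?_
  intro s₁ h22 hF₁
  rw [h20, h21] at h22
  change s₁.reg 22 = p.target P z e at h22
  obtain ⟨k, hk⟩ : ∃ k, k = p.target P z e := ⟨_, rfl⟩
  rw [← hk] at h22 ⊢
  have hkD : k < p.D := hk ▸ pack_lt fun i hi =>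
    dig_lt (hs.moduli.digits i hi).1 (hs.moduli.digits i hi).2 _ _
  have hg₁ : s₁.guest = s.guest := hF₁.guest_eq rfl rfl
  have hs₁ := hs.env.frame hF₁ rfl rfl
  refine Runs.seq_asg rfl (by simp; omega) (by simp [← hBw, h22]; omega) ?_
  simp only [Ex.eval, BinOp.eval, h22, Ex.cost]
  have hkI : k + 2 ∈ Finset.Icc 1 (p.D + 1) := Finset.mem_Icc.mpr (by omega)
  obtain ⟨t, s', hex, hret, ht⟩ := hA _ hs.guest (k + 2) hkI
  have hex' : Exec w' qry (s₁.setReg 100 (k + 2)).guest t s' := by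
    have := guest_setReg s₁ 0 (k + 2)
    rw [hg₁] at this
    rwa [show (100 : ℕ) = 0 + 100 by rfl, this]
  have hcard := card_witnesses_le (p := p) P k
  have ht' : t ≤ c + c * p.work P k := by
    refine ht.trans ?_
    rw [mul_add, mul_one]
    exact Nat.add_le_add_left (Nat.mul_le_mul_left _ hcard) _
  have hcw : (c + 120) * p.work P k = c * p.work P k + 120 * p.work P k := by ring
  refine Runs.seq_le (Runs.shift hw' hex') (by omega) ?_
  rintro s₂ ⟨hg₂, hr₂, hm₂⟩ -
  have hlow : ∀ r < 100, s₂.reg r = s₁.reg r := fun r hr => by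
    rw [hr₂ r hr, State.setReg_reg, if_neg (by omega)]
  have hmem : ∀ a < 50, s₂.mem a = s₁.mem a := fun a ha => by rw [hm₂ a ha]; rfl
  have hs₂ : p.Env s₂ := hs₁.of_eq (fun i hi => hlow i (by omega)) fun a ha => hmem a (by omega)
  have hP₂ : p.Moduli P s₂ := hs.moduli.of_eq ((hmem 3 (by norm_num)).trans (hF₁.mem 3 rfl))
  have hB₂ : p.Buckets P p.N s₂ := hs.buckets.of_eq ((hmem 10 (by norm_num)).trans (hF₁.mem 10 rfl))
    ((hmem 13 (by norm_num)).trans (hF₁.mem 13 rfl))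
  have e20 : s₂.reg 20 = p.a z := by rw [hlow 20 (by norm_num), hF₁.reg 20 rfl, h20]
  have e41 : s₂.reg 41 = s.reg 41 := by rw [hlow 41 (by norm_num), hF₁.reg 41 rfl]
  set W := convWitnesses (p.D + 1) (p.vec P) (p.vec P) (k + 2) with hW
  obtain ⟨hcardW, himg⟩ := hret
  have e100 : s₂.reg 100 = W.card := by
    rw [← hcardW, ← hg₂]; rfl
  have e52 : s₂.mem 52 = s'.mem 2 := by rw [← hg₂]; rfl
  have e53 : s₂.mem 53 = s'.mem 3 := by rw [← hg₂]; rfl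
  rw [hcardW] at himg
  have hpair : ∀ l < W.card, ∃ i j, s₂.mem 52 l = i + 1 ∧ s₂.mem 53 l = j + 1 ∧ i + j = k ∧
      i < p.D ∧ j < p.D ∧ 1 ≤ p.bucketSize P i ∧ 1 ≤ p.bucketSize P j := by
    intro l hl
    rw [e52, e53]
    refine mem_witnesses.mp ?_
    rw [← hW, ← himg]
    exact Finset.mem_image.mpr ⟨l, Finset.mem_range.mpr hl, rfl⟩
  -- A list of `W.card` entries whose set of values is `W` has no repetitions, so summing over the
  -- list is summing over `W`.
  have hinj : Set.InjOn (fun t => (s'.mem 2 t, s'.mem 3 t)) (Finset.range W.card : Set ℕ) := by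
    rw [← Finset.card_image_iff, himg, Finset.card_range]
  have hsum : ∑ l ∈ Finset.range W.card, p.bucketSize P (s₂.mem 52 l - 1) *
      p.bucketSize P (s₂.mem 53 l - 1) ≤ p.work P k := by
    refine le_trans (le_of_eq ?_) (sum_witnesses_le P k)
    rw [← hW]
    conv_rhs => rw [← himg]
    rw [Finset.sum_image hinj, e52, e53]
  have hWD : W.card ≤ M * M + 2 * M + 1 := by
    refine (Finset.card_filter_le _ _).trans ?_
    rw [Finset.card_product, Nat.card_Icc]
    have : (p.D + 1) * (p.D + 1) ≤ (M + 1) * (M + 1) := Nat.mul_le_mul (by omega) (by omega)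
    calc _ ≤ (M + 1) * (M + 1) := this
      _ = _ := by ring
  refine (Runs.forTo W.card (fun l s' => s'.reg 41 ≤ 1 ∧ (s'.reg 41 = 1 ↔ s.reg 41 = 1 ∨
      ∃ l' < l, ∃ u < p.bucketSize P (s₂.mem 52 l' - 1), ∃ v < p.bucketSize P (s₂.mem 53 l' - 1),
        s₂.mem 13 ((s₂.mem 52 l' - 1) * p.N + u) +
          s₂.mem 13 ((s₂.mem 53 l' - 1) * p.N + v) = p.a z))
    (fun l => 100 * (p.bucketSize P (s₂.mem 52 l - 1) * p.bucketSize P (s₂.mem 53 l - 1))) e100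
    (by omega) rfl rfl rfl rfl rfl ⟨by simpa [e41] using hs.r41, by simp [e41]⟩ ?_ ?_).mono ?_
    (fun _ h => h)
  · rintro l hl s₃ ⟨h1, h2⟩ h27 hF₃
    obtain ⟨i, j, hi, hj, hij, hiD, hjD, hi1, hj1⟩ := hpair l hl
    have f13 : s₃.mem 13 = s₂.mem 13 := hF₃.mem 13 rfl
    have hrun := runs_pairProg hp (hs₂.frame hF₃ rfl rfl)
      (hB₂.of_eq (hF₃.mem 10 rfl) (hF₃.mem 13 rfl))
      (t := l) (i := i) (j := j) (z := p.a z) h27 (by rw [hF₃.mem 52 rfl, hi])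
      (by rw [hF₃.mem 53 rfl, hj]) hiD hjD (by rw [hF₃.reg 20 rfl, e20]) haz (by omega) h1 hi1 hj1
    refine hrun.mono (by simp [hi, hj]) ?_
    rintro s₄ ⟨g1, g2⟩
    simp only [State.setReg_reg, Nat.reduceEqDiff, if_false]
    refine ⟨g1, ?_⟩
    rw [g2, h2, Nat.exists_lt_succ_right, ← or_assoc, f13]
    simp only [hi, hj, Nat.add_sub_cancel]
  · rintro s₃ ⟨h1, h2⟩ - hF₃
    have hg₃ : s₃.guest = s' := by
      rw [← hg₂]; exact hF₃.guest_eq rfl rfl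
    refine ⟨⟨hs₂.frame hF₃ rfl rfl, hP₂.of_eq (hF₃.mem 3 rfl),
      hB₂.of_eq (hF₃.mem 10 rfl) (hF₃.mem 13 rfl), ?_, h1⟩, by rw [hF₃.reg 20 rfl, e20], ?_⟩
    · rw [hg₃]; exact hs.guest.query hkI hex
    rw [h2]
    refine or_congr_right ⟨?_, ?_⟩
    · rintro ⟨l, hl, u, hu, v, hv, huv⟩
      obtain ⟨i, j, hi, hj, hij, hiD, hjD, hi1, hj1⟩ := hpair l hl
      simp only [hi, hj, Nat.add_sub_cancel] at hu hv huv
      obtain ⟨x, hx, hxi, hx'⟩ := hB₂.2.1 i hiD u hu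
      obtain ⟨y, hy, hyj, hy'⟩ := hB₂.2.1 j hjD v hv
      exact ⟨x, hx, y, hy, by rw [hxi, hyj, hij, hk], by rw [← hx', ← hy', huv]⟩
    · rintro ⟨x, hx, y, hy, hc, hxy⟩
      obtain ⟨u, hu, hu'⟩ := hB₂.2.2 x hx
      obtain ⟨v, hv, hv'⟩ := hB₂.2.2 y hy
      have hmemW : (p.code P x + 1, p.code P y + 1) ∈ W := mem_witnesses.mpr
        ⟨_, _, rfl, rfl, hc.trans hk.symm, code_lt hP₂ x, code_lt hP₂ y, Nat.one_le_of_lt hu,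
          Nat.one_le_of_lt hv⟩
      rw [← himg, Finset.mem_image] at hmemW
      obtain ⟨l, hl, hl'⟩ := hmemW
      rw [Prod.mk.injEq, ← e52, ← e53] at hl'
      refine ⟨l, Finset.mem_range.mp hl, u, ?_, v, ?_, ?_⟩ <;>
        simp only [hl'.1, hl'.2, Nat.add_sub_cancel]
      exacts [hu, hv, by rw [hu', hv', hxy]]
  · rw [Finset.sum_add_distrib, ← Finset.mul_sum]
    simp
    omega

/-- A hit contains a true solution by definition. Conversely, a solution satisfies every congruence,
so `sum_dig_eq` supplies a carry pattern with which it is found. -/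
theorem exists_hit_iff {P : ℕ → ℕ} (hP : ∀ i < p.r, 1 ≤ P i ∧ 2 * P i ≤ p.L) :
    (∃ z < p.N, ∃ e < p.E, p.Hit P z e) ↔ ¬ p.NoSol := by
  simp only [NoSol, not_forall, not_not]
  constructor
  · rintro ⟨z, hz, e, -, x, hx, y, hy, -, h⟩
    exact ⟨x, hx, y, hy, z, hz, h⟩
  · rintro ⟨x, hx, y, hy, z, hz, h⟩
    have hsum := sum_dig_eq P (p.a x) (p.a y) (p.a z) p.r fun i hi => (hP i hi).1
    rw [if_pos fun i _ => by rw [h]] at hsum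
    obtain ⟨e, he, hne⟩ := Finset.exists_ne_zero_of_sum_ne_zero (hsum.trans_ne one_ne_zero)
    refine ⟨z, hz, e, Finset.mem_range.mp he, x, hx, y, hy, ?_, h⟩
    have hdig : ∀ i < p.r, dig P (p.a x) 0 i + dig P (p.a y) 0 i = dig P (p.a z) e i := by
      by_contra hcon
      exact hne (if_neg hcon)
    rw [code, code, target, pack, pack, pack, ← Finset.sum_add_distrib]
    exact Finset.sum_congr rfl fun i hi => by rw [← hdig i (Finset.mem_range.mp hi), add_mul]

theorem sum_work {P : ℕ → ℕ} (hP : ∀ i < p.r, 1 ≤ P i ∧ 2 * P i ≤ p.L) :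
    ∑ z ∈ Finset.range p.N, ∑ e ∈ Finset.range p.E, p.work P (p.target P z e) =
      pseudoCount p.a p.N p.r P :=
  sum_hist_mul_hist p.a p.L p.N p.r P hP

/-- The bit vectors for the data structure. -/
def fillProg : Prog :=
  asg 100 (.b .add (.r 3) (.c 1)) ;;
  forTo 25 3
    (sto 50 (.b .add (.r 25) (.c 1)) (.b .lt (.c 0) (.ld 10 (.r 25))) ;;
    sto 51 (.b .add (.r 25) (.c 1)) (.b .lt (.c 0) (.ld 10 (.r 25))))

/-- The guest must find precisely its initial configuration, with zeros outside the input. For this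
its whole part of the memory has to be untouched so far. -/
theorem runs_fillProg {M : ℕ} (hp : p.Ok M) {P : ℕ → ℕ} {s : State} (hs : p.Env s)
    (hB : p.Buckets P p.N s) (hg : s.guest = ⟨fun _ => 0, fun _ _ => 0⟩) :
    Runs p.w fillProg s (p.D * 30 + 20) (fun s' =>
      s'.guest = convInput (p.D + 1) (p.vec P) (p.vec P)) := by
  obtain ⟨hL1, hLM, hM2, hM3, hw⟩ := hp.bounds
  have hM := hp.hM
  have hD := hp.hD
  obtain ⟨B, hBw⟩ : ∃ B, B = 2 ^ p.w := ⟨_, rfl⟩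
  rw [← hBw] at hw
  have hgr : ∀ r, s.reg (r + 100) = 0 := fun r => congrFun (congrArg State.reg hg) r
  have hgm : ∀ r, s.mem (r + 50) = fun _ => 0 := fun r => congrFun (congrArg State.mem hg) r
  refine Runs.seq_asg rfl (by simp) (by simp [← hBw, hs.r3]; omega) ?_
  refine Runs.forTo_le p.D 20 (fun j s' =>
    (∀ i, s'.mem 50 i = if 1 ≤ i ∧ i ≤ j ∧ 0 < p.bucketSize P (i - 1) then 1 else 0) ∧
    ∀ i, s'.mem 51 i = if 1 ≤ i ∧ i ≤ j ∧ 0 < p.bucketSize P (i - 1) then 1 else 0)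
    (by simp; omega) (by simpa using hs.r3) (by omega) rfl rfl rfl rfl rfl ⟨?_, ?_⟩ ?_ ?_
  · intro i
    rw [if_neg (by omega)]
    exact congrFun (hgm 0) i
  · intro i
    rw [if_neg (by omega)]
    exact congrFun (hgm 1) i
  · rintro j hj s' ⟨h1, h2⟩ h25 hF
    have e10 : s'.mem 10 j = p.bucketSize P j := by
      rw [hF.mem 10 rfl]; exact hB.1 j hj
    have hN := p.bucketSize_le P j
    have hNM := hp.hN
    refine Runs.seq_sto rfl rfl (by simp) (by simp [← hBw, h25]; omega)
      (by simp only [Ex.Safe, Ex.eval, BinOp.eval, h25, e10, ← hBw]; split_ifs <;> omega) ?_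
    refine Runs.sto_le rfl rfl (by simp) (by simp [← hBw, h25]; omega)
      (by simp [h25, e10, ← hBw]; split_ifs <;> omega) ?_
    have key : ∀ i v, (v = if 1 ≤ i ∧ i ≤ j ∧ 0 < p.bucketSize P (i - 1) then 1 else 0) →
        (if i = j + 1 then (if 0 < p.bucketSize P j then 1 else 0) else v) =
          if 1 ≤ i ∧ i ≤ j + 1 ∧ 0 < p.bucketSize P (i - 1) then 1 else 0 := by
      rintro i v rfl
      by_cases hi : i = j + 1
      · subst hi; simp
      · rw [if_neg hi]
        refine if_congr ⟨?_, ?_⟩ rfl rfl <;> rintro ⟨h1, h2, h3⟩ <;> exact ⟨h1, by omega, h3⟩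
    constructor
    · intro i
      rw [← key i _ (h1 i)]
      simp [h25, e10, Function.update_apply]
    · intro i
      rw [← key i _ (h2 i)]
      simp [h25, e10, Function.update_apply]
  · rintro s' ⟨h1, h2⟩ - hF
    have hvec : ∀ i, (if 1 ≤ i ∧ i ≤ p.D ∧ 0 < p.bucketSize P (i - 1) then 1 else 0) =
        if i ∈ Finset.Icc 1 (p.D + 1) then (p.vec P i).toNat else 0 := by
      intro i
      by_cases h : 1 ≤ i ∧ i ≤ p.D ∧ 0 < p.bucketSize P (i - 1)
      · rw [if_pos h, if_pos (Finset.mem_Icc.mpr (by omega)), vec, decide_eq_true h]; rfl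
      · rw [if_neg h, vec, decide_eq_false h]; simp
    ext r
    · have : ∀ r, s'.reg (r + 100) = if r = 0 then p.D + 1 else 0 := by
        intro r
        rw [hF.reg (r + 100) ?_, State.setReg_reg]
        · by_cases h : r = 0
          · simp [h, hs.r3]
          · rw [if_neg (by omega), if_neg h, hgr]
        · rw [Bool.and_eq_true, Bool.not_eq_true', isTemp_eq_false]
          refine ⟨by omega, Prog.allR_mono (f := fun x => Nat.ble x 99) (fun x hx => ?_) rfl⟩
          rw [Nat.ble_eq] at hx
          rw [Bool.not_eq_true', beq_eq_false]; omega
      exact this r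
    · rename_i i
      rcases Nat.lt_or_ge r 2 with hr | hr
      · interval_cases r
        · exact (h1 i).trans ((hvec i).trans (by simp [convInput]))
        · exact (h2 i).trans ((hvec i).trans (by simp [convInput]))
      · have : s'.mem (r + 50) i = 0 := by
          rw [hF.mem (r + 50) ?_, State.setReg_mem, hgm]
          refine Prog.allM_mono (f := fun x => Nat.ble x 51) (fun x hx => ?_) rfl
          rw [Nat.ble_eq] at hx
          rw [Bool.not_eq_true', beq_eq_false]; omega
        refine this.trans ?_
        simp [convInput, show r ≠ 0 by omega, show r ≠ 1 by omega]

/-- The search for a solution with the data structure. -/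
def dsProg (pre qry : Prog) : Prog :=
  bucketProg ;; fillProg ;; pre.shift ;; asg 41 (.c 0) ;;
  forTo 26 0
    (asg 20 (.ld 0 (.b .add (.r 26) (.c 1))) ;; forTo 21 6 (queryProg qry))

theorem keepR_queryProg {qry : Prog} {r : ℕ} (hr : r < 100)
    (h : (codeProg ;; asg 100 (.b .add (.r 22) (.c 2)) ;; forTo 27 100 pairProg).keepR r = true) :
    (queryProg qry).keepR r = true := by
  simp only [queryProg, Prog.keepR_seq, Prog.keepR_shift _ _ hr, Bool.and_eq_true] at h ⊢
  tauto

theorem runs_dsProg {M : ℕ} (hp : p.Ok M) {P : ℕ → ℕ} {w' : ℕ} (hw' : w' ≤ p.w) {pre qry : Prog}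
    {s₀ : State} {t₀ c : ℕ} {s : State} (hs : p.Env s) (hP : p.Moduli P s)
    (hg : s.guest = ⟨fun _ => 0, fun _ _ => 0⟩)
    (hpre : Exec w' pre (convInput (p.D + 1) (p.vec P) (p.vec P)) t₀ s₀)
    (hA : p.Answers P w' qry s₀ c) :
    Runs p.w (dsProg pre qry) s (p.D * 50 + p.N * (p.E * (p.r * 40 + 60 + c) + p.r * 40 + 100) + 100
      + t₀ + (c + 120) * pseudoCount p.a p.N p.r P)
      (fun s' => s'.reg 41 ≤ 1 ∧ (s'.reg 41 = 1 ↔ ¬ p.NoSol)) := by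
  obtain ⟨hL1, hLM, hM2, hM3, hw⟩ := hp.bounds
  have hM := hp.hM
  have hN := hp.hN
  have hE := hp.hE
  have hdig := hP.digits
  rw [← exists_hit_iff hdig, ← sum_work hdig]
  obtain ⟨B, hBw⟩ : ∃ B, B = 2 ^ p.w := ⟨_, rfl⟩
  rw [← hBw] at hw
  -- Query times vary with the number of pairs to be tested; only their sum over all `z` and `e` is
  -- controlled, by the number of pseudo-solutions.
  have hsum : ∑ z ∈ Finset.range p.N, (20 + (∑ e ∈ Finset.range p.E,
        ((p.r * 40 + 50 + c + (c + 120) * p.work P (p.target P z e)) + 8) + 6) + 8) + 6 =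
      p.N * (p.E * (p.r * 40 + 58 + c) + 34) + 6 + (c + 120) *
        ∑ z ∈ Finset.range p.N, ∑ e ∈ Finset.range p.E, p.work P (p.target P z e) := by
    simp only [Finset.sum_add_distrib, Finset.sum_const, Finset.card_range, smul_eq_mul,
      Finset.mul_sum]
    ring
  have htot : p.N * (p.E * (p.r * 40 + 60 + c) + p.r * 40 + 100) =
      p.N * (p.E * (p.r * 40 + 58 + c) + 34) + p.N * (p.E * 2) + p.N * (p.r * 40 + 60) + p.N * 6 := by
    ring
  -- The buckets are built anew, for the final moduli: counting has overwritten array `10` by a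
  -- transform.
  refine Runs.seq_le (runs_bucketProg hp hs hP) (by omega) ?_
  intro s₁ hB₁ hF₁
  have hs₁ := hs.frame hF₁ rfl rfl
  have hP₁ := hP.of_eq (hF₁.mem 3 rfl)
  refine Runs.seq_le (runs_fillProg hp hs₁ hB₁ ((hF₁.guest_eq rfl rfl).trans hg)) (by omega) ?_
  intro s₂ hg₂ hF₂
  have hs₂ := hs₁.frame hF₂ rfl rfl
  have hP₂ := hP₁.of_eq (hF₂.mem 3 rfl)
  have hB₂ := hB₁.of_eq (hF₂.mem 10 rfl) (hF₂.mem 13 rfl)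
  refine Runs.seq_le (Runs.shift hw' (hg₂ ▸ hpre)) (by omega) ?_
  rintro s₃ ⟨hg₃, hr₃, hm₃⟩ -
  have hs₃ : p.Env s₃ := hs₂.of_eq (fun i hi => hr₃ i (by omega)) fun a ha => hm₃ a (by omega)
  have hR : p.Ready P w' qry s₀ (s₃.setReg 41 0) :=
    ⟨hs₃.setReg _ (by norm_num), hP₂.of_eq (hm₃ 3 (by norm_num)),
      hB₂.of_eq (hm₃ 10 (by norm_num)) (hm₃ 13 (by norm_num)),
      by rw [guest_setReg_of_lt _ _ _ (by norm_num), hg₃]; exact .init, by simp⟩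
  have hset : ∀ {s' : State} {i v : ℕ}, p.Ready P w' qry s₀ s' → 20 ≤ i → i < 100 → i ≠ 41 →
      p.Ready P w' qry s₀ (s'.setReg i v) := by
    intro s' i v h h1 h2 h3
    exact ⟨h.env.setReg _ h1, h.moduli, h.buckets, by
      rw [guest_setReg_of_lt _ _ _ h2]; exact h.guest, by
      rw [State.setReg_reg, if_neg (by omega)]; exact h.r41⟩
  refine Runs.seq_asg rfl (by simp; omega) (by simp) ?_
  simp only [Ex.eval, Ex.cost]
  refine (Runs.forTo p.N (fun j s' => p.Ready P w' qry s₀ s' ∧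
    (s'.reg 41 = 1 ↔ ∃ z < j, ∃ e < p.E, p.Hit P z e)) (fun z => 20 + (∑ e ∈ Finset.range p.E,
        ((p.r * 40 + 50 + c + (c + 120) * p.work P (p.target P z e)) + 8) + 6)) hR.env.r0 (by omega)
    rfl rfl rfl ?_ ?_ ⟨hset hR (by norm_num) (by norm_num) (by norm_num), by simp⟩ ?_
    (fun s' h _ _ => ⟨h.1.r41, h.2⟩)).mono (by omega) (fun _ h => h)
  · rw [Prog.keepR_seq, Prog.keepR_forTo _ _ _ _ rfl, keepR_queryProg (by norm_num) rfl]; rfl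
  · rw [Prog.keepR_seq, Prog.keepR_forTo _ _ _ _ rfl, keepR_queryProg (by norm_num) rfl]; rfl
  rintro z hz s' ⟨h1, h2⟩ h26 -
  have haz := hp.ha z hz
  refine Runs.seq_asg rfl (by simp; omega) (by simp [h26, ← hBw, h1.env.inp z hz]; omega) ?_
  simp only [Ex.eval, BinOp.eval, h26, h1.env.inp z hz, Ex.cost]
  refine (Runs.forTo p.E (fun e s'' => p.Ready P w' qry s₀ s'' ∧ s''.reg 20 = p.a z ∧
    (s''.reg 41 = 1 ↔ s'.reg 41 = 1 ∨ ∃ e' < e, p.Hit P z e'))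
    (fun e => p.r * 40 + 50 + c + (c + 120) * p.work P (p.target P z e)) (by simpa using h1.env.r6) (by omega)
    rfl rfl rfl (keepR_queryProg (by norm_num) rfl) (keepR_queryProg (by norm_num) rfl)
    ⟨hset (hset h1 (by norm_num) (by norm_num) (by norm_num)) (by norm_num) (by norm_num)
      (by norm_num), by simp, by simp⟩ ?_ ?_).mono ?_ (fun _ h => h)
  · rintro e he s₄ ⟨g1, g2, g3⟩ h21 -
    refine (runs_queryProg hp hw' hA g1 hz he g2 h21).mono le_rfl ?_
    rintro s₅ ⟨f1, f2, f3⟩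
    refine ⟨hset f1 (by norm_num) (by norm_num) (by norm_num), by simpa using f2, ?_⟩
    simp only [State.setReg_reg, Nat.reduceEqDiff, if_false]
    rw [f3, g3, Nat.exists_lt_succ_right, or_assoc]
  · rintro s₄ ⟨g1, -, g3⟩ - -
    refine ⟨hset g1 (by norm_num) (by norm_num) (by norm_num), ?_⟩
    simp only [State.setReg_reg, Nat.reduceEqDiff, if_false]
    rw [g3, h2, Nat.exists_lt_succ_right]
  · omega

/-! ### The whole algorithm and its running time -/

/-- The algorithm for 3SUM. -/
def mainProg (r b m C : ℕ) (pre qry : Prog) : Prog :=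
  paramProg r b m ;; tableProg ;; greedyProg ;;
  asg 40 (.c (r - 1)) ;; powProg 1 40 ;;
  cond (.b .lt (.b .div (.b .mul (.c C) (.b .mul (.r 0) (.b .mul (.r 0) (.r 0)))) (.r 21)) (.r 34))
    (asg 0 (.c 1))
    (dsProg pre qry ;; asg 0 (.r 41))

/-- The bound for the number of pseudo-solutions. -/
def threshold (p : Par) (C : ℕ) : ℕ := C * p.N ^ 3 / p.q ^ (p.r - 1)

/-- A bound for the running time, with preprocessing time `T₀` and query time `c` per witness. -/
def mainTime (p : Par) (b C T₀ c : ℕ) : ℕ :=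
  (p.q * (p.q * 20 + b * 12 + 60) + 24 * p.r + 12 * p.m + 120) +
  (p.L * (p.m * (p.q * 14 + 20) + p.L * 40 + 50) + 10) +
  p.greedyTime + (p.r * 12 + 40) +
  (p.D * 50 + p.N * (p.E * (p.r * 40 + 60 + c) + p.r * 40 + 100) + 100
      + T₀ + (c + 120) * p.threshold C)

theorem pseudoCount_le_threshold {M k : ℕ} (hp : p.Ok M) {P : ℕ → ℕ}
    (h : pseudoCount p.a p.N p.r P * p.S ^ p.r ≤ p.N ^ 3 * (k * (Nat.log 2 p.q + 1)) ^ p.r) :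
    pseudoCount p.a p.N p.r P ≤ p.threshold (threshConst k p.r) := by
  have h5 := hp.five_le
  refine le_threshold p.N _ p.q p.r p.S _ _ ?_ h
    (pow_mul_pow_le_threshConst k p.r p.q hp.one_le_r h5) (by omega)
  refine Finset.card_pos.mpr ⟨2, Finset.mem_filter.mpr ⟨Finset.mem_Icc.mpr ⟨by norm_num, ?_⟩,
    Nat.prime_two⟩⟩
  rw [H, L]; omega

theorem runs_mainProg {M b k : ℕ} (hp : p.Ok M) {s : State} (h0 : s.reg 0 = p.N)
    (hb : b ≤ p.m + 1) (hr : p.r ≤ p.m + 1) (hqb : p.N < p.q ^ b)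
    (hmin : ∀ q', 5 ≤ q' → q' < p.q → ¬ (q'.Prime ∧ p.N < q' ^ b))
    (hin : ∀ x < p.N, s.mem 0 (x + 1) = p.a x)
    (hg : s.guest = ⟨fun _ => 0, fun _ _ => 0⟩)
    (hk : ∀ x < p.N, 2 * p.a x < 2 ^ (k * (Nat.log 2 p.q + 1)))
    (hC : threshConst k p.r * p.N ^ 3 ≤ M)
    {w' : ℕ} (hw' : w' ≤ p.w) {pre qry : Prog} {T₀ c : ℕ}
    (hDS : ∀ P, ∃ t₀ s₀, Exec w' pre (convInput (p.D + 1) (p.vec P) (p.vec P)) t₀ s₀ ∧ t₀ ≤ T₀ ∧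
      p.Answers P w' qry s₀ c) :
    Runs p.w (mainProg p.r b p.m (threshConst k p.r) pre qry) s
      (p.mainTime b (threshConst k p.r) T₀ c) (fun s' => s'.reg 0 = 1 ↔ ¬ p.NoSol) := by
  obtain ⟨hL1, hLM, hM2, hM3, hw⟩ := hp.bounds
  obtain ⟨-, h5, hr1, -, -, hM, hNM, hqM, hrM, hm, hD, hQ, hE, -, -⟩ := id hp
  obtain ⟨B, hB⟩ : ∃ B, B = 2 ^ p.w := ⟨_, rfl⟩
  rw [← hB] at hw
  obtain ⟨C, hCeq⟩ : ∃ C, C = threshConst k p.r := ⟨_, rfl⟩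
  have hth : ∀ P, p.NoSol → pseudoCount p.a p.N p.r P * p.S ^ p.r ≤
      p.N ^ 3 * (k * (Nat.log 2 p.q + 1)) ^ p.r → pseudoCount p.a p.N p.r P ≤ p.threshold C :=
    fun P _ h => hCeq ▸ pseudoCount_le_threshold hp h
  rw [← hCeq] at hC ⊢
  rw [mainTime]
  refine Runs.seq_le (runs_paramProg hp h0 hb hqb hmin) (by omega) ?_
  intro s₁ hs₁ hF₁
  refine Runs.seq_le (runs_tableProg hp hs₁ (by rw [hF₁.mem 0 rfl]; exact hin)) (by omega) ?_
  intro s₂ hs₂ hF₂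
  refine Runs.seq_le (runs_greedyProg hp hs₂ _ hk) (by omega) ?_
  rintro s₃ ⟨P, hP₃, h34, hno⟩ hF₃
  have hs₃ : p.Env s₃ := hs₂.frame hF₃ rfl rfl
  have hg₃ : s₃.guest = ⟨fun _ => 0, fun _ _ => 0⟩ := by
    rw [hF₃.guest_eq rfl rfl, hF₂.guest_eq rfl rfl, hF₁.guest_eq rfl rfl, hg]
  refine Runs.seq_asg rfl (by simp; omega) (by simp [← hB]; omega) ?_
  simp only [Ex.eval, Ex.cost]
  have hqr : p.q ^ (p.r - 1) ≤ M :=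
    (Nat.pow_le_pow_right (by omega) (by omega)).trans hQ
  refine Runs.seq_le (runs_powProg 1 40 p.q (p.r - 1) (by simpa using hs₃.r1) (by simp) rfl rfl
    rfl rfl rfl rfl (by omega) (by omega) (by omega) (by omega)) (by omega) ?_
  intro s₄ h21 hF₄
  have hs₄ : p.Env s₄ := (hs₃.setReg _ (by norm_num)).frame hF₄ rfl rfl
  have hP₄ : p.Moduli P s₄ := hP₃.of_eq (by rw [hF₄.mem 3 rfl]; rfl)
  have hg₄ : s₄.guest = ⟨fun _ => 0, fun _ _ => 0⟩ := by
    rw [hF₄.guest_eq rfl rfl, guest_setReg_of_lt _ _ _ (by norm_num), hg₃]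
  have g34 : s₄.reg 34 = pseudoCount p.a p.N p.r P := by
    rw [hF₄.reg 34 rfl]; simpa using h34
  have hN3 : p.N * (p.N * p.N) = p.N ^ 3 := by ring
  have hC1 : C ≤ M :=
    (Nat.le_mul_of_pos_right _ (Nat.pow_pos (by have := hp.one_le_N; omega))).trans hC
  have hval : (Ex.b .lt (.b .div (.b .mul (.c C) (.b .mul (.r 0) (.b .mul (.r 0) (.r 0)))) (.r 21))
      (.r 34)).eval s₄ = if p.threshold C < pseudoCount p.a p.N p.r P then 1 else 0 := by
    simp only [Ex.eval, BinOp.eval, hs₄.r0, h21, g34, hN3, threshold]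
    rfl
  refine (Runs.cond (T := 10) (T' := (p.D * 50 + p.N * (p.E * (p.r * 40 + 60 + c) + p.r * 40 + 100)
      + 100 + T₀ + (c + 120) * p.threshold C) + 2) rfl ?_ ?_ ?_).mono ?_ (fun _ h => h)
  · have e1 : p.N ^ 3 ≤ M := hp.hN3.le.trans hQ
    have e2 := Nat.div_le_self (C * p.N ^ 3) (p.q ^ (p.r - 1))
    have e3 : pseudoCount p.a p.N p.r P ≤ M := (pseudoCount_le _ _ _ _).trans e1
    have e4 : p.N * p.N ≤ p.N ^ 3 := by
      rw [← hN3]; exact Nat.le_mul_of_pos_left _ hp.one_le_N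
    simp only [Ex.Safe, Ex.eval, BinOp.eval, hs₄.r0, h21, g34, hN3, ← hB]
    and_intros <;> first | omega | (split_ifs <;> omega)
  · intro h
    rw [hval] at h
    refine Runs.asg_le rfl (by simp) (by simp [← hB]; omega) ?_
    simp only [State.setReg_reg, Ex.eval, if_true, true_iff]
    -- Without solutions the greedy guarantee keeps the count within the threshold, so a larger
    -- count proves that a solution exists.
    intro hns
    have := hth P hns (hno hns)
    rw [if_neg (by omega)] at h
    exact h rfl
  · intro h
    rw [hval] at h
    have hcnt : pseudoCount p.a p.N p.r P ≤ p.threshold C := by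
      by_contra hcon
      rw [if_pos (by omega)] at h
      exact one_ne_zero h
    obtain ⟨t₀, s₀, hpre, ht₀, hA⟩ := hDS P
    have hcnt' := Nat.mul_le_mul_left (c + 120) hcnt
    refine Runs.seq_le (runs_dsProg hp hw' hs₄ hP₄ hg₄ hpre hA) (by omega) ?_
    rintro s₅ ⟨h₅, h₅'⟩ -
    exact Runs.asg_le rfl (by simp; omega) (by simp [← hB]; omega) (by simpa using h₅')
  · simp
    omega

/-- All parts of the running time that grow with `N` are measured by the single quantity `G`; what
remains depends on `b`, `m` and `r` only. -/
theorem mainTime_le {b C T₀ c G : ℕ} (h5 : 5 ≤ p.q) (hN : 1 ≤ p.N)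
    (h1 : p.q * p.q ≤ G) (h2 : p.q ^ (p.r + 2) ≤ G) (h3 : p.q * p.N ≤ G) (h4 : p.N * c ≤ G)
    (h5 : T₀ ≤ G) (h6 : (c + 120) * p.threshold C ≤ G) :
    p.mainTime b C T₀ c ≤ G * (612 + 12 * b + 46 * p.m + 76 * p.r +
      p.r * (320 * p.r + 220 + (2 ^ p.r * (p.r * 80 + 60) + 100) + 60) +
      2 ^ p.r * (p.r * 40 + 61)) := by
  have hL : p.L ≤ p.q := Nat.sub_le _ _
  have hH : p.H ≤ p.q := (Nat.div_le_self _ _).trans hL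
  have hD : p.D ≤ p.q ^ p.r := Nat.pow_le_pow_left hL _
  have hqG : p.q ≤ G := (Nat.le_mul_of_pos_left _ (by omega)).trans h1
  have hNG : p.N ≤ G := (Nat.le_mul_of_pos_left _ (by omega)).trans h3
  have hDG : p.D ≤ G := (hD.trans (Nat.pow_le_pow_right (by omega) (by omega))).trans h2
  have hG : 1 ≤ G := hN.trans hNG
  have hE : p.E = 2 ^ p.r := rfl
  have e1 : p.q * (p.q * 20 + b * 12 + 60) ≤ G * (20 + b * 12 + 60) := calc
    _ = p.q * p.q * 20 + p.q * (b * 12 + 60) := by ring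
    _ ≤ G * 20 + G * (b * 12 + 60) := by gcongr
    _ = _ := by ring
  have e2 : p.L * (p.m * (p.q * 14 + 20) + p.L * 40 + 50) ≤ G * (p.m * 34 + 90) := calc
    _ ≤ p.q * (p.m * (p.q * 14 + 20) + p.q * 40 + 50) := by gcongr
    _ = p.q * p.q * (p.m * 14 + 40) + p.q * (p.m * 20 + 50) := by ring
    _ ≤ G * (p.m * 14 + 40) + G * (p.m * 20 + 50) := by gcongr
    _ = _ := by ring
  have e3 : p.H * (p.D * (p.r * (p.L * 60 + 200) + 80)) ≤ G * (p.r * 260 + 80) := calc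
    _ ≤ p.q * (p.q ^ p.r * (p.r * (p.q * 60 + p.q * 200) + p.q * 80)) := by
      gcongr <;> omega
    _ = p.q ^ (p.r + 2) * (p.r * 260 + 80) := by ring
    _ ≤ _ := by gcongr
  have e4 : p.H * (p.N * (p.E * (p.r * 80 + 60) + 100)) ≤
      G * (2 ^ p.r * (p.r * 80 + 60) + 100) := calc
    _ ≤ p.q * (p.N * (p.E * (p.r * 80 + 60) + 100)) := by gcongr
    _ = p.q * p.N * (2 ^ p.r * (p.r * 80 + 60) + 100) := by rw [hE]; ring
    _ ≤ _ := by gcongr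
  have e5 : p.H * (p.r * 60 + 140) ≤ G * (p.r * 60 + 140) := by gcongr; omega
  have e6 : p.greedyTime ≤
      G * (p.r * (320 * p.r + 220 + (2 ^ p.r * (p.r * 80 + 60) + 100) + 60) + 20) := calc
    _ = p.r * (p.H * (p.D * (p.r * (p.L * 60 + 200) + 80)) +
        p.H * (p.N * (p.E * (p.r * 80 + 60) + 100)) + p.H * (p.r * 60 + 140) + 60) + 20 := by
      rw [greedyTime, countTime]; ring
    _ ≤ p.r * (G * (p.r * 260 + 80) + G * (2 ^ p.r * (p.r * 80 + 60) + 100) +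
        G * (p.r * 60 + 140) + G * 60) + G * 20 := by gcongr <;> omega
    _ = _ := by ring
  have e7 : p.N * (p.E * (p.r * 40 + 60 + c) + p.r * 40 + 100) ≤
      G * (2 ^ p.r * (p.r * 40 + 61) + p.r * 40 + 100) := calc
    _ = p.N * (2 ^ p.r * (p.r * 40 + 60) + p.r * 40 + 100) + p.N * c * 2 ^ p.r := by rw [hE]; ring
    _ ≤ G * (2 ^ p.r * (p.r * 40 + 60) + p.r * 40 + 100) + G * 2 ^ p.r := by gcongr
    _ = _ := by ring
  calc p.mainTime b C T₀ c ≤ (G * (20 + b * 12 + 60) + 24 * (G * p.r) + 12 * (G * p.m) + G * 120) +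
      (G * (p.m * 34 + 90) + G * 10) +
      G * (p.r * (320 * p.r + 220 + (2 ^ p.r * (p.r * 80 + 60) + 100) + 60) + 20) +
      (G * p.r * 12 + G * 40) +
      (G * 50 + G * (2 ^ p.r * (p.r * 40 + 61) + p.r * 40 + 100) + G * 100 + G + G) := by
        rw [mainTime]
        gcongr <;> first | omega | exact Nat.le_mul_of_pos_left _ hG
    _ = G * (612 + 12 * b + 46 * p.m + 76 * p.r +
      p.r * (320 * p.r + 220 + (2 ^ p.r * (p.r * 80 + 60) + 100) + 60) +
      2 ^ p.r * (p.r * 40 + 61)) := by ring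

/-! ### Choice of the prime, the word length and the exponents -/

/-- With `t` the integer part of the `b`-th root of `N`, Bertrand's postulate gives a prime above `t
+ 4` and at most `2 * t + 8 ≤ 10 * t`. -/
theorem exists_least_prime (N b : ℕ) (hN : 1 ≤ N) (hb : 1 ≤ b) : ∃ q, q.Prime ∧ 5 ≤ q ∧ N < q ^ b ∧
    q ^ b ≤ 10 ^ b * N ∧ ∀ q', 5 ≤ q' → q' < q → ¬ (q'.Prime ∧ N < q' ^ b) := by
  classical
  obtain ⟨t, ht1, htN, htN'⟩ : ∃ t, 1 ≤ t ∧ t ^ b ≤ N ∧ N < (t + 1) ^ b := by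
    have hex : ∃ s, N < (s + 1) ^ b :=
      ⟨N, (Nat.lt_succ_self N).trans_le (Nat.le_self_pow (by omega) _)⟩
    have hs := Nat.find_spec hex
    have h0 : Nat.find hex ≠ 0 := by
      intro h0; rw [h0] at hs; simp at hs; omega
    refine ⟨Nat.find hex, by omega, ?_, hs⟩
    have := Nat.find_min hex (show Nat.find hex - 1 < Nat.find hex by omega)
    rw [Nat.sub_add_cancel (by omega)] at this
    omega
  obtain ⟨q₀, hq₀, hlt, hle⟩ := Nat.exists_prime_lt_and_le_two_mul (t + 4) (by omega)
  have hex : ∃ q, 5 ≤ q ∧ q.Prime ∧ N < q ^ b :=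
    ⟨q₀, by omega, hq₀, htN'.trans_le (Nat.pow_le_pow_left (by omega) _)⟩
  obtain ⟨h1, h2, h3⟩ := Nat.find_spec hex
  refine ⟨Nat.find hex, h2, h1, h3, ?_, fun q' h5 hlt' h => Nat.find_min hex hlt' ⟨h5, h⟩⟩
  have hfind : Nat.find hex ≤ q₀ :=
    Nat.find_min' hex ⟨by omega, hq₀, htN'.trans_le (Nat.pow_le_pow_left (by omega) _)⟩
  calc Nat.find hex ^ b ≤ (10 * t) ^ b := Nat.pow_le_pow_left (by omega) _
    _ = 10 ^ b * t ^ b := mul_pow _ _ _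
    _ ≤ _ := Nat.mul_le_mul_left _ htN

/-- A polynomial bound for all numbers that occur. -/
def bound (N b r c k : ℕ) : ℕ := (10 ^ (3 * b) + 8 + r + 3 * b + 2 ^ r + threshConst k r) * N ^ (c + 3)

theorem bound_ge {N b r c k : ℕ} (hN : 1 ≤ N) :
    10 ^ (3 * b) * N ^ 3 ≤ bound N b r c k ∧ 8 ≤ bound N b r c k ∧ r ≤ bound N b r c k ∧
    3 * b ≤ bound N b r c k ∧ 2 ^ r ≤ bound N b r c k ∧ threshConst k r * N ^ 3 ≤ bound N b r c k ∧
    N ^ c ≤ bound N b r c k := by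
  have h1 : N ^ 3 ≤ N ^ (c + 3) := Nat.pow_le_pow_right hN (by omega)
  have h2 : N ^ c ≤ N ^ (c + 3) := Nat.pow_le_pow_right hN (by omega)
  have h3 : 1 ≤ N ^ (c + 3) := Nat.one_le_pow _ _ hN
  obtain ⟨K, hK⟩ : ∃ K, K = 10 ^ (3 * b) + 8 + r + 3 * b + 2 ^ r + threshConst k r := ⟨_, rfl⟩
  have key : ∀ x y, x ≤ K → y ≤ N ^ (c + 3) → x * y ≤ K * N ^ (c + 3) :=
    fun x y h h' => Nat.mul_le_mul h h'
  rw [bound, ← hK]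
  generalize 10 ^ (3 * b) = A at *
  generalize 2 ^ r = B at *
  refine ⟨key _ _ (by omega) h1, ?_, ?_, ?_, ?_, key _ _ (by omega) h1, ?_⟩
  · simpa using key 8 1 (by omega) h3
  · simpa using key r 1 (by omega) h3
  · simpa using key (3 * b) 1 (by omega) h3
  · simpa using key B 1 (by omega) h3
  · simpa using key 1 _ (by omega) h2

/-- All numbers that occur are polynomial in `N`, and so is the size of the guest's instance. Hence
the logarithms of both are at most a constant times `log N + 1`. -/
theorem exists_wordLength (b r c k κ : ℕ) : ∃ κ', ∀ N, 1 ≤ N →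
    8 * bound N b r c k ^ 4 ≤ 2 ^ wordLength κ' N ∧
    ∀ n, n ≤ 2 * bound N b r c k → wordLength κ n ≤ wordLength κ' N := by
  obtain ⟨K, hK⟩ : ∃ K, K = 10 ^ (3 * b) + 8 + r + 3 * b + 2 ^ r + threshConst k r := ⟨_, rfl⟩
  refine ⟨(8 * K ^ 4 + (c + 3) * 4) * (1 + κ) + κ, fun N hN => ?_⟩
  obtain ⟨l, hl⟩ : ∃ l, l = Nat.log 2 N + 1 := ⟨_, rfl⟩
  have hNl : N ≤ 2 ^ l := by
    rw [hl]; exact (Nat.lt_pow_succ_log_self (by norm_num) N).le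
  have hl0 : 0 < l := by omega
  have h8 : 8 * bound N b r c k ^ 4 ≤ 2 ^ ((8 * K ^ 4 + (c + 3) * 4) * l) := by
    rw [bound, ← hK, mul_pow, ← mul_assoc, ← pow_mul N, add_mul (8 * K ^ 4),
      pow_add 2 (8 * K ^ 4 * l)]
    refine Nat.mul_le_mul (Nat.lt_two_pow_self.le.trans (Nat.pow_le_pow_right (by norm_num)
      (Nat.le_mul_of_pos_right _ hl0))) ?_
    rw [mul_comm _ l, pow_mul 2 l]
    exact Nat.pow_le_pow_left hNl _
  have hM := (bound_ge (b := b) (r := r) (c := c) (k := k) hN).2.1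
  constructor
  · refine h8.trans (Nat.pow_le_pow_right (by norm_num) ?_)
    rw [wordLength, ← hl]
    refine Nat.mul_le_mul_right _ ?_
    rw [mul_add, mul_one]; omega
  · intro n hn
    have hlog : Nat.log 2 n ≤ (8 * K ^ 4 + (c + 3) * 4) * l := by
      refine (Nat.log_mono_right (hn.trans ?_)).trans (Nat.log_pow (by norm_num) _).le
      refine le_trans ?_ h8
      refine Nat.mul_le_mul (by norm_num) (Nat.le_self_pow (by norm_num) _)
    rw [wordLength, wordLength, ← hl]
    calc κ * (Nat.log 2 n + 1) ≤ κ * ((8 * K ^ 4 + (c + 3) * 4) * l + l) := by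
          gcongr; omega
      _ = ((8 * K ^ 4 + (c + 3) * 4) * κ + κ) * l := by ring
      _ ≤ _ := by
        refine Nat.mul_le_mul_right _ ?_
        rw [mul_add, mul_one]; omega

/-- The choice `m + 1 = 3 * b` makes `Q = (q ^ b) ^ 3`, which exceeds `N ^ 3` but only by a constant
factor. As `r ≤ 3 * b`, it also bounds `D`. -/
theorem ok_of_bound {b c k : ℕ} (hprime : p.q.Prime) (h5 : 5 ≤ p.q) (hr1 : 1 ≤ p.r)
    (hrb : p.r ≤ 3 * b) (hm : p.m + 1 = 3 * b) (hN : 1 ≤ p.N) (hqb : p.N < p.q ^ b)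
    (hqb' : p.q ^ b ≤ 10 ^ b * p.N) (ha : ∀ x < p.N, p.a x ≤ p.N ^ c)
    (hw : 8 * bound p.N b p.r c k ^ 4 ≤ 2 ^ p.w) : p.Ok (bound p.N b p.r c k) := by
  obtain ⟨g1, g2, g3, g4, g5, -, g7⟩ := bound_ge (b := b) (r := p.r) (c := c) (k := k) hN
  have hQ : p.Q = (p.q ^ b) ^ 3 := by rw [Q, hm, ← pow_mul, mul_comm]
  have hQM : p.Q ≤ bound p.N b p.r c k := by
    refine le_trans ?_ g1
    rw [hQ, mul_comm 3 b, pow_mul, ← mul_pow]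
    exact Nat.pow_le_pow_left hqb' _
  have hN3 : p.N ^ 3 < p.Q := hQ ▸ Nat.pow_lt_pow_left hqb (by norm_num)
  refine ⟨hprime, h5, hr1, hN, hN3, g2, ?_, ?_, g3, by omega, ?_, hQM, g5,
    fun x hx => (ha x hx).trans g7, hw⟩
  · exact (Nat.le_self_pow (by norm_num) _).trans (hN3.le.trans hQM)
  · exact (Nat.le_self_pow (by omega) _).trans hQM
  · refine le_trans ?_ hQM
    rw [D, Q]
    exact (Nat.pow_le_pow_left (Nat.sub_le _ _) _).trans (Nat.pow_le_pow_right (by omega) (by omega))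

/-- The conditions ask for an integer `r` with `(b + 1) * u < r < b * v` and `r + 2 < 2 * b`, where
`u = 1 / (1 - β)` and `v = 2 / (2 - α)`. Here `u < v` follows from `β < α / 2`, and `v < 2` from `α
< 1`. So for large `b` the interval is long enough to contain an integer, and it lies well below `2
* b`. -/
theorem exists_exponents {α β : ℝ} (hα0 : 0 < α) (hα1 : α < 1) (hβ : β < α / 2) :
    ∃ b r : ℕ, 1 ≤ r ∧ 2 ≤ b ∧ (r : ℝ) * (2 - α) < 2 * b ∧ (b : ℝ) + 1 < r * (1 - β) ∧
      r + 2 < 2 * b := by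
  obtain ⟨u, hu⟩ : ∃ u, u = (1 - β)⁻¹ := ⟨_, rfl⟩
  obtain ⟨v, hv⟩ : ∃ v, v = 2 / (2 - α) := ⟨_, rfl⟩
  have hu0 : 0 < u := by rw [hu]; exact inv_pos.mpr (by linarith)
  have huv : u < v := by
    rw [hu, hv, inv_eq_one_div, div_lt_div_iff₀ (by linarith) (by linarith)]; linarith
  have hv2 : v < 2 := by rw [hv, div_lt_iff₀ (by linarith)]; linarith
  have hu1 : u * (1 - β) = 1 := by rw [hu]; exact inv_mul_cancel₀ (by linarith)
  have hv1 : v * (2 - α) = 2 := by rw [hv]; exact div_mul_cancel₀ _ (by linarith)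
  obtain ⟨n₁, h₁⟩ := exists_nat_gt ((1 + u) / (v - u))
  obtain ⟨n₂, h₂⟩ := exists_nat_gt (2 / (2 - v))
  rw [div_lt_iff₀ (by linarith)] at h₁ h₂
  obtain ⟨b, hb⟩ : ∃ b, b = n₁ + n₂ + 2 := ⟨_, rfl⟩
  have hb₁ : (n₁ : ℝ) ≤ b := by rw [hb]; push_cast; linarith [(n₂.cast_nonneg : (0 : ℝ) ≤ n₂)]
  have hb₂ : (n₂ : ℝ) ≤ b := by rw [hb]; push_cast; linarith [(n₁.cast_nonneg : (0 : ℝ) ≤ n₁)]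
  have k₁ : 1 + u < b * (v - u) := h₁.trans_le (mul_le_mul_of_nonneg_right hb₁ (by linarith))
  have k₂ : 2 < b * (2 - v) := h₂.trans_le (mul_le_mul_of_nonneg_right hb₂ (by linarith))
  obtain ⟨r, hr⟩ : ∃ r, r = ⌊((b : ℝ) + 1) * u⌋₊ + 1 := ⟨_, rfl⟩
  have hr₁ : ((b : ℝ) + 1) * u < r := by rw [hr]; push_cast; exact Nat.lt_floor_add_one _
  have hr₂ : (r : ℝ) ≤ (b + 1) * u + 1 := by
    rw [hr]; push_cast
    linarith [Nat.floor_le (show 0 ≤ ((b : ℝ) + 1) * u by positivity)]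
  have hr₃ : (r : ℝ) < b * v := by linarith
  refine ⟨b, r, by omega, by omega, ?_, ?_, ?_⟩
  · calc (r : ℝ) * (2 - α) < b * v * (2 - α) := mul_lt_mul_of_pos_right hr₃ (by linarith)
      _ = 2 * b := by rw [mul_assoc, hv1, mul_comm]
  · calc (b : ℝ) + 1 = (b + 1) * u * (1 - β) := by rw [mul_assoc, hu1, mul_one]
      _ < r * (1 - β) := mul_lt_mul_of_pos_right hr₁ (by linarith)
  · have : (r : ℝ) + 2 < 2 * b := by linarith
    exact_mod_cast this

/-- The constant factor of the running time. -/
def timeFactor (b m r : ℕ) : ℕ := 612 + 12 * b + 46 * m + 76 * r +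
  r * (320 * r + 220 + (2 ^ r * (r * 80 + 60) + 100) + 60) + 2 ^ r * (r * 40 + 61)

theorem threshold_le {b C : ℕ} {X : ℝ} (hX : 1 ≤ X) (hXq : X ≤ p.q) (hN : (p.N : ℝ) = X ^ b)
    (hr1 : 1 ≤ p.r) : (p.threshold C : ℝ) ≤ C * X ^ (3 * b - (p.r - 1) : ℝ) := by
  have hX0 : 0 < X := by linarith
  have h1 : (X : ℝ) ^ (3 * b - (p.r - 1) : ℝ) = (X ^ b) ^ 3 / X ^ (p.r - 1) := by
    rw [Real.rpow_sub hX0, ← pow_mul, ← Real.rpow_natCast, ← Real.rpow_natCast X (p.r - 1),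
      Nat.cast_sub hr1]
    push_cast
    rw [mul_comm (b : ℝ)]
  rw [h1, ← hN, ← mul_div_assoc, threshold]
  refine Nat.cast_div_le.trans ?_
  push_cast
  gcongr

/-- The hypotheses `g1` to `g5` cover, in this order, the greedy transforms, the greedy histograms,
the base cost of the queries, the preprocessing, and the work on witnesses. -/
theorem mainTime_le_rpow {b C T₀ c : ℕ} {X C₁ α β γ : ℝ} (h5 : 5 ≤ p.q) (hN1 : 1 ≤ p.N)
    (hr1 : 1 ≤ p.r) (hX : 1 ≤ X) (hXq : X ≤ p.q) (hqX : (p.q : ℝ) ≤ 10 * X)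
    (hN : (p.N : ℝ) = X ^ b) (hC₁ : 0 ≤ C₁) (hβ0 : 0 ≤ β)
    (hT : (T₀ : ℝ) ≤ C₁ * X ^ (p.r * (2 - α))) (hc : (c : ℝ) ≤ C₁ * X ^ (p.r * β))
    (g1 : (p.r : ℝ) + 2 ≤ γ) (g2 : (b : ℝ) + 1 ≤ γ) (g3 : b + p.r * β ≤ γ)
    (g4 : p.r * (2 - α) ≤ γ) (g5 : 3 * b - (p.r - 1) + p.r * β ≤ γ) :
    (p.mainTime b C T₀ c : ℝ) ≤
      (100 + 10 ^ (p.r + 2) + C₁ + (C₁ + 120) * C) * timeFactor b p.m p.r * X ^ γ := by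
  have hX0 : 0 < X := by linarith
  obtain ⟨K, hK⟩ : ∃ K : ℝ, K = 100 + 10 ^ (p.r + 2) + C₁ + (C₁ + 120) * C := ⟨_, rfl⟩
  have hmono : ∀ y, y ≤ γ → X ^ y ≤ X ^ γ := fun y hy => Real.rpow_le_rpow_of_exponent_le hX hy
  have hγ0 : 0 < X ^ γ := Real.rpow_pos_of_pos hX0 _
  have hC0 : (0 : ℝ) ≤ (C₁ + 120) * C := by positivity
  have h10 : (0 : ℝ) ≤ 10 ^ (p.r + 2) := by positivity
  have hfin : ∀ (x : ℕ) (k y : ℝ), (x : ℝ) ≤ k * X ^ y → 0 ≤ k → k ≤ K → y ≤ γ →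
      x ≤ ⌊K * X ^ γ⌋₊ := by
    intro x k y hx hk hkK hy
    refine Nat.le_floor (hx.trans ?_)
    exact mul_le_mul hkK (hmono y hy) (Real.rpow_pos_of_pos hX0 _).le (hk.trans hkK)
  have hr0 : (0 : ℝ) ≤ p.r := Nat.cast_nonneg _
  have hmain := mainTime_le (b := b) (C := C) (T₀ := T₀) (c := c) (G := ⌊K * X ^ γ⌋₊) h5 hN1
    (hfin _ 100 2 ?_ (by norm_num) (by linarith) (by linarith))
    (hfin _ (10 ^ (p.r + 2)) (p.r + 2) ?_ h10 (by linarith) g1)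
    (hfin _ 10 (b + 1) ?_ (by norm_num) (by linarith) g2)
    (hfin _ C₁ (b + p.r * β) ?_ hC₁ (by linarith) g3)
    (hfin _ C₁ _ hT hC₁ (by linarith) g4)
    (hfin _ ((C₁ + 120) * C) (3 * b - (p.r - 1) + p.r * β) ?_ hC0 (by linarith) g5)
  · have hG : (⌊K * X ^ γ⌋₊ : ℝ) ≤ K * X ^ γ :=
      Nat.floor_le (mul_nonneg (by linarith) hγ0.le)
    calc (p.mainTime b C T₀ c : ℝ) ≤ (⌊K * X ^ γ⌋₊ : ℝ) * timeFactor b p.m p.r := by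
          exact_mod_cast hmain
      _ ≤ K * X ^ γ * timeFactor b p.m p.r := by gcongr
      _ = K * timeFactor b p.m p.r * X ^ γ := by ring
      _ = _ := by rw [hK]
  · rw [Real.rpow_two]
    push_cast
    calc (p.q : ℝ) * p.q ≤ (10 * X) * (10 * X) := by gcongr
      _ = 100 * X ^ 2 := by ring
  · push_cast
    calc (p.q : ℝ) ^ (p.r + 2) ≤ (10 * X) ^ (p.r + 2) := by gcongr
      _ = 10 ^ (p.r + 2) * X ^ ((p.r : ℝ) + 2) := by
        rw [mul_pow]; congr 1
        rw [← Real.rpow_natCast]; push_cast; rfl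
  · push_cast
    calc (p.q : ℝ) * p.N ≤ 10 * X * X ^ b := by rw [hN]; gcongr
      _ = 10 * X ^ ((b : ℝ) + 1) := by
        rw [Real.rpow_add_one hX0.ne', Real.rpow_natCast]; ring
  · push_cast
    calc (p.N : ℝ) * c ≤ X ^ b * (C₁ * X ^ (p.r * β)) := by rw [hN]; gcongr
      _ = C₁ * X ^ (b + p.r * β) := by
        rw [Real.rpow_add hX0, Real.rpow_natCast]; ring
  · push_cast
    have h1 : 1 ≤ X ^ (p.r * β) := Real.one_le_rpow hX (by positivity)
    calc ((c : ℝ) + 120) * p.threshold C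
        ≤ ((C₁ + 120) * X ^ (p.r * β)) * (C * X ^ (3 * b - (p.r - 1) : ℝ)) := by
          gcongr
          · linarith
          · exact threshold_le hX hXq hN hr1
      _ = (C₁ + 120) * C * X ^ (3 * b - (p.r - 1) + p.r * β) := by
        rw [Real.rpow_add hX0]; ring

end Par

/-! ### The reduction from 3SUM -/

open Par

theorem guest_threeSumInput (n : ℕ) (a : ℕ → ℕ) :
    (threeSumInput n a).guest = ⟨fun _ => 0, fun _ _ => 0⟩ := by
  ext r
  · simp [State.guest, threeSumInput]
  · simp [State.guest, threeSumInput]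

/-- The saving `δ` depends on `α` and `ε` alone. The exponent `c` of the universe affects only the
constants and the word length, which is the order of quantifiers needed to refute the hypothesis. -/
theorem threeSumSolvable_of_dataStructure {α ε : ℝ} (hα0 : 0 < α) (hα1 : α < 1) (hε : 0 < ε)
    (h : ConvWitnessDataStructure
        (fun n => (n : ℝ) ^ (2 - α)) (fun n => (n : ℝ) ^ (α / 2 - ε))) :
    ∃ δ : ℝ, 0 < δ ∧ ∀ c : ℕ, ThreeSumSolvable c (fun n => (n : ℝ) ^ (2 - δ)) := by
  -- The exponent of the query time may be negative. It is raised to at least `0`, so that rounding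
  -- the time up to an integer costs only a constant factor.
  obtain ⟨β, hβ0, hβ1, hβε⟩ : ∃ β : ℝ, 0 ≤ β ∧ β < α / 2 ∧ α / 2 - ε ≤ β :=
    ⟨max 0 (α / 2 - ε), le_max_left _ _, max_lt (by linarith) (by linarith), le_max_right _ _⟩
  obtain ⟨b, r, hr1, hb2, hb₁, hb₂, hb₃⟩ := exists_exponents hα0 hα1 hβ1
  have hbR : (2 : ℝ) ≤ b := by exact_mod_cast hb2
  have hrR : (1 : ℝ) ≤ r := by exact_mod_cast hr1
  have hb₃' : (r : ℝ) + 2 < 2 * b := by exact_mod_cast hb₃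
  obtain ⟨γ, g1, g2, g3, g4, g5, hγ⟩ : ∃ γ : ℝ, (r : ℝ) + 2 ≤ γ ∧ (b : ℝ) + 1 ≤ γ ∧
      b + r * β ≤ γ ∧ r * (2 - α) ≤ γ ∧ 3 * b - (r - 1) + r * β ≤ γ ∧ γ < 2 * b := by
    refine ⟨max (r + 2) (max (b + 1) (max (b + r * β) (max (r * (2 - α))
      (3 * b - (r - 1) + r * β)))), by simp, by simp, by simp, by simp, by simp, ?_⟩
    simp only [max_lt_iff]
    refine ⟨hb₃', by linarith, by nlinarith, hb₁, by nlinarith⟩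
  obtain ⟨pre, qry, κ, C, hDS⟩ := h
  refine ⟨2 - γ / b, by rw [sub_pos, div_lt_iff₀ (by linarith)]; exact hγ, fun cc => ?_⟩
  obtain ⟨κ', hκ'⟩ := exists_wordLength b r cc (b * cc + 1) κ
  set C₂ := threshConst (b * cc + 1) r with hC₂
  -- The vectors have length at most `(10 * X) ^ r`, and both exponents used are at most `2`. The
  -- summand `1` pays for rounding up.
  set C₁ : ℝ := |C| * (10 ^ r) ^ (2 : ℝ) + 1 with hC₁
  refine ⟨mainProg r b (3 * b - 1) C₂ pre qry, κ',
    (100 + 10 ^ (r + 2) + C₁ + (C₁ + 120) * C₂) * timeFactor b (3 * b - 1) r, ?_⟩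
  intro N hN A hA hcard a ha
  obtain ⟨hw, hw'⟩ := hκ' N hN
  obtain ⟨q, hq, hq5, hNq, hqN, hqmin⟩ := exists_least_prime N b hN (by omega)
  obtain ⟨X, hXN⟩ : ∃ X : ℝ, X = (N : ℝ) ^ (b : ℝ)⁻¹ := ⟨_, rfl⟩
  have hX1 : 1 ≤ X := by
    rw [hXN]; exact Real.one_le_rpow (by exact_mod_cast hN) (by positivity)
  have hXb : (N : ℝ) = X ^ b := by
    rw [hXN, Real.rpow_inv_natCast_pow (Nat.cast_nonneg _) (by omega)]
  have hXq : X ≤ q := by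
    refine (lt_of_pow_lt_pow_left₀ b (Nat.cast_nonneg _) ?_).le
    rw [← hXb]; exact_mod_cast hNq
  have hqX : (q : ℝ) ≤ 10 * X := by
    refine le_of_pow_le_pow_left₀ (n := b) (by omega) (by linarith) ?_
    rw [mul_pow, ← hXb]; exact_mod_cast hqN
  have hXγ : X ^ γ = (N : ℝ) ^ (2 - (2 - γ / b)) := by
    rw [hXN, ← Real.rpow_mul (Nat.cast_nonneg _)]; congr 1; field_simp; ring
  have haA : ∀ x < N, a (x + 1) ∈ A := fun x hx => ha.mapsTo ⟨by omega, by omega⟩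
  have haN : ∀ x < N, a (x + 1) ≤ N ^ cc := fun x hx => (Finset.mem_Icc.mp (hA (haA x hx))).2
  let p : Par := ⟨N, fun x => a (x + 1), q, r, 3 * b - 1, wordLength κ' N⟩
  have hp : p.Ok (bound N b r cc (b * cc + 1)) :=
    ok_of_bound (p := p) hq hq5 hr1 (show r ≤ 3 * b by omega) (show 3 * b - 1 + 1 = 3 * b by omega)
      hN hNq hqN haN hw
  have hDq : p.D + 1 ≤ q ^ r := by
    have : (q - 1) ^ r < q ^ r := Nat.pow_lt_pow_left (by omega) (by omega)
    exact this
  have hDX : ((p.D + 1 : ℕ) : ℝ) ≤ 10 ^ r * X ^ r := by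
    calc ((p.D + 1 : ℕ) : ℝ) ≤ ((q ^ r : ℕ) : ℝ) := by exact_mod_cast hDq
      _ = (q : ℝ) ^ r := by push_cast; rfl
      _ ≤ (10 * X) ^ r := by gcongr
      _ = _ := mul_pow _ _ _
  have h10 : (1 : ℝ) ≤ 10 ^ r := one_le_pow₀ (by norm_num)
  have hDpow : ∀ y : ℝ, 0 ≤ y → y ≤ 2 →
      ((p.D + 1 : ℕ) : ℝ) ^ y ≤ (10 ^ r) ^ (2 : ℝ) * X ^ (r * y) := by
    intro y hy hy2
    calc ((p.D + 1 : ℕ) : ℝ) ^ y ≤ (10 ^ r * X ^ r) ^ y :=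
          Real.rpow_le_rpow (Nat.cast_nonneg _) hDX hy
      _ = (10 ^ r) ^ y * X ^ (r * y) := by
        rw [Real.mul_rpow (by positivity) (by positivity), ← Real.rpow_natCast X r,
          ← Real.rpow_mul (by linarith)]
      _ ≤ _ := by gcongr
  have hD1 : (1 : ℝ) ≤ ((p.D + 1 : ℕ) : ℝ) := by push_cast; linarith [(p.D.cast_nonneg : (0 : ℝ) ≤ _)]
  set c := ⌈|C| * ((p.D + 1 : ℕ) : ℝ) ^ (α / 2 - ε)⌉₊ with hcdef
  set T₀ := ⌊|C| * ((p.D + 1 : ℕ) : ℝ) ^ (2 - α)⌋₊ with hTdef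
  have hT : (T₀ : ℝ) ≤ C₁ * X ^ (p.r * (2 - α)) := by
    have hx : 0 ≤ X ^ (r * (2 - α)) := by positivity
    calc (T₀ : ℝ) ≤ |C| * ((p.D + 1 : ℕ) : ℝ) ^ (2 - α) := Nat.floor_le (by positivity)
      _ ≤ |C| * ((10 ^ r) ^ (2 : ℝ) * X ^ (r * (2 - α))) := by
        gcongr; exact hDpow _ (by linarith) (by linarith)
      _ ≤ C₁ * X ^ (r * (2 - α)) := by rw [hC₁]; linarith
  have hc : (c : ℝ) ≤ C₁ * X ^ (p.r * β) := by
    have hx : 1 ≤ X ^ (r * β) := Real.one_le_rpow hX1 (by positivity)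
    calc (c : ℝ) ≤ |C| * ((p.D + 1 : ℕ) : ℝ) ^ (α / 2 - ε) + 1 := (Nat.ceil_lt_add_one (by positivity)).le
      _ ≤ |C| * ((p.D + 1 : ℕ) : ℝ) ^ β + 1 := by gcongr
      _ ≤ |C| * ((10 ^ r) ^ (2 : ℝ) * X ^ (r * β)) + 1 := by
        gcongr; exact hDpow _ hβ0 (by linarith)
      _ ≤ C₁ * X ^ (r * β) := by rw [hC₁]; linarith
  have hrun := runs_mainProg (p := p) (b := b) (k := b * cc + 1) (T₀ := T₀) (c := c)
    (w' := wordLength κ (p.D + 1)) (pre := pre) (qry := qry) hp (s := threeSumInput N a) rfl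
    (show b ≤ 3 * b - 1 + 1 by omega) (show r ≤ 3 * b - 1 + 1 by omega) hNq hqmin ?_
    (guest_threeSumInput N a) ?_ (bound_ge hN).2.2.2.2.2.1
    (hw' _ (by have h1 := hp.hD; have h2 := hp.hM; omega)) ?_
  · obtain ⟨t, s₀, s', hex, ht, hsim, hpost⟩ := hrun _ (Sim.refl _)
    refine ⟨t, s₀, hex, ?_, ?_⟩
    · rw [hsim.1 0 rfl, hpost]
      simp only [NoSol, not_forall, not_not]
      constructor
      · rintro ⟨x, hx, y, hy, z, hz, hxyz⟩
        exact ⟨_, haA x hx, _, haA y hy, _, haA z hz, hxyz⟩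
      · have hsurj : ∀ v ∈ A, ∃ x, ∃ _ : x < N, a (x + 1) = v := by
          intro v hv
          obtain ⟨i, ⟨hi1, hi2⟩, rfl⟩ := ha.surjOn hv
          exact ⟨i - 1, by omega, by rw [Nat.sub_add_cancel hi1]⟩
        rintro ⟨x, hx, y, hy, z, hz, hxyz⟩
        obtain ⟨x', hx', rfl⟩ := hsurj x hx
        obtain ⟨y', hy', rfl⟩ := hsurj y hy
        obtain ⟨z', hz', rfl⟩ := hsurj z hz
        exact ⟨x', hx', y', hy', z', hz', hxyz⟩
    · beta_reduce
      rw [← hXγ]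
      refine le_trans (by exact_mod_cast ht) (mainTime_le_rpow (p := p) hq5 hN hr1 hX1 hXq hqX hXb
        (by positivity) hβ0 hT hc g1 g2 g3 g4 g5)
  · intro x hx
    have : x + 1 ≤ N := hx
    simp [threeSumInput, p, this]
  · intro x hx
    -- As `N < q ^ b`, the inputs are at most `q ^ (b * cc)`, and one more factor `q` covers the
    -- `2`; hence `k = b * cc + 1`.
    have h1 : a (x + 1) ≤ q ^ (b * cc) := by
      rw [pow_mul]; exact (haN x hx).trans (Nat.pow_le_pow_left hNq.le _)
    calc 2 * a (x + 1) ≤ q * q ^ (b * cc) := Nat.mul_le_mul (by omega) h1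
      _ = q ^ (b * cc + 1) := (pow_succ' _ _).symm
      _ < (2 ^ (Nat.log 2 q + 1)) ^ (b * cc + 1) :=
        Nat.pow_lt_pow_left (Nat.lt_pow_succ_log_self (by norm_num) q) (by omega)
      _ = 2 ^ ((b * cc + 1) * (Nat.log 2 q + 1)) := by rw [← pow_mul, mul_comm]
  · intro P
    obtain ⟨t₀, s₀, h1, h2, h3⟩ := hDS (p.D + 1) (by omega) (p.vec P) (p.vec P)
    refine ⟨t₀, s₀, h1, ?_, ?_⟩
    · refine Nat.le_floor (h2.trans ?_)
      gcongr; exact le_abs_self C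
    · intro s hs k hk
      obtain ⟨t, s', e1, e2, e3⟩ := h3 s hs k hk
      refine ⟨t, s', e1, e2, ?_⟩
      generalize (convWitnesses (p.D + 1) (p.vec P) (p.vec P) k).card = W at e3 ⊢
      have hcW : (t : ℝ) ≤ c * (1 + W) := by
        refine e3.trans ?_
        gcongr
        refine le_trans ?_ (Nat.le_ceil _)
        gcongr; exact le_abs_self C
      exact_mod_cast hcW

end WordRAM

theorem theoremC1 (α : ℝ) (hα0 : 0 < α) (hα1 : α < 1)
    (h3SUM : DeterministicThreeSumHypothesis) (ε : ℝ) (hε : 0 < ε) :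
    ¬ ConvWitnessDataStructure
        (fun n => (n : ℝ) ^ (2 - α)) (fun n => (n : ℝ) ^ (α / 2 - ε)) := by
  intro h
  obtain ⟨δ, hδ, hsol⟩ := WordRAM.threeSumSolvable_of_dataStructure hα0 hα1 hε h
  obtain ⟨c, hc⟩ := h3SUM δ hδ
  exact hc (hsol c)
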